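/- Let $\rho$ be a primitive cube root of unity and $f_t=x^3+y^3+z^3+txyz$, for $t$ in $C=\{t\in\mathbb C: t^3\neq-27\}$. Let $\mathcal O=\mathbb C[[x,y,z]]$ with maximal ideal $m$ and $J(f)=\langle\partial_xf,\partial_yf,\partial_zf\rangle$. Put $A^k(t)=\mathcal O/\langle f_t,\,m^kJ(f_t)\rangle$ for $k\in\mathbb Z_{\ge0}$ and $A^\infty(t)=\mathcal O/\langle f_t\rangle$. Let $\mathrm{Grp}^k(\tilde E_6)$ be the groupoid with object set $C$ in which the morphisms $t\to s$ are the homogeneous (degree-preserving) $\mathbb C$-algebra isomorphisms $\varphi:A^k(t)\to A^k(s)$ modulo the action of $\mathbb C^*$ by $x_j\mapsto\lambda x_j$. To $\varphi$ one attaches the class in $\mathrm{PGL}_3(\mathbb C)$ of the matrix $B$ of $\varphi$ in degree one, $\varphi(x_j)=\sum_iB_{ij}x_i$ with $(x_1,x_2,x_3)=(x,y,z)$. Let $G\subset \mathrm{PGL}_3(\mathbb C)$ be the subgroup generated by $$A_1=\begin{pmatrix}\rho&0&0\\0&1&0\\0&0&1\end{pmatrix},\ A_2=\begin{pmatrix}\rho&\rho^2&1\\\rho^2&\rho&1\\1&1&1\end{pmatrix},\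 A_3=\begin{pmatrix}0&1&0\\1&0&0\\0&0&1\end{pmatrix},\ A_4=\begin{pmatrix}1&0&0\\0&0&1\\0&1&0\end{pmatrix},$$ and let $H$ be the group of fractional linear transformations of $C$ generated by $P:t\mapsto\rho t$ and $R:t\mapsto\frac{18-3t}{3+t}$. Then $G$ has order $216$, $H$ has order $12$ and is isomorphic to the alternating group $A_4$ on four letters, and there is a group homomorphism $\pi:G\to H$ sending (the classes of) $A_1,A_2,A_3,A_4$ to $P,R,\mathrm{Id},\mathrm{Id}$. Let $G$ act on $C$ through $\pi$, and let $C^\circ=C\setminus\{0,6,6\rho,6\rho^2\}$, which is stable under this action. (1) For $k=0$ and $k=1$, the map that is the identity on objects and sends $[\varphi]$ to $[B]$ is an isomorphism of groupoids from the full subgroupoid of $\mathrm{Grp}^k(\tilde E_6)$ on $C^\circ$ onto the action groupoid of $G$ on $C^\circ$ (objects: the points of $C^\circ$; morphisms $t\to s$: the $g\in G$ with $\pi(g)t=s$). (2) For every integer $k\ge2$ and for $k=\infty$, the same map is an isomorphism of groupoids from $\mathrm{Grp}^k(\tilde E_6)$ onto the action groupoid of $G$ on $C$. (3) For $t\in C^\circ$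 let $L^1(t)=\mathrm{Der}_{\mathbb C}(A^1(t))$ be the first Yau algebra. There are a solvable complex Lie algebra $L$ with a basis $e_1,\dots,e_{22}$ and isomorphisms of Lie algebras $\Phi_t:L\to L^1(t)$ for $t\in C^\circ$, so that the basis $\Phi_t(e_1),\dots,\Phi_t(e_{22})$ of $L^1(t)$ has structure constants independent of $t$. Moreover $1,x,y,z,x^2,y^2,z^2,xy,xz,yz,xyz$ is a basis of $A^1(t)$ for every $t\in C^\circ$, and in this basis the action of $L$ on $A^1(t)$ through $\Phi_t$ is a family of $11$-dimensional matrix representations of $L$ that depends continuously on $t\in C^\circ$. No Torelli-type theorem holds: there are $t,s\in C^\circ$ with $L^1(t)\cong L^1(s)$ as Lie algebras such that $f_t$ and $f_s$ are not contact equivalent, i.e. there are no $\phi\in\mathrm{Aut}_{\mathbb C}(\mathcal O)$ and $u\in\mathcal O^*$ with $\phi(f_t)=u f_s$. -/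

import Mathlib

noncomputable section

/-! ### Moduli algebras, Yau algebras and homogeneous isomorphisms -/

/-- The formal power series ring `ℂ⟦x₁, …, xₙ⟧`. -/
abbrev FormalRing (n : ℕ) : Type := MvPowerSeries (Fin n) ℂ

/-- The Jacobi ideal `J(f) = ⟨∂₁ f, …, ∂ₙ f⟩`. -/
def jacobiIdeal {n : ℕ} (f : FormalRing n) : Ideal (FormalRing n) :=
  Ideal.span (Set.range fun i : Fin n => MvPowerSeries.pderiv ℂ i f)

/-- The ideal `⟨f, m ^ k J(f)⟩` for finite `k`, and `⟨f⟩` for `k = ∞`. -/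
def moduliIdeal {n : ℕ} (f : FormalRing n) (k : ℕ∞) : Ideal (FormalRing n) :=
  ENat.recTopCoe (C := fun _ => Ideal (FormalRing n))
    (Ideal.span {f})
    (fun j => Ideal.span {f} ⊔ IsLocalRing.maximalIdeal (FormalRing n) ^ j * jacobiIdeal f) k

/-- The `k`-th moduli algebra of `f`; for `k = ∞` the local function algebra. -/
abbrev ModuliAlgebra {n : ℕ} (f : FormalRing n) (k : ℕ∞) : Type :=
  FormalRing n ⧸ moduliIdeal f k

/-- The class of a power series in the `k`-th moduli algebra. -/
def toModuli {n : ℕ} (f : FormalRing n) (k : ℕ∞) : FormalRing n →ₐ[ℂ] ModuliAlgebra f k :=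
  Ideal.Quotient.mkₐ ℂ (moduliIdeal f k)

/-- The `k`-th Yau algebra: the Lie algebra of derivations of the `k`-th moduli algebra. -/
abbrev YauAlgebra {n : ℕ} (f : FormalRing n) (k : ℕ∞) : Type :=
  Derivation ℂ (ModuliAlgebra f k) (ModuliAlgebra f k)

/-- Contact equivalence: `φ f = u g` for an automorphism `φ` and a unit `u`. -/
def ContactEquivalent {n : ℕ} (f g : FormalRing n) : Prop :=
  ∃ (φ : FormalRing n ≃ₐ[ℂ] FormalRing n) (u : (FormalRing n)ˣ), φ f = u * g

/-- The classes in the moduli algebra of the homogeneous polynomials of degree `d`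
(all variables have weight one). -/
def gradedPiece {n : ℕ} (f : FormalRing n) (k : ℕ∞) (d : ℕ) :
    Submodule ℂ (ModuliAlgebra f k) :=
  (MvPolynomial.homogeneousSubmodule (Fin n) ℂ d).map
    ((toModuli f k).comp (MvPolynomial.coeToMvPowerSeries.algHom ℂ)).toLinearMap

/-- A homogeneous isomorphism of `k`-th moduli algebras: an isomorphism of `ℂ`-algebras that
respects the weights. -/
structure HomogeneousIso {n : ℕ} (f g : FormalRing n) (k : ℕ∞) where
  toAlgEquiv : ModuliAlgebra f k ≃ₐ[ℂ] ModuliAlgebra g k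
  map_gradedPiece : ∀ d : ℕ,
    (gradedPiece f k d).map toAlgEquiv.toLinearMap = gradedPiece g k d

namespace HomogeneousIso

variable {n : ℕ} {f g h : FormalRing n} {k : ℕ∞}

theorem mem_piece (φ : HomogeneousIso f g k) {d : ℕ} {a : ModuliAlgebra f k}
    (ha : a ∈ gradedPiece f k d) : φ.toAlgEquiv a ∈ gradedPiece g k d := by
  rw [← φ.map_gradedPiece d]
  exact Submodule.mem_map_of_mem (f := φ.toAlgEquiv.toLinearMap) ha

theorem symm_mem_piece (φ : HomogeneousIso f g k) {d : ℕ} {b : ModuliAlgebra g k}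
    (hb : b ∈ gradedPiece g k d) : φ.toAlgEquiv.symm b ∈ gradedPiece f k d := by
  rw [← φ.map_gradedPiece d] at hb
  obtain ⟨a, ha, rfl⟩ := hb
  have h1 : φ.toAlgEquiv.symm (φ.toAlgEquiv.toLinearMap a) = a := φ.toAlgEquiv.symm_apply_apply a
  rw [h1]
  exact ha

/-- The identity. -/
def refl (f : FormalRing n) (k : ℕ∞) : HomogeneousIso f f k where
  toAlgEquiv := AlgEquiv.refl
  map_gradedPiece d := by
    ext a
    constructor
    · rintro ⟨b, hb, rfl⟩
      exact hb
    · intro ha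
      exact ⟨a, ha, rfl⟩

/-- The inverse. -/
def symm (φ : HomogeneousIso f g k) : HomogeneousIso g f k where
  toAlgEquiv := φ.toAlgEquiv.symm
  map_gradedPiece d := by
    ext a
    constructor
    · rintro ⟨b, hb, rfl⟩
      exact φ.symm_mem_piece hb
    · intro ha
      exact ⟨φ.toAlgEquiv a, φ.mem_piece ha, φ.toAlgEquiv.symm_apply_apply a⟩

/-- The composite, first `φ` and then `ψ`. -/
def trans (φ : HomogeneousIso f g k) (ψ : HomogeneousIso g h k) : HomogeneousIso f h k where
  toAlgEquiv := φ.toAlgEquiv.trans ψ.toAlgEquiv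
  map_gradedPiece d := by
    ext a
    constructor
    · rintro ⟨b, hb, rfl⟩
      exact ψ.mem_piece (φ.mem_piece hb)
    · intro ha
      refine ⟨φ.toAlgEquiv.symm (ψ.toAlgEquiv.symm a),
        φ.symm_mem_piece (ψ.symm_mem_piece ha), ?_⟩
      change ψ.toAlgEquiv (φ.toAlgEquiv (φ.toAlgEquiv.symm (ψ.toAlgEquiv.symm a))) = a
      simp

/-- Two homogeneous isomorphisms agree modulo scalars when they differ by the action of some
`c ∈ ℂ*`, which multiplies the elements of weight `d` by `c ^ d`. -/
def scalarSetoid (f g : FormalRing n) (k : ℕ∞) : Setoid (HomogeneousIso f g k) where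
  r φ ψ := ∃ c : ℂ, c ≠ 0 ∧ ∀ d : ℕ, ∀ a ∈ gradedPiece f k d,
    φ.toAlgEquiv a = c ^ d • ψ.toAlgEquiv a
  iseqv :=
    { refl := fun φ => ⟨1, one_ne_zero, fun d a _ => by simp⟩
      symm := by
        rintro φ ψ ⟨c, hc, H⟩
        refine ⟨c⁻¹, inv_ne_zero hc, fun d a ha => ?_⟩
        rw [H d a ha, smul_smul, ← mul_pow, inv_mul_cancel₀ hc, one_pow, one_smul]
      trans := by
        rintro φ ψ χ ⟨c, hc, H⟩ ⟨c', hc', H'⟩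
        refine ⟨c * c', mul_ne_zero hc hc', fun d a ha => ?_⟩
        rw [H d a ha, H' d a ha, smul_smul, ← mul_pow] }

/-- Homogeneous isomorphisms modulo scalars. -/
def Class (f g : FormalRing n) (k : ℕ∞) : Type := Quotient (scalarSetoid f g k)

/-- The class of a homogeneous isomorphism modulo scalars. -/
def toClass (φ : HomogeneousIso f g k) : Class f g k := Quotient.mk (scalarSetoid f g k) φ

/-- Composition of classes. -/
def Class.trans (p : Class f g k) (q : Class g h k) : Class f h k :=
  Quotient.map₂ (fun φ ψ => HomogeneousIso.trans φ ψ) (by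
    rintro φ φ' ⟨c, hc, H⟩ ψ ψ' ⟨c', hc', H'⟩
    refine ⟨c * c', mul_ne_zero hc hc', fun d a ha => ?_⟩
    change ψ.toAlgEquiv (φ.toAlgEquiv a) = (c * c') ^ d • ψ'.toAlgEquiv (φ'.toAlgEquiv a)
    rw [H d a ha, map_smul, H' d _ (φ'.mem_piece ha), smul_smul, ← mul_pow]) p q

/-- Inverses of classes. -/
def Class.symm (p : Class f g k) : Class g f k :=
  Quotient.map (fun φ => HomogeneousIso.symm φ) (by
    rintro φ ψ ⟨c, hc, H⟩
    refine ⟨c⁻¹, inv_ne_zero hc, fun d b hb => ?_⟩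
    change φ.toAlgEquiv.symm b = c⁻¹ ^ d • ψ.toAlgEquiv.symm b
    rw [AlgEquiv.symm_apply_eq, map_smul, H d _ (ψ.symm_mem_piece hb), smul_smul, ← mul_pow,
      inv_mul_cancel₀ hc, one_pow, one_smul, AlgEquiv.apply_symm_apply]) p

@[ext] theorem ext {φ ψ : HomogeneousIso f g k} (H : φ.toAlgEquiv = ψ.toAlgEquiv) : φ = ψ := by
  cases φ
  cases ψ
  cases H
  rfl

theorem Class.trans_toClass (φ : HomogeneousIso f g k) (ψ : HomogeneousIso g h k) :
    Class.trans φ.toClass ψ.toClass = (φ.trans ψ).toClass := rfl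

theorem Class.symm_toClass (φ : HomogeneousIso f g k) :
    Class.symm φ.toClass = φ.symm.toClass := rfl

theorem toClass_surjective (p : Class f g k) : ∃ φ : HomogeneousIso f g k, φ.toClass = p :=
  Quotient.exists_rep p

theorem Class.refl_trans (p : Class f g k) : Class.trans (refl f k).toClass p = p := by
  obtain ⟨φ, rfl⟩ := toClass_surjective p
  rw [Class.trans_toClass]
  exact congrArg toClass (HomogeneousIso.ext (AlgEquiv.ext fun _ => rfl))

theorem Class.trans_refl (p : Class f g k) : Class.trans p (refl g k).toClass = p := by
  obtain ⟨φ, rfl⟩ := toClass_surjective p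
  rw [Class.trans_toClass]
  exact congrArg toClass (HomogeneousIso.ext (AlgEquiv.ext fun _ => rfl))

theorem trans_assoc {l : FormalRing n} (φ : HomogeneousIso f g k) (ψ : HomogeneousIso g h k)
    (χ : HomogeneousIso h l k) : (φ.trans ψ).trans χ = φ.trans (ψ.trans χ) := by
  apply HomogeneousIso.ext
  apply AlgEquiv.ext
  intro a
  have H : ∀ {f₁ f₂ f₃ : FormalRing n} (α : HomogeneousIso f₁ f₂ k) (β : HomogeneousIso f₂ f₃ k)
      (b : ModuliAlgebra f₁ k), (α.trans β).toAlgEquiv b = β.toAlgEquiv (α.toAlgEquiv b) :=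
    fun _ _ _ => rfl
  rw [H, H, H, H]

theorem Class.trans_assoc {l : FormalRing n} (p : Class f g k) (q : Class g h k)
    (r : Class h l k) :
    Class.trans (Class.trans p q) r = Class.trans p (Class.trans q r) := by
  obtain ⟨φ, rfl⟩ := toClass_surjective p
  obtain ⟨ψ, rfl⟩ := toClass_surjective q
  obtain ⟨χ, rfl⟩ := toClass_surjective r
  rw [Class.trans_toClass, Class.trans_toClass, Class.trans_toClass, Class.trans_toClass,
    HomogeneousIso.trans_assoc]

theorem Class.symm_trans (p : Class f g k) : Class.trans p.symm p = (refl g k).toClass := by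
  obtain ⟨φ, rfl⟩ := toClass_surjective p
  rw [Class.symm_toClass, Class.trans_toClass]
  exact congrArg toClass (HomogeneousIso.ext (AlgEquiv.symm_trans_self φ.toAlgEquiv))

theorem Class.trans_symm (p : Class f g k) : Class.trans p p.symm = (refl f k).toClass := by
  obtain ⟨φ, rfl⟩ := toClass_surjective p
  rw [Class.symm_toClass, Class.trans_toClass]
  exact congrArg toClass (HomogeneousIso.ext (AlgEquiv.self_trans_symm φ.toAlgEquiv))

end HomogeneousIso

/-! ### The family `x³ + y³ + z³ + t x y z` and its groupoids -/

/-- The polynomial `x³ + y³ + z³ + t x y z`. -/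
def e6Poly (t : ℂ) : FormalRing 3 :=
  MvPowerSeries.X 0 ^ 3 + MvPowerSeries.X 1 ^ 3 + MvPowerSeries.X 2 ^ 3 +
    MvPowerSeries.C t * (MvPowerSeries.X 0 * MvPowerSeries.X 1 * MvPowerSeries.X 2)

/-- The parameters with an isolated singularity. -/
abbrev E6Param : Type := {t : ℂ // t ^ 3 ≠ -27}

/-- The groupoid whose objects are the parameters and whose morphisms `t ⟶ s` are the homogeneous
isomorphisms from the `k`-th moduli algebra at `t` to that at `s`, modulo scalars. -/
@[ext] structure E6Groupoid (k : ℕ∞) : Type where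
  param : E6Param

instance (k : ℕ∞) : CategoryTheory.Groupoid (E6Groupoid k) where
  Hom t s := HomogeneousIso.Class (e6Poly t.param) (e6Poly s.param) k
  id t := (HomogeneousIso.refl (e6Poly t.param) k).toClass
  comp p q := HomogeneousIso.Class.trans p q
  id_comp p := HomogeneousIso.Class.refl_trans p
  comp_id p := HomogeneousIso.Class.trans_refl p
  assoc p q r := HomogeneousIso.Class.trans_assoc p q r
  inv p := HomogeneousIso.Class.symm p
  inv_comp p := HomogeneousIso.Class.symm_trans p
  comp_inv p := HomogeneousIso.Class.trans_symm p

/-- The morphism `m` is the class of a homogeneous isomorphism `φ` whose matrix in weight one, with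
respect to the coordinates, is `B`: `φ (x_j) = ∑ i, B i j x_i`. -/
def E6Groupoid.HasMatrix {k : ℕ∞} {t s : E6Groupoid k} (m : t ⟶ s)
    (B : Matrix.GeneralLinearGroup (Fin 3) ℂ) : Prop :=
  ∃ φ : HomogeneousIso (e6Poly t.param) (e6Poly s.param) k, φ.toClass = m ∧
    ∀ j : Fin 3, φ.toAlgEquiv (toModuli (e6Poly t.param) k (MvPowerSeries.X j)) =
      ∑ i : Fin 3, (B : Matrix (Fin 3) (Fin 3) ℂ) i j •
        toModuli (e6Poly s.param) k (MvPowerSeries.X i)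

/-! ### The groups `G` and `H` -/

/-- A primitive cube root of unity satisfies `ρ ^ 2 + ρ + 1 = 0`. -/
theorem cubeRoot_relation {ρ : ℂ} (hρ : IsPrimitiveRoot ρ 3) : ρ ^ 2 + ρ + 1 = 0 := by
  have h := hρ.geom_sum_eq_zero (by norm_num)
  simp only [Finset.sum_range_succ, Finset.sum_range_zero] at h
  linear_combination h

/-- The matrices `A₁, A₂, A₃, A₄`. -/
def hesseMatrix (ρ : ℂ) : Fin 4 → Matrix (Fin 3) (Fin 3) ℂ :=
  ![!![ρ, 0, 0; 0, 1, 0; 0, 0, 1],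
    !![ρ, ρ ^ 2, 1; ρ ^ 2, ρ, 1; 1, 1, 1],
    !![0, 1, 0; 1, 0, 0; 0, 0, 1],
    !![1, 0, 0; 0, 0, 1; 0, 1, 0]]

theorem hesseMatrix_det_ne_zero {ρ : ℂ} (hρ : IsPrimitiveRoot ρ 3) (i : Fin 4) :
    (hesseMatrix ρ i).det ≠ 0 := by
  have h0 : ρ ≠ 0 := hρ.ne_zero (by norm_num)
  have h1 : ρ ≠ 1 := hρ.ne_one (by norm_num)
  have h2 := cubeRoot_relation hρ
  fin_cases i
  · simp [hesseMatrix, Matrix.det_fin_three, h0]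
  · have h3 : (hesseMatrix ρ 1).det = -3 * (2 * ρ + 1) := by
      simp [hesseMatrix, Matrix.det_fin_three]
      linear_combination (-ρ ^ 2 + ρ + 3) * h2
    have h4 : 2 * ρ + 1 ≠ 0 := by
      intro h5
      have h6 : (3 : ℂ) = 0 := by linear_combination 4 * h2 - (2 * ρ + 1) * h5
      norm_num at h6
    change (hesseMatrix ρ 1).det ≠ 0
    rw [h3]
    exact mul_ne_zero (by norm_num) h4
  · simp [hesseMatrix, Matrix.det_fin_three]
  · simp [hesseMatrix, Matrix.det_fin_three]

/-- The classes of `A₁, A₂, A₃, A₄` in `PGL₃(ℂ)`. -/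
def hesseElement {ρ : ℂ} (hρ : IsPrimitiveRoot ρ 3) (i : Fin 4) :
    Matrix.ProjGenLinGroup (Fin 3) ℂ :=
  Matrix.ProjGenLinGroup.mk
    (Matrix.GeneralLinearGroup.mkOfDetNeZero (hesseMatrix ρ i) (hesseMatrix_det_ne_zero hρ i))

/-- The group `G`, generated by the classes of `A₁, A₂, A₃, A₄` in `PGL₃(ℂ)`. -/
def groupG {ρ : ℂ} (hρ : IsPrimitiveRoot ρ 3) : Subgroup (Matrix.ProjGenLinGroup (Fin 3) ℂ) :=
  Subgroup.closure (Set.range (hesseElement hρ))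

/-- The generators of `G`, as elements of `G`. -/
def genG {ρ : ℂ} (hρ : IsPrimitiveRoot ρ 3) (i : Fin 4) : groupG hρ :=
  ⟨hesseElement hρ i, Subgroup.subset_closure (Set.mem_range_self i)⟩

/-- The transformation `P : t ↦ ρ t` of the parameters. -/
def permP {ρ : ℂ} (hρ : IsPrimitiveRoot ρ 3) : Equiv.Perm E6Param where
  toFun t := ⟨ρ * t, by
    rw [mul_pow, hρ.pow_eq_one, one_mul]
    exact t.2⟩
  invFun t := ⟨ρ ^ 2 * t, by
    have h : (ρ ^ 2 * (t : ℂ)) ^ 3 = (ρ ^ 3) ^ 2 * (t : ℂ) ^ 3 := by ring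
    rw [h, hρ.pow_eq_one, one_pow, one_mul]
    exact t.2⟩
  left_inv t := Subtype.ext (by
    change ρ ^ 2 * (ρ * (t : ℂ)) = t
    linear_combination (t : ℂ) * hρ.pow_eq_one)
  right_inv t := Subtype.ext (by
    change ρ * (ρ ^ 2 * (t : ℂ)) = t
    linear_combination (t : ℂ) * hρ.pow_eq_one)

theorem three_add_ne_zero (t : E6Param) : 3 + (t : ℂ) ≠ 0 := by
  intro h
  have h1 : (t : ℂ) = -3 := by linear_combination h
  refine t.2 ?_
  rw [h1]
  norm_num

/-- The fractional linear map `t ↦ (18 - 3 t) / (3 + t)` on the parameters. -/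
def mapR (t : E6Param) : E6Param :=
  ⟨(18 - 3 * t) / (3 + t), by
    have h := three_add_ne_zero t
    intro h1
    rw [div_pow, div_eq_iff (pow_ne_zero 3 h)] at h1
    have h2 : (t : ℂ) ^ 2 * 729 = 729 * (3 * (t : ℂ) - 9) := by
      linear_combination h1
    refine t.2 ?_
    linear_combination ((t : ℂ) + 3) / 729 * h2⟩

theorem mapR_mapR (t : E6Param) : mapR (mapR t) = t := by
  have h := three_add_ne_zero t
  have h' := three_add_ne_zero (mapR t)
  refine Subtype.ext ?_
  change (18 - 3 * ((18 - 3 * (t : ℂ)) / (3 + t))) / (3 + (18 - 3 * (t : ℂ)) / (3 + t)) = t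
  change 3 + (18 - 3 * (t : ℂ)) / (3 + t) ≠ 0 at h'
  rw [div_eq_iff h']
  field_simp
  ring

/-- The transformation `R : t ↦ (18 - 3 t) / (3 + t)` of the parameters. -/
def permR : Equiv.Perm E6Param where
  toFun := mapR
  invFun := mapR
  left_inv := mapR_mapR
  right_inv := mapR_mapR

/-- The group `H` of fractional linear transformations generated by `P` and `R`. -/
def groupH {ρ : ℂ} (hρ : IsPrimitiveRoot ρ 3) : Subgroup (Equiv.Perm E6Param) :=
  Subgroup.closure {permP hρ, permR}

/-- The jump points `0, 6, 6 ρ, 6 ρ²`. -/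
def jumpPoints (ρ : ℂ) : Set ℂ := {0, 6, 6 * ρ, 6 * ρ ^ 2}

theorem mem_jumpPoints_iff {ρ : ℂ} (hρ : IsPrimitiveRoot ρ 3) (t : ℂ) :
    t ∈ jumpPoints ρ ↔ t * (t ^ 3 - 216) = 0 := by
  have h2 := cubeRoot_relation hρ
  have h3 : t * (t ^ 3 - 216) = t * ((t - 6) * ((t - 6 * ρ) * (t - 6 * ρ ^ 2))) := by
    linear_combination t * (6 * t ^ 2 - 36 * ρ * t + 216 * (ρ - 1)) * h2
  rw [h3]
  simp only [jumpPoints, Set.mem_insert_iff, Set.mem_singleton_iff, mul_eq_zero, sub_eq_zero]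

theorem permP_mem_jumpPoints {ρ : ℂ} (hρ : IsPrimitiveRoot ρ 3) (t : E6Param) :
    ((permP hρ t : E6Param) : ℂ) ∈ jumpPoints ρ ↔ (t : ℂ) ∈ jumpPoints ρ := by
  have h0 : ρ ≠ 0 := hρ.ne_zero (by norm_num)
  rw [mem_jumpPoints_iff hρ, mem_jumpPoints_iff hρ]
  change ρ * (t : ℂ) * ((ρ * (t : ℂ)) ^ 3 - 216) = 0 ↔ _
  rw [mul_pow, hρ.pow_eq_one, one_mul, mul_assoc, mul_eq_zero]
  simp [h0]

theorem mapR_mem_jumpPoints {ρ : ℂ} (hρ : IsPrimitiveRoot ρ 3) (t : E6Param)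
    (ht : (t : ℂ) ∈ jumpPoints ρ) : ((mapR t : E6Param) : ℂ) ∈ jumpPoints ρ := by
  have h := three_add_ne_zero t
  rw [mem_jumpPoints_iff hρ] at ht ⊢
  change (18 - 3 * (t : ℂ)) / (3 + t) * (((18 - 3 * (t : ℂ)) / (3 + t)) ^ 3 - 216) = 0
  have h1 : (18 - 3 * (t : ℂ)) / (3 + t) * (((18 - 3 * (t : ℂ)) / (3 + t)) ^ 3 - 216) =
      729 * ((t : ℂ) * ((t : ℂ) ^ 3 - 216)) / (3 + (t : ℂ)) ^ 4 := by
    field_simp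
    ring
  rw [h1, ht]
  simp

theorem groupH_mem_jumpPoints {ρ : ℂ} (hρ : IsPrimitiveRoot ρ 3) {σ : Equiv.Perm E6Param}
    (hσ : σ ∈ groupH hρ) : ∀ t : E6Param,
      ((σ t : E6Param) : ℂ) ∈ jumpPoints ρ ↔ (t : ℂ) ∈ jumpPoints ρ := by
  induction hσ using Subgroup.closure_induction with
  | mem σ h =>
    intro t
    rcases h with rfl | rfl
    · exact permP_mem_jumpPoints hρ t
    · refine ⟨fun h => ?_, mapR_mem_jumpPoints hρ t⟩
      have h1 := mapR_mem_jumpPoints hρ _ h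
      change ((mapR (mapR t) : E6Param) : ℂ) ∈ jumpPoints ρ at h1
      rwa [mapR_mapR] at h1
  | one => exact fun t => Iff.rfl
  | mul σ τ _ _ h1 h2 => exact fun t => (h1 (τ t)).trans (h2 t)
  | inv σ _ h => exact fun t => by simpa using (h (σ⁻¹ t)).symm

/-- The set of parameters that are not jump points, with the action of `H`. -/
def nonJump {ρ : ℂ} (hρ : IsPrimitiveRoot ρ 3) : SubMulAction (groupH hρ) E6Param where
  carrier := {t | (t : ℂ) ∉ jumpPoints ρ}
  smul_mem' := fun σ t ht h => ht ((groupH_mem_jumpPoints hρ σ.2 t).1 h)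

/-- The set `X` with the action of `G` through a group homomorphism `π : G → H`. -/
def ActionThrough {G H : Type} [Group G] [Group H] (_π : G →* H) (X : Type) : Type := X

instance {G H : Type} [Group G] [Group H] (π : G →* H) (X : Type) [MulAction H X] :
    MulAction G (ActionThrough π X) where
  smul g x := (π g • (show X from x) : X)
  one_smul x := by
    change (π 1 • (show X from x) : X) = x
    rw [map_one, one_smul]
  mul_smul g h x := by
    change (π (g * h) • (show X from x) : X) = π g • π h • (show X from x)
    rw [map_mul, mul_smul]

/-- The action groupoid of `G` acting on `X` through `π : G → H`. -/
abbrev ActionGroupoid {G H : Type} [Group G] [Group H] (π : G →* H) (X : Type)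
    [MulAction H X] : Type :=
  CategoryTheory.ActionCategory G (ActionThrough π X)

/-- The point of `X` underlying an object of the action groupoid. -/
def ActionGroupoid.point {G H : Type} [Group G] [Group H] {π : G →* H} {X : Type}
    [MulAction H X] (a : ActionGroupoid π X) : X :=
  show ActionThrough π X from CategoryTheory.ActionCategory.back (M := G) a

/-- The element of `G` underlying a morphism of the action groupoid. -/
def ActionGroupoid.element {G H : Type} [Group G] [Group H] {π : G →* H} {X : Type}
    [MulAction H X] {a b : CategoryTheory.ActionCategory G (ActionThrough π X)} (m : a ⟶ b) : G :=
  Subtype.val m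

/-- The full subgroupoid on the parameters that are not jump points. -/
abbrev E6NonJumpGroupoid {ρ : ℂ} (hρ : IsPrimitiveRoot ρ 3) (k : ℕ∞) : Type :=
  CategoryTheory.ObjectProperty.FullSubcategory
    (fun t : E6Groupoid k => t.param ∈ nonJump hρ)

/-- The monomials `1, x, y, z, x², y², z², xy, xz, yz, xyz`. -/
def e6Monomial : Fin 11 → FormalRing 3 :=
  ![1, MvPowerSeries.X 0, MvPowerSeries.X 1, MvPowerSeries.X 2,
    MvPowerSeries.X 0 ^ 2, MvPowerSeries.X 1 ^ 2, MvPowerSeries.X 2 ^ 2,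
    MvPowerSeries.X 0 * MvPowerSeries.X 1, MvPowerSeries.X 0 * MvPowerSeries.X 2,
    MvPowerSeries.X 1 * MvPowerSeries.X 2,
    MvPowerSeries.X 0 * MvPowerSeries.X 1 * MvPowerSeries.X 2]

end

/-! ### The Hesse pencil, its Hessian, and monomial matrices -/

noncomputable section

open Matrix

/-! Everything rests on the Hesse pencil of cubics a(x³+y³+z³) + bxyz. The Hessian determinant maps
the pencil to itself and is covariant: Hess(F∘M) = (det M)² (Hess F)∘M. Moreover xyz is a
combination of f_t and Hess f_t with denominator 8(27+t³). So an invertible linear map M taking one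
smooth member into the pencil takes xyz into the pencil too (`hesseCubic_triangle_comp`), and since
xyz is proportional to its own Hessian, the image is one of the four triangles of the pencil
(`triangle_parameter`). A power of A₁ followed by A₂ moves any other triangle back to xyz, and a map
preserving xyz up to a factor is monomial. Its nonzero entries have equal cubes, so up to a scalar
it is a product of powers of ρ on the diagonal and a permutation, hence in G. This is
`mk_mem_groupG`, the core of the argument.

The homomorphism π records how G moves the members of the pencil. Its kernel consists of the
monomial classes fixing every member, 3·3! = 18 of them. A Möbius map is determined by three values,
so H acts faithfully on the four jump points; the image is the alternating group, and |G| = 18·12.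

On polynomials a homogeneous isomorphism is a linear substitution, and conversely each g in G with
π(g)t = s induces one for every k. What remains is that its matrix lies in G and relates t to s. For
k ≥ 2 the degree-three part of the ideal is the line through f_t, so the substitution carries f_t to
a multiple of f_s and `mk_mem_groupG` applies. For k ≤ 1 one uses instead the degree-three part of
J(f_t), which has codimension one among cubic forms. The functional annihilating it, evaluated on
cubes of linear forms, is again a member of the pencil, the dual cubic -(t/3)(x³+y³+z³) + 6xyz.
Matrices act on dual cubics without the transpose (`dualCubic_comp`), and G is stable under
transposition. The dual cubic at s is a smooth member exactly when s ≠ 0 and s³ ≠ 216, that is, away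
from the jump points.

In A¹(t) the fourth power of the maximal ideal vanishes and degree three is spanned by xyz. Away
from the jump points the linear part of a derivation is a scalar (`exists_derValue`), while the
quadratic and cubic parts of the images of x, y, z are arbitrary (`exists_derivation`), which gives
dimension 1 + 18 + 3. In these coordinates t enters the bracket only through the pairing of two
quadratic parts into the cubic part, and a linear shear depending polynomially on t removes it
(`socleBracket_quadShear`). So all these Lie algebras are isomorphic. On the other hand, comparing
3-jets shows that contact equivalence of f_t and f_s puts t and s in one H-orbit, and the cube of
`hesseInvariant` separates the orbits of 1 and 2. -/

/-- The member `a (x³ + y³ + z³) + b x y z` of the Hesse pencil, as a function. -/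
def hesseCubic (a b : ℂ) (p : Fin 3 → ℂ) : ℂ :=
  a * (p 0 ^ 3 + p 1 ^ 3 + p 2 ^ 3) + b * (p 0 * p 1 * p 2)

/-- The Hessian matrix of a member of the Hesse pencil. -/
def hesseHessian (a b : ℂ) (p : Fin 3 → ℂ) : Matrix (Fin 3) (Fin 3) ℂ :=
  !![6 * a * p 0, b * p 2, b * p 1; b * p 2, 6 * a * p 1, b * p 0; b * p 1, b * p 0, 6 * a * p 2]

/-- The third difference of a cubic form is its symmetric trilinear form. Expressing the Hessian
through values of the cubic gives its covariance under linear maps without differentiating. -/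
theorem hesseCubic_polarization (a b : ℂ) (u v w : Fin 3 → ℂ) :
    v ⬝ᵥ hesseHessian a b u *ᵥ w =
      hesseCubic a b (u + v + w) - hesseCubic a b (u + v) - hesseCubic a b (u + w)
        - hesseCubic a b (v + w) + hesseCubic a b u + hesseCubic a b v + hesseCubic a b w := by
  simp [hesseCubic, hesseHessian, dotProduct, mulVec, Fin.sum_univ_three]
  ring

/-- The Hessian of a member of the pencil is again a member, so the covariance of Hessians becomes a
relation between pairs of coefficients. -/
theorem hesseHessian_det (a b : ℂ) (p : Fin 3 → ℂ) :
    (hesseHessian a b p).det = hesseCubic (-6 * a * b ^ 2) (216 * a ^ 3 + 2 * b ^ 3) p := by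
  simp [hesseCubic, hesseHessian, det_fin_three]
  ring

theorem matrix_eq_of_bilinear {A B : Matrix (Fin 3) (Fin 3) ℂ}
    (h : ∀ v w : Fin 3 → ℂ, v ⬝ᵥ A *ᵥ w = v ⬝ᵥ B *ᵥ w) : A = B := by
  ext i j
  simpa using h (Pi.single i 1) (Pi.single j 1)

/-- By polarization both bilinear forms are the same combination of values of the two cubics, and
`h` identifies these values. -/
theorem hesseHessian_covariant {M : Matrix (Fin 3) (Fin 3) ℂ} {a b a' b' : ℂ}
    (h : ∀ p, hesseCubic a b (M *ᵥ p) = hesseCubic a' b' p) (p : Fin 3 → ℂ) :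
    Mᵀ * hesseHessian a b (M *ᵥ p) * M = hesseHessian a' b' p := by
  apply matrix_eq_of_bilinear
  intro v w
  have h1 : v ⬝ᵥ (Mᵀ * hesseHessian a b (M *ᵥ p) * M) *ᵥ w =
      (M *ᵥ v) ⬝ᵥ hesseHessian a b (M *ᵥ p) *ᵥ (M *ᵥ w) := by
    rw [← mulVec_mulVec, ← mulVec_mulVec, dotProduct_mulVec, vecMul_transpose]
  rw [h1, hesseCubic_polarization, hesseCubic_polarization]
  simp only [← mulVec_add, h]

theorem hesseCubic_hessian_covariant {M : Matrix (Fin 3) (Fin 3) ℂ} {a b a' b' : ℂ}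
    (h : ∀ p, hesseCubic a b (M *ᵥ p) = hesseCubic a' b' p) (p : Fin 3 → ℂ) :
    M.det ^ 2 * hesseCubic (-6 * a * b ^ 2) (216 * a ^ 3 + 2 * b ^ 3) (M *ᵥ p) =
      hesseCubic (-6 * a' * b' ^ 2) (216 * a' ^ 3 + 2 * b' ^ 3) p := by
  rw [← hesseHessian_det, ← hesseHessian_det, ← hesseHessian_covariant h p]
  simp only [det_mul, det_transpose]
  ring

theorem hesseCubic_coeffs {a b a' b' : ℂ} (h : ∀ p, hesseCubic a b p = hesseCubic a' b' p) :
    a = a' ∧ b = b' := by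
  have h1 := h ![1, 0, 0]
  have h2 := h ![1, 1, 1]
  simp [hesseCubic] at h1 h2
  refine ⟨h1, ?_⟩
  rw [h1] at h2
  simpa using h2

theorem hesseCubic_mul (c a b : ℂ) (p : Fin 3 → ℂ) :
    c * hesseCubic a b p = hesseCubic (c * a) (c * b) p := by
  simp [hesseCubic]; ring

/-- A linear map that carries a smooth member of the pencil to a member of the pencil carries the
whole pencil to itself. -/
theorem hesseCubic_triangle_comp {M : Matrix (Fin 3) (Fin 3) ℂ} {t a' b' : ℂ}
    (hM : M.det ≠ 0) (ht : t ^ 3 ≠ -27)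
    (h : ∀ p, hesseCubic 1 t (M *ᵥ p) = hesseCubic a' b' p) :
    ∃ α β : ℂ, ∀ p, hesseCubic 0 1 (M *ᵥ p) = hesseCubic α β p := by
  -- The identity behind the witnesses is Hess f_t + 6t² f_t = (216 + 8t³) xyz. The factor 8(27 +
  -- t³) is nonzero by smoothness, and composing the left side with M gives members of the pencil,
  -- up to the factor (det M)² on the Hessian.
  have hd : M.det ^ 2 * (216 + 8 * t ^ 3) ≠ 0 := by
    refine mul_ne_zero (pow_ne_zero 2 hM) fun h0 => ht ?_
    linear_combination h0 / 8
  refine ⟨(-6 * a' * b' ^ 2 + M.det ^ 2 * 6 * t ^ 2 * a') / (M.det ^ 2 * (216 + 8 * t ^ 3)),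
    (216 * a' ^ 3 + 2 * b' ^ 3 + M.det ^ 2 * 6 * t ^ 2 * b') / (M.det ^ 2 * (216 + 8 * t ^ 3)),
    fun p => ?_⟩
  have h1 := hesseCubic_hessian_covariant h p
  have h2 := h p
  rw [div_eq_inv_mul, div_eq_inv_mul, ← hesseCubic_mul, eq_inv_mul_iff_mul_eq₀ hd]
  simp only [hesseCubic] at h1 h2 ⊢
  linear_combination h1 + M.det ^ 2 * 6 * t ^ 2 * h2

/-- The Hessian of xyz is 2xyz, so by covariance the image of xyz is proportional to its own
Hessian. If α ≠ 0, comparing the first coefficients gives (det M)² = -3β², and the second ones then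
give the relation on β³. -/
theorem triangle_parameter {M : Matrix (Fin 3) (Fin 3) ℂ} {α β : ℂ}
    (h : ∀ p, hesseCubic 0 1 (M *ᵥ p) = hesseCubic α β p) : α = 0 ∨ β ^ 3 = -27 * α ^ 3 := by
  have h1 : ∀ p, hesseCubic (2 * M.det ^ 2 * α) (2 * M.det ^ 2 * β) p =
      hesseCubic (-6 * α * β ^ 2) (216 * α ^ 3 + 2 * β ^ 3) p := fun p => by
    rw [← hesseCubic_hessian_covariant h p, ← hesseCubic_mul, ← h p]
    simp only [hesseCubic]
    ring
  obtain ⟨h2, h3⟩ := hesseCubic_coeffs h1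
  by_cases hα : α = 0
  · exact Or.inl hα
  · right
    have h4 : M.det ^ 2 = -3 * β ^ 2 := by
      apply mul_left_cancel₀ (mul_ne_zero two_ne_zero hα)
      linear_combination h2
    rw [h4] at h3
    linear_combination h3 / (-8)

/-- If the product of three linear forms in two variables vanishes, one of the forms does. -/
theorem binary_product_eq_zero {a b : Fin 3 → ℂ}
    (h : ∀ u v : ℂ, (a 0 * u + b 0 * v) * (a 1 * u + b 1 * v) * (a 2 * u + b 2 * v) = 0) :
    ∃ i, a i = 0 ∧ b i = 0 := by
  by_contra! hc
  have h0 := hc 0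
  have h1 := hc 1
  have h2 := hc 2
  -- The four coefficients of the binary cubic, read off from its values at (1,0), (0,1), (1,1) and
  -- (1,-1).
  have e1 : a 0 * a 1 * a 2 = 0 := by simpa using h 1 0
  have e2 : b 0 * b 1 * b 2 = 0 := by simpa using h 0 1
  have e3 : a 0 * a 1 * b 2 + a 0 * b 1 * a 2 + b 0 * a 1 * a 2 = 0 := by
    linear_combination (h 1 1 - h 1 (-1)) / 2 - e2
  have e4 : b 0 * b 1 * a 2 + b 0 * a 1 * b 2 + a 0 * b 1 * b 2 = 0 := by
    linear_combination h 1 1 - e1 - e2 - e3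
  simp only [mul_eq_zero, or_assoc] at e1 e2
  rcases e1 with ha | ha | ha <;> rcases e2 with hb | hb | hb <;> simp_all

/-- The monomial matrix with entries `m i` at `(i, σ i)`. -/
def monomialMatrix (m : Fin 3 → ℂ) (σ : Equiv.Perm (Fin 3)) : Matrix (Fin 3) (Fin 3) ℂ :=
  Matrix.of fun i j => if j = σ i then m i else 0

theorem monomialMatrix_mulVec (m : Fin 3 → ℂ) (σ : Equiv.Perm (Fin 3)) (p : Fin 3 → ℂ)
    (i : Fin 3) : (monomialMatrix m σ *ᵥ p) i = m i * p (σ i) := by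
  simp [monomialMatrix, mulVec, dotProduct]

/-- On each coordinate line the product of the three row forms of M vanishes, so one row restricts
to zero there and has a single nonzero entry. The three lines yield three different rows, which
defines the permutation. -/
theorem exists_monomialMatrix {M : Matrix (Fin 3) (Fin 3) ℂ} {β : ℂ} (hM : M.det ≠ 0)
    (h : ∀ p, hesseCubic 0 1 (M *ᵥ p) = hesseCubic 0 β p) :
    ∃ (m : Fin 3 → ℂ) (σ : Equiv.Perm (Fin 3)), M = monomialMatrix m σ := by
  have hp : ∀ p : Fin 3 → ℂ, (M *ᵥ p) 0 * (M *ᵥ p) 1 * (M *ᵥ p) 2 = β * (p 0 * p 1 * p 2) :=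
    fun p => by simpa [hesseCubic] using h p
  simp only [mulVec, dotProduct, Fin.sum_univ_three] at hp
  obtain ⟨i0, h0⟩ := binary_product_eq_zero (a := fun i => M i 1) (b := fun i => M i 2)
    fun u v => by simpa using hp ![0, u, v]
  obtain ⟨i1, h1⟩ := binary_product_eq_zero (a := fun i => M i 0) (b := fun i => M i 2)
    fun u v => by simpa using hp ![u, 0, v]
  obtain ⟨i2, h2⟩ := binary_product_eq_zero (a := fun i => M i 0) (b := fun i => M i 1)
    fun u v => by simpa using hp ![u, v, 0]
  have hrow : ∀ i, ¬ (M i 0 = 0 ∧ M i 1 = 0 ∧ M i 2 = 0) := fun i hi =>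
    hM (det_eq_zero_of_row_eq_zero i fun j => by fin_cases j <;> simp [hi])
  -- A row attached to two coordinate lines would have all its entries zero.
  have hinj : Function.Injective ![i0, i1, i2] := by
    have a := hrow i0
    have b := hrow i1
    intro x y hxy
    fin_cases x <;> fin_cases y <;> simp at hxy ⊢ <;> subst hxy <;> simp_all
  set τ := Equiv.ofBijective _ (Finite.injective_iff_bijective.1 hinj) with hτ
  refine ⟨fun i => M i (τ.symm i), τ.symm, ?_⟩
  have hz : ∀ k j, j ≠ k → M (τ k) j = 0 := by
    intro k j hjk
    fin_cases k <;> fin_cases j <;> simp_all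
  ext i j
  simp only [monomialMatrix, of_apply]
  split_ifs with hj
  · rw [hj]
  · simpa using hz (τ.symm i) j hj

theorem hesseCubic_monomialMatrix (a b : ℂ) (m : Fin 3 → ℂ) (σ : Equiv.Perm (Fin 3))
    (p : Fin 3 → ℂ) : hesseCubic a b (monomialMatrix m σ *ᵥ p) =
      a * ∑ k, m k ^ 3 * p (σ k) ^ 3 + b * ((m 0 * m 1 * m 2) * (p 0 * p 1 * p 2)) := by
  have h1 : p (σ 0) * p (σ 1) * p (σ 2) = p 0 * p 1 * p 2 := by
    simpa [Fin.prod_univ_three] using Equiv.prod_comp σ p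
  simp only [hesseCubic, monomialMatrix_mulVec, Fin.sum_univ_three, ← h1]
  ring

/-- A monomial matrix that carries a Fermat-type member of the pencil into the pencil has entries
with equal cubes. -/
theorem monomialMatrix_cubes {m : Fin 3 → ℂ} {σ : Equiv.Perm (Fin 3)} {t a' b' : ℂ}
    (h : ∀ p, hesseCubic 1 t (monomialMatrix m σ *ᵥ p) = hesseCubic a' b' p) (i : Fin 3) :
    m i ^ 3 = a' := by
  have h1 := h (Pi.single (σ i) 1)
  rw [hesseCubic_monomialMatrix, Finset.sum_eq_single i (fun k _ hk => by simp [hk])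
    (by simp)] at h1
  generalize σ i = k at h1
  fin_cases k <;> simpa [hesseCubic] using h1

end

/-! ### The action of G on the Hesse pencil and the homomorphism π -/

noncomputable section

open Matrix

/-- The class `g` carries every member `t` of the Hesse pencil to the member `h t`. -/
def Carries (g : ProjGenLinGroup (Fin 3) ℂ) (h : Equiv.Perm E6Param) : Prop :=
  ∀ B : GeneralLinearGroup (Fin 3) ℂ, ProjGenLinGroup.mk B = g → ∀ t : E6Param,
    ∃ c : ℂ, c ≠ 0 ∧ ∀ p, hesseCubic 1 t ((B : Matrix (Fin 3) (Fin 3) ℂ)ᵀ *ᵥ p) =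
      c * hesseCubic 1 (h t) p

theorem hesseCubic_smul (a b u : ℂ) (p : Fin 3 → ℂ) :
    hesseCubic a b (u • p) = u ^ 3 * hesseCubic a b p := by
  simp [hesseCubic]; ring

theorem exists_smul_of_mk_eq {B C : GeneralLinearGroup (Fin 3) ℂ}
    (h : ProjGenLinGroup.mk B = ProjGenLinGroup.mk C) :
    ∃ u : ℂ, u ≠ 0 ∧ (C : Matrix (Fin 3) (Fin 3) ℂ) = u • (B : Matrix (Fin 3) (Fin 3) ℂ) := by
  obtain ⟨u, rfl⟩ := ProjGenLinGroup.mk_eq_mk_iff.1 h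
  refine ⟨u, u.ne_zero, ?_⟩
  simp only [Units.val_mul, GeneralLinearGroup.coe_scalar]
  ext i j
  simp [mul_comm]

theorem mk_eq_of_smul {B C : GeneralLinearGroup (Fin 3) ℂ} {u : ℂ} (hu : u ≠ 0)
    (h : (C : Matrix (Fin 3) (Fin 3) ℂ) = u • (B : Matrix (Fin 3) (Fin 3) ℂ)) :
    ProjGenLinGroup.mk B = ProjGenLinGroup.mk C := by
  refine ProjGenLinGroup.mk_eq_mk_iff.2 ⟨Units.mk0 u hu, Units.ext ?_⟩
  rw [h]
  simp only [Units.val_mul, GeneralLinearGroup.coe_scalar]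
  ext i j
  simp [mul_comm]

/-- One representative suffices: rescaling the matrix by u only multiplies a cubic by u³. -/
theorem carries_mk {B : GeneralLinearGroup (Fin 3) ℂ} {h : Equiv.Perm E6Param}
    (H : ∀ t : E6Param, ∃ c : ℂ, c ≠ 0 ∧ ∀ p,
      hesseCubic 1 t ((B : Matrix (Fin 3) (Fin 3) ℂ)ᵀ *ᵥ p) = c * hesseCubic 1 (h t) p) :
    Carries (ProjGenLinGroup.mk B) h := by
  intro C hC t
  obtain ⟨u, hu, hu'⟩ := exists_smul_of_mk_eq hC.symm
  obtain ⟨c, hc, hc'⟩ := H t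
  refine ⟨u ^ 3 * c, mul_ne_zero (pow_ne_zero 3 hu) hc, fun p => ?_⟩
  rw [hu', transpose_smul, smul_mulVec, hesseCubic_smul, hc']
  ring

theorem Carries.one : Carries 1 1 := by
  rw [← ProjGenLinGroup.mk_one]
  exact carries_mk fun t => ⟨1, one_ne_zero, fun p => by simp⟩

/-- Transposition reverses the product and precomposition reverses it again, so the map to
transformations of the parameter is a homomorphism and not an antihomomorphism. -/
theorem Carries.mul {g g' : ProjGenLinGroup (Fin 3) ℂ} {h h' : Equiv.Perm E6Param}
    (H : Carries g h) (H' : Carries g' h') : Carries (g * g') (h * h') := by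
  obtain ⟨B, rfl⟩ := ProjGenLinGroup.mk_surjective g
  obtain ⟨B', rfl⟩ := ProjGenLinGroup.mk_surjective g'
  rw [← map_mul]
  refine carries_mk fun t => ?_
  obtain ⟨c', hc', e'⟩ := H' B' rfl t
  obtain ⟨c, hc, e⟩ := H B rfl (h' t)
  refine ⟨c' * c, mul_ne_zero hc' hc, fun p => ?_⟩
  rw [Units.val_mul, transpose_mul, ← mulVec_mulVec, e', e, mul_assoc, Equiv.Perm.mul_apply]

theorem Carries.inv {g : ProjGenLinGroup (Fin 3) ℂ} {h : Equiv.Perm E6Param}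
    (H : Carries g h) : Carries g⁻¹ h⁻¹ := by
  obtain ⟨B, rfl⟩ := ProjGenLinGroup.mk_surjective g
  rw [← map_inv]
  refine carries_mk fun t => ?_
  obtain ⟨c, hc, e⟩ := H B rfl (h⁻¹ t)
  refine ⟨c⁻¹, inv_ne_zero hc, fun p => ?_⟩
  have e1 := e (((B⁻¹ : GeneralLinearGroup (Fin 3) ℂ) : Matrix (Fin 3) (Fin 3) ℂ)ᵀ *ᵥ p)
  have e2 : (B : Matrix (Fin 3) (Fin 3) ℂ)ᵀ *
      ((B⁻¹ : GeneralLinearGroup (Fin 3) ℂ) : Matrix (Fin 3) (Fin 3) ℂ)ᵀ = 1 := by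
    rw [← transpose_mul, Units.inv_mul, transpose_one]
  rw [mulVec_mulVec, e2, one_mulVec, show h (h⁻¹ t) = t from h.apply_symm_apply t] at e1
  rw [e1, inv_mul_cancel_left₀ hc]

theorem hesseCubic_param_unique {t s c d : ℂ} (hc : c ≠ 0)
    (h : ∀ p, c * hesseCubic 1 t p = d * hesseCubic 1 s p) : t = s := by
  simp only [hesseCubic_mul] at h
  obtain ⟨h1, h2⟩ := hesseCubic_coeffs h
  apply mul_left_cancel₀ hc
  linear_combination h2 - s * h1

/-- A nonzero multiple of f_s determines s. Thanks to this, π can be defined by choice and still be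
multiplicative. -/
theorem Carries.unique {g : ProjGenLinGroup (Fin 3) ℂ} {h h' : Equiv.Perm E6Param}
    (H : Carries g h) (H' : Carries g h') : h = h' := by
  obtain ⟨B, rfl⟩ := ProjGenLinGroup.mk_surjective g
  refine Equiv.ext fun t => Subtype.ext ?_
  obtain ⟨c, hc, e⟩ := H B rfl t
  obtain ⟨c', hc', e'⟩ := H' B rfl t
  exact hesseCubic_param_unique hc fun p => by rw [← e, e']

variable {ρ : ℂ} (hρ : IsPrimitiveRoot ρ 3)

/-- The transformations of the parameters attached to the generators. -/
def hesseParamMap (i : Fin 4) : Equiv.Perm E6Param := ![permP hρ, permR, 1, 1] i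

theorem hesseParamMap_mem (i : Fin 4) : hesseParamMap hρ i ∈ groupH hρ := by
  fin_cases i
  · exact Subgroup.subset_closure (Or.inl rfl)
  · exact Subgroup.subset_closure (Or.inr rfl)
  · exact one_mem _
  · exact one_mem _

/-- Symmetry of the generators removes the transpose from their action on the pencil, and it is also
why G is stable under transposition. -/
theorem hesseMatrix_transpose (i : Fin 4) : (hesseMatrix ρ i)ᵀ = hesseMatrix ρ i := by
  fin_cases i <;> (ext i j; fin_cases i <;> fin_cases j <;> simp [hesseMatrix])

theorem hesseCubic_comp_A1 {ρ : ℂ} (hρ : IsPrimitiveRoot ρ 3) (a b : ℂ) (p : Fin 3 → ℂ) :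
    hesseCubic a b (hesseMatrix ρ 0 *ᵥ p) = hesseCubic a (ρ * b) p := by
  simp [hesseCubic, hesseMatrix, mulVec, dotProduct, Fin.sum_univ_three]
  linear_combination a * p 0 ^ 3 * hρ.pow_eq_one

/-- In the affine coordinate b/a this linear map of the pencil is R, with multiplier 3 + t on f_t.
-/
theorem hesseCubic_comp_A2 {ρ : ℂ} (hρ : IsPrimitiveRoot ρ 3) (a b : ℂ) (p : Fin 3 → ℂ) :
    hesseCubic a b (hesseMatrix ρ 1 *ᵥ p) = hesseCubic (3 * a + b) (18 * a - 3 * b) p := by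
  have h := cubeRoot_relation hρ
  have h2 : ρ ^ 2 = -1 - ρ := by linear_combination h
  simp [hesseCubic, hesseMatrix, mulVec, dotProduct, Fin.sum_univ_three]
  rw [h2]
  ring_nf
  simp only [h2]
  ring

theorem carries_hesseElement (i : Fin 4) : Carries (hesseElement hρ i) (hesseParamMap hρ i) := by
  refine carries_mk fun t => ?_
  change ∃ c : ℂ, c ≠ 0 ∧ ∀ p, hesseCubic 1 t ((hesseMatrix ρ i)ᵀ *ᵥ p) = _
  rw [hesseMatrix_transpose]
  fin_cases i
  · exact ⟨1, one_ne_zero, fun p => (hesseCubic_comp_A1 hρ 1 t p).trans (one_mul _).symm⟩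
  · refine ⟨3 + t, three_add_ne_zero t, fun p => (hesseCubic_comp_A2 hρ 1 t p).trans ?_⟩
    change _ = (3 + (t : ℂ)) * hesseCubic 1 ((18 - 3 * (t : ℂ)) / (3 + t)) p
    rw [hesseCubic_mul, mul_div_cancel₀ _ (three_add_ne_zero t)]
    simp
  · refine ⟨1, one_ne_zero, fun p => ?_⟩
    simp [hesseCubic, hesseMatrix, hesseParamMap, mulVec, dotProduct, Fin.sum_univ_three]
    ring
  · refine ⟨1, one_ne_zero, fun p => ?_⟩
    simp [hesseCubic, hesseMatrix, hesseParamMap, mulVec, dotProduct, Fin.sum_univ_three]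
    ring

theorem exists_carries_of_mem_groupG {g : ProjGenLinGroup (Fin 3) ℂ} (hg : g ∈ groupG hρ) :
    ∃ h ∈ groupH hρ, Carries g h := by
  induction hg using Subgroup.closure_induction with
  | mem g hg =>
    obtain ⟨i, rfl⟩ := hg
    exact ⟨_, hesseParamMap_mem hρ i, carries_hesseElement hρ i⟩
  | one => exact ⟨1, one_mem _, Carries.one⟩
  | mul g g' _ _ H H' =>
    obtain ⟨h, hh, H⟩ := H
    obtain ⟨h', hh', H'⟩ := H'
    exact ⟨h * h', mul_mem hh hh', H.mul H'⟩
  | inv g _ H =>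
    obtain ⟨h, hh, H⟩ := H
    exact ⟨h⁻¹, inv_mem hh, H.inv⟩

theorem exists_carries_of_mem_groupH {h : Equiv.Perm E6Param} (hh : h ∈ groupH hρ) :
    ∃ g ∈ groupG hρ, Carries g h := by
  induction hh using Subgroup.closure_induction with
  | mem h hh =>
    rcases hh with rfl | rfl
    · exact ⟨_, (genG hρ 0).2, carries_hesseElement hρ 0⟩
    · exact ⟨_, (genG hρ 1).2, carries_hesseElement hρ 1⟩
  | one => exact ⟨1, one_mem _, Carries.one⟩
  | mul g g' _ _ H H' =>
    obtain ⟨h, hh, H⟩ := H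
    obtain ⟨h', hh', H'⟩ := H'
    exact ⟨h * h', mul_mem hh hh', H.mul H'⟩
  | inv g _ H =>
    obtain ⟨h, hh, H⟩ := H
    exact ⟨h⁻¹, inv_mem hh, H.inv⟩

/-- The transformation of the parameters induced by an element of `G`. -/
def paramMap (g : groupG hρ) : groupH hρ :=
  ⟨(exists_carries_of_mem_groupG hρ g.2).choose,
    (exists_carries_of_mem_groupG hρ g.2).choose_spec.1⟩

theorem carries_paramMap (g : groupG hρ) :
    Carries (g : ProjGenLinGroup (Fin 3) ℂ) (paramMap hρ g : Equiv.Perm E6Param) :=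
  (exists_carries_of_mem_groupG hρ g.2).choose_spec.2

/-- The homomorphism `π : G → H`. -/
def paramHom : groupG hρ →* groupH hρ where
  toFun := paramMap hρ
  map_one' := Subtype.ext ((carries_paramMap hρ 1).unique Carries.one)
  map_mul' g g' := Subtype.ext ((carries_paramMap hρ (g * g')).unique
    ((carries_paramMap hρ g).mul (carries_paramMap hρ g')))

theorem carries_paramHom (g : groupG hρ) :
    Carries (g : ProjGenLinGroup (Fin 3) ℂ) (paramHom hρ g : Equiv.Perm E6Param) :=
  carries_paramMap hρ g

theorem paramHom_genG (i : Fin 4) :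
    (paramHom hρ (genG hρ i) : Equiv.Perm E6Param) = hesseParamMap hρ i :=
  (carries_paramHom hρ (genG hρ i)).unique (carries_hesseElement hρ i)

theorem paramHom_surjective : Function.Surjective (paramHom hρ) := by
  rintro ⟨h, hh⟩
  obtain ⟨g, hg, H⟩ := exists_carries_of_mem_groupH hρ hh
  exact ⟨⟨g, hg⟩, Subtype.ext ((carries_paramHom hρ ⟨g, hg⟩).unique H)⟩

/-! ### Monomial matrices in `G` -/

/-- The entry of row i stands in column σ i, hence the reversed order of the permutations. -/
theorem monomialMatrix_mul (m n : Fin 3 → ℂ) (σ τ : Equiv.Perm (Fin 3)) :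
    monomialMatrix m σ * monomialMatrix n τ =
      monomialMatrix (fun i => m i * n (σ i)) (τ * σ) := by
  ext i k
  simp only [monomialMatrix, mul_apply, of_apply]
  rw [Finset.sum_eq_single (σ i) (fun j _ hj => by simp [hj]) (by simp), if_pos rfl, mul_ite,
    mul_zero]
  exact if_congr Iff.rfl rfl rfl

theorem monomialMatrix_one : monomialMatrix 1 1 = 1 := by
  ext i j
  simp [monomialMatrix, one_apply, eq_comm]

theorem monomialMatrix_transpose (m : Fin 3 → ℂ) (σ : Equiv.Perm (Fin 3)) :
    (monomialMatrix m σ)ᵀ = monomialMatrix (fun i => m (σ⁻¹ i)) σ⁻¹ := by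
  ext i j
  simp only [monomialMatrix, transpose_apply, of_apply, Equiv.Perm.eq_inv_iff_eq, @eq_comm _ i]
  split_ifs with h
  · rw [← h]; simp
  · rfl

/-- The matrix `M` is invertible and its class lies in `G`. -/
def MemG (M : Matrix (Fin 3) (Fin 3) ℂ) : Prop :=
  ∃ B : GeneralLinearGroup (Fin 3) ℂ, (B : Matrix (Fin 3) (Fin 3) ℂ) = M ∧
    ProjGenLinGroup.mk B ∈ groupG hρ

variable {hρ}

theorem MemG.mul {M N : Matrix (Fin 3) (Fin 3) ℂ} (hM : MemG hρ M) (hN : MemG hρ N) :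
    MemG hρ (M * N) := by
  obtain ⟨B, rfl, hB⟩ := hM
  obtain ⟨C, rfl, hC⟩ := hN
  exact ⟨B * C, rfl, by rw [map_mul]; exact mul_mem hB hC⟩

theorem MemG.smul {M : Matrix (Fin 3) (Fin 3) ℂ} (hM : MemG hρ M) {u : ℂ} (hu : u ≠ 0) :
    MemG hρ (u • M) := by
  obtain ⟨B, rfl, hB⟩ := hM
  refine ⟨B * .scalar (Fin 3) (Units.mk0 u hu), ?_, ?_⟩
  · simp only [Units.val_mul, GeneralLinearGroup.coe_scalar]
    ext i j
    simp [mul_comm]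
  · rw [map_mul, ProjGenLinGroup.mk_scalar, mul_one]
    exact hB

theorem MemG.mk_mem {B : GeneralLinearGroup (Fin 3) ℂ}
    (h : MemG hρ (B : Matrix (Fin 3) (Fin 3) ℂ)) : ProjGenLinGroup.mk B ∈ groupG hρ := by
  obtain ⟨C, hC, h⟩ := h
  rwa [Units.ext hC] at h

variable (hρ)

theorem memG_hesseMatrix (i : Fin 4) : MemG hρ (hesseMatrix ρ i) :=
  ⟨_, rfl, (genG hρ i).2⟩

theorem memG_one : MemG hρ 1 := ⟨1, rfl, one_mem _⟩

theorem memG_monomial_swap : MemG hρ (monomialMatrix 1 (Equiv.swap 0 1)) ∧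
    MemG hρ (monomialMatrix 1 (Equiv.swap 1 2)) := by
  constructor
  · convert memG_hesseMatrix hρ 2 using 1
    ext i j
    fin_cases i <;> fin_cases j <;> simp [monomialMatrix, hesseMatrix, Equiv.swap_apply_def]
  · convert memG_hesseMatrix hρ 3 using 1
    ext i j
    fin_cases i <;> fin_cases j <;> simp [monomialMatrix, hesseMatrix, Equiv.swap_apply_def]

theorem perm_three_cases (σ : Equiv.Perm (Fin 3)) : σ = 1 ∨ σ = Equiv.swap 0 1 ∨
    σ = Equiv.swap 1 2 ∨ σ = Equiv.swap 0 1 * Equiv.swap 1 2 ∨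
    σ = Equiv.swap 1 2 * Equiv.swap 0 1 ∨
    σ = Equiv.swap 0 1 * (Equiv.swap 1 2 * Equiv.swap 0 1) := by
  revert σ
  decide

theorem memG_permutation (σ : Equiv.Perm (Fin 3)) : MemG hρ (monomialMatrix 1 σ) := by
  obtain ⟨h1, h2⟩ := memG_monomial_swap hρ
  have h : ∀ {σ τ : Equiv.Perm (Fin 3)}, MemG hρ (monomialMatrix 1 σ) →
      MemG hρ (monomialMatrix 1 τ) → MemG hρ (monomialMatrix 1 (σ * τ)) := by
    intro σ τ hσ hτ
    have := hτ.mul hσ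
    rw [monomialMatrix_mul] at this
    convert this using 2
    ext i
    simp
  rcases perm_three_cases σ with rfl | rfl | rfl | rfl | rfl | rfl
  · rw [monomialMatrix_one]
    exact memG_one hρ
  · exact h1
  · exact h2
  · exact h h1 h2
  · exact h h2 h1
  · exact h h1 (h h2 h1)

theorem memG_diagonal (i j : ℕ) : MemG hρ (monomialMatrix ![ρ ^ i, ρ ^ j, 1] 1) := by
  have h1 : MemG hρ (monomialMatrix ![ρ, 1, 1] 1) := by
    convert memG_hesseMatrix hρ 0 using 1
    ext i j
    fin_cases i <;> fin_cases j <;> simp [monomialMatrix, hesseMatrix]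
  -- The second diagonal generator is the conjugate of A₁ by the transposition A₃.
  have h2 : MemG hρ (monomialMatrix ![1, ρ, 1] 1) := by
    have := ((memG_permutation hρ (Equiv.swap 0 1)).mul h1).mul
      (memG_permutation hρ (Equiv.swap 0 1))
    rw [monomialMatrix_mul, monomialMatrix_mul] at this
    convert this using 2
    · ext i
      fin_cases i <;> simp [Equiv.swap_apply_def]
    · simp
  have hi : ∀ i, MemG hρ (monomialMatrix ![ρ ^ i, 1, 1] 1) := by
    intro i
    induction i with
    | zero =>
      convert memG_one hρ using 1
      rw [← monomialMatrix_one]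
      congr 1
      ext i
      fin_cases i <;> simp
    | succ i ih =>
      have := ih.mul h1
      rw [monomialMatrix_mul, mul_one] at this
      convert this using 2
      · ext k
        fin_cases k <;> simp [pow_succ]
  induction j with
  | zero => simpa using hi i
  | succ j ih =>
    have := ih.mul h2
    rw [monomialMatrix_mul, mul_one] at this
    convert this using 2
    · ext k
      fin_cases k <;> simp [pow_succ]

theorem exists_pow_of_cube_eq {ρ : ℂ} (hρ : IsPrimitiveRoot ρ 3) {x y : ℂ} (hy : y ≠ 0) (h : x ^ 3 = y ^ 3) :
    ∃ i < 3, x = y * ρ ^ i := by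
  have h1 : (x / y) ^ 3 = 1 := by rw [div_pow, h, div_self (pow_ne_zero 3 hy)]
  obtain ⟨i, hi, e⟩ := hρ.eq_pow_of_pow_eq_one h1
  exact ⟨i, hi, by rw [e, mul_div_cancel₀ _ hy]⟩

/-- Entries with equal cubes differ by powers of ρ. After dividing by the last entry the matrix is a
diagonal matrix of powers of ρ times a permutation matrix. -/
theorem memG_monomial {m : Fin 3 → ℂ} {c : ℂ} (hc : c ≠ 0) (hm : ∀ i, m i ^ 3 = c)
    (σ : Equiv.Perm (Fin 3)) : MemG hρ (monomialMatrix m σ) := by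
  have h0 : m 2 ≠ 0 := fun h => hc (by rw [← hm 2, h]; simp)
  obtain ⟨i, -, hi⟩ := exists_pow_of_cube_eq hρ h0 ((hm 0).trans (hm 2).symm)
  obtain ⟨j, -, hj⟩ := exists_pow_of_cube_eq hρ h0 ((hm 1).trans (hm 2).symm)
  have h := ((memG_diagonal hρ i j).mul (memG_permutation hρ σ)).smul h0
  rw [monomialMatrix_mul] at h
  convert h using 1
  ext k l
  fin_cases k <;> simp [monomialMatrix, hi, hj]

/-- A linear change of coordinates between members of the Hesse pencil, one of them smooth, belongs
to `G`. -/
theorem mk_mem_groupG {B : GeneralLinearGroup (Fin 3) ℂ} {t a' b' : ℂ} (ht : t ^ 3 ≠ -27)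
    (h : ∀ p, hesseCubic 1 t ((B : Matrix (Fin 3) (Fin 3) ℂ)ᵀ *ᵥ p) = hesseCubic a' b' p) :
    ProjGenLinGroup.mk B ∈ groupG hρ := by
  have hdet : ∀ B : GeneralLinearGroup (Fin 3) ℂ, (B : Matrix (Fin 3) (Fin 3) ℂ)ᵀ.det ≠ 0 :=
    fun B => by rw [det_transpose]; exact B.det_ne_zero
  -- The case in which the triangle xyz is carried to a multiple of itself; the other three
  -- triangles are reduced to it below.
  have hmono : ∀ (B : GeneralLinearGroup (Fin 3) ℂ) (t a' b' β : ℂ), t ^ 3 ≠ -27 →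
      (∀ p, hesseCubic 1 t ((B : Matrix (Fin 3) (Fin 3) ℂ)ᵀ *ᵥ p) = hesseCubic a' b' p) →
      (∀ p, hesseCubic 0 1 ((B : Matrix (Fin 3) (Fin 3) ℂ)ᵀ *ᵥ p) = hesseCubic 0 β p) →
      ProjGenLinGroup.mk B ∈ groupG hρ := by
    intro B t a' b' β ht h h'
    obtain ⟨m, σ, hm⟩ := exists_monomialMatrix (hdet B) h'
    rw [hm] at h
    have hc := monomialMatrix_cubes h
    have ha : a' ≠ 0 := by
      rintro rfl
      refine hdet B (det_eq_zero_of_row_eq_zero 0 fun j => ?_)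
      have := hc 0
      rw [hm]
      simp_all [monomialMatrix]
    apply MemG.mk_mem
    rw [← transpose_transpose (B : Matrix (Fin 3) (Fin 3) ℂ), hm, monomialMatrix_transpose]
    exact memG_monomial hρ ha (fun i => hc _) _
  obtain ⟨α, β, hαβ⟩ := hesseCubic_triangle_comp (hdet B) ht h
  by_cases hα : α = 0
  · subst hα
    exact hmono B t a' b' β ht h hαβ
  have hβ : β ^ 3 = (-3 * α) ^ 3 := by
    rw [((triangle_parameter hαβ).resolve_left hα)]
    ring
  -- With β = -3αρ^i, composing with A₁ to the power 3-i turns the image (α, β) of xyz into (α,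
  -- -3α), and A₂ turns this into (0, 27α), a multiple of xyz.
  obtain ⟨i, hi, rfl⟩ := exists_pow_of_cube_eq hρ (mul_ne_zero (by norm_num) hα) hβ
  have hpow : ∀ (j : ℕ) (a b : ℂ) (p : Fin 3 → ℂ),
      hesseCubic a b (hesseMatrix ρ 0 ^ j *ᵥ p) = hesseCubic a (ρ ^ j * b) p := by
    intro j
    induction j with
    | zero => simp
    | succ j ih =>
      intro a b p
      rw [pow_succ, ← mulVec_mulVec, ih, hesseCubic_comp_A1 hρ]
      ring_nf
  have hrho : ρ ^ (3 - i) * (-3 * α * ρ ^ i) = -3 * α := by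
    have : ρ ^ (3 - i) * ρ ^ i = 1 := by
      rw [← pow_add, Nat.sub_add_cancel hi.le, hρ.pow_eq_one]
    linear_combination -3 * α * this
  obtain ⟨C, hC, hCG⟩ := memG_hesseMatrix hρ 1
  obtain ⟨D, hD, hDG⟩ := memG_hesseMatrix hρ 0
  have hT : ((C * D ^ (3 - i) * B : GeneralLinearGroup (Fin 3) ℂ) :
      Matrix (Fin 3) (Fin 3) ℂ)ᵀ =
      (B : Matrix (Fin 3) (Fin 3) ℂ)ᵀ * (hesseMatrix ρ 0 ^ (3 - i) * hesseMatrix ρ 1) := by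
    simp only [Units.val_mul, Units.val_pow_eq_pow_val, hC, hD, transpose_mul, transpose_pow,
      hesseMatrix_transpose]
  have hmem := hmono (C * D ^ (3 - i) * B) t (3 * a' + ρ ^ (3 - i) * b')
    (18 * a' - 3 * (ρ ^ (3 - i) * b')) (18 * α - 3 * (-3 * α)) ht
    (fun p => by
      rw [hT, ← mulVec_mulVec, ← mulVec_mulVec, h, hpow, hesseCubic_comp_A2 hρ])
    (fun p => by
      rw [hT, ← mulVec_mulVec, ← mulVec_mulVec, hαβ, hpow, hesseCubic_comp_A2 hρ, hrho]
      ring_nf)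
  rw [map_mul, map_mul, map_pow] at hmem
  exact (Subgroup.mul_mem_cancel_left _ (mul_mem hCG (pow_mem hDG _))).1 hmem

/-- If a linear change of coordinates carries `f_t` to a multiple of `f_s`, its class lies in `G`
and its image in `H` carries `t` to `s`. -/
theorem mk_mem_groupG_and_paramHom {B : GeneralLinearGroup (Fin 3) ℂ} {t s : E6Param} {c : ℂ}
    (h : ∀ p, hesseCubic 1 t ((B : Matrix (Fin 3) (Fin 3) ℂ)ᵀ *ᵥ p) = c * hesseCubic 1 s p) :
    ∃ hB : ProjGenLinGroup.mk B ∈ groupG hρ, paramHom hρ ⟨_, hB⟩ • t = s := by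
  have hB := mk_mem_groupG hρ t.2 (fun p => (h p).trans (hesseCubic_mul c 1 s p))
  refine ⟨hB, Subtype.ext ?_⟩
  obtain ⟨d, hd, e⟩ := carries_paramHom hρ ⟨_, hB⟩ B rfl t
  exact hesseCubic_param_unique hd fun p => by
    rw [← h, e]
    rfl

end

/-! ### The kernel of π and the order of G -/

noncomputable section

open Matrix

theorem monomialMatrix_det_ne_zero {m : Fin 3 → ℂ} (hm : ∀ i, m i ≠ 0)
    (σ : Equiv.Perm (Fin 3)) : (monomialMatrix m σ).det ≠ 0 := by
  have h : monomialMatrix m σ * monomialMatrix (fun i => (m (σ⁻¹ i))⁻¹) σ⁻¹ = 1 := by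
    rw [monomialMatrix_mul, inv_mul_cancel, ← monomialMatrix_one]
    congr 1
    ext i
    simp [hm]
  exact fun h0 => by simpa [h0] using congrArg det h

/-- The invertible matrix whose transpose is a given monomial matrix. -/
def monomialGL (m : Fin 3 → ℂ) (hm : ∀ i, m i ≠ 0) (σ : Equiv.Perm (Fin 3)) :
    GeneralLinearGroup (Fin 3) ℂ :=
  GeneralLinearGroup.mkOfDetNeZero (monomialMatrix m σ)ᵀ
    (by rw [det_transpose]; exact monomialMatrix_det_ne_zero hm σ)

theorem monomialGL_transpose (m : Fin 3 → ℂ) (hm : ∀ i, m i ≠ 0) (σ : Equiv.Perm (Fin 3)) :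
    (monomialGL m hm σ : Matrix (Fin 3) (Fin 3) ℂ)ᵀ = monomialMatrix m σ :=
  transpose_transpose _

theorem monomialMatrix_eq_smul {m m' : Fin 3 → ℂ} (hm : ∀ i, m i ≠ 0) {u : ℂ} (hu : u ≠ 0)
    {σ σ' : Equiv.Perm (Fin 3)} (h : monomialMatrix m' σ' = u • monomialMatrix m σ) :
    σ' = σ ∧ m' = u • m := by
  have h1 : ∀ i, σ i = σ' i ∧ m' i = u * m i := by
    intro i
    have h2 := congrFun (congrFun h i) (σ i)
    simp only [monomialMatrix, of_apply, Matrix.smul_apply, if_true, smul_eq_mul] at h2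
    split_ifs at h2 with h3
    · exact ⟨h3, h2⟩
    · exact absurd h2.symm (mul_ne_zero hu (hm i))
  exact ⟨Equiv.ext fun i => (h1 i).1.symm, funext fun i => (h1 i).2⟩

variable {ρ : ℂ} (hρ : IsPrimitiveRoot ρ 3)

/-- The classes of the monomial matrices that fix all members of the Hesse pencil. -/
def kernelClass (x : Fin 3 × Equiv.Perm (Fin 3)) : ProjGenLinGroup (Fin 3) ℂ :=
  ProjGenLinGroup.mk (monomialGL ![ρ ^ (x.1 : ℕ), ρ ^ (2 * x.1 : ℕ), 1]
    (fun i => by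
      have := hρ.ne_zero (by norm_num)
      fin_cases i <;> simp [this]) x.2)

/-- The entries have cube 1 and product 1, so x³+y³+z³ and xyz are both preserved. -/
theorem carries_kernelClass (x : Fin 3 × Equiv.Perm (Fin 3)) : Carries (kernelClass hρ x) 1 := by
  refine carries_mk fun t => ⟨1, one_ne_zero, fun p => ?_⟩
  rw [monomialGL_transpose, hesseCubic_monomialMatrix]
  have h1 : ∀ k, (![ρ ^ (x.1 : ℕ), ρ ^ (2 * x.1 : ℕ), 1] : Fin 3 → ℂ) k ^ 3 = 1 := by
    intro k
    fin_cases k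
    · simp [← pow_mul, mul_comm _ 3, pow_mul ρ 3, hρ.pow_eq_one]
    · simp [← pow_mul, mul_comm _ 3, pow_mul ρ 3, hρ.pow_eq_one]
    · simp
  have h2 : ρ ^ (x.1 : ℕ) * ρ ^ (2 * x.1 : ℕ) = 1 := by
    rw [← pow_add, show (x.1 : ℕ) + 2 * x.1 = 3 * x.1 by ring, pow_mul, hρ.pow_eq_one, one_pow]
  simp only [h1, one_mul]
  rw [Equiv.sum_comp x.2 (fun k => p k ^ 3)]
  simp [hesseCubic, h2, Fin.sum_univ_three]

theorem kernelClass_injective : Function.Injective (kernelClass hρ) := by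
  rintro ⟨k, σ⟩ ⟨k', σ'⟩ h
  obtain ⟨u, hu, e⟩ := exists_smul_of_mk_eq h
  have e' := congrArg transpose e
  rw [transpose_smul, monomialGL_transpose, monomialGL_transpose] at e'
  obtain ⟨rfl, hm⟩ := monomialMatrix_eq_smul (fun i => by
      have := hρ.ne_zero (by norm_num)
      fin_cases i <;> simp [this]) hu e'
  have h2 : (1 : ℂ) = u := by simpa using congrFun hm 2
  have h0 : ρ ^ (k' : ℕ) = u * ρ ^ (k : ℕ) := by simpa using congrFun hm 0
  rw [← h2, one_mul] at h0
  rw [Fin.ext (hρ.pow_inj k'.2 k.2 h0)]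

/-- A map fixing every member up to factors multiplies the whole pencil by one factor c. It
preserves xyz up to c, so it is monomial, and both the cubes and the product of its entries equal c.
Dividing by the last entry leaves ρ^i, ρ^j, 1 with ρ^(i+j) = 1. -/
theorem exists_kernelClass {g : ProjGenLinGroup (Fin 3) ℂ} (hg : Carries g 1) :
    ∃ x, kernelClass hρ x = g := by
  obtain ⟨B, rfl⟩ := ProjGenLinGroup.mk_surjective g
  obtain ⟨c0, hc0, e0⟩ := hg B rfl ⟨0, by norm_num⟩
  obtain ⟨c1, hc1, e1⟩ := hg B rfl ⟨1, by norm_num⟩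
  obtain ⟨c2, hc2, e2⟩ := hg B rfl ⟨2, by norm_num⟩
  simp only [Equiv.Perm.one_apply] at e0 e1 e2
  -- The relation f₂ = 2f₁ - f₀ forces c2 = 2·c1 - c0 and 2·c2 = 2·c1, so the three factors agree.
  have hc : c0 = c1 := by
    have h := hesseCubic_coeffs (a := c2) (b := 2 * c2) (a' := 2 * c1 - c0) (b' := 2 * c1)
      fun p => by
        have h0 := e0 p
        have h1 := e1 p
        have h2 := e2 p
        simp only [hesseCubic] at h0 h1 h2 ⊢
        linear_combination 2 * h1 - h2 - h0
    linear_combination h.1 - h.2 / 2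
  subst hc
  have hdet : (B : Matrix (Fin 3) (Fin 3) ℂ)ᵀ.det ≠ 0 := by
    rw [det_transpose]; exact B.det_ne_zero
  obtain ⟨m, σ, hm⟩ := exists_monomialMatrix (β := c0) hdet fun p => by
    have h0 := e0 p
    have h1 := e1 p
    simp only [hesseCubic] at h0 h1 ⊢
    linear_combination h1 - h0
  rw [hm] at e1
  have hcube := monomialMatrix_cubes fun p => (e1 p).trans (hesseCubic_mul _ _ _ p)
  rw [mul_one] at hcube
  have hprod : m 0 * m 1 * m 2 = c0 := by
    have h := e1 1
    rw [hesseCubic_monomialMatrix] at h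
    simp [hesseCubic, hcube] at h
    linear_combination h
  have hm2 : m 2 ≠ 0 := fun h => hc0 (by rw [← hcube 2, h]; simp)
  obtain ⟨i, hi3, hi⟩ := exists_pow_of_cube_eq hρ hm2 ((hcube 0).trans (hcube 2).symm)
  obtain ⟨j, hj3, hj⟩ := exists_pow_of_cube_eq hρ hm2 ((hcube 1).trans (hcube 2).symm)
  have hij : ρ ^ (i + j) = 1 := by
    apply mul_left_cancel₀ hc0
    rw [← hcube 2] at hprod ⊢
    rw [hi, hj] at hprod
    rw [pow_add]
    linear_combination hprod
  have hj' : ρ ^ j = ρ ^ (2 * i) := by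
    have h3 := (hρ.pow_eq_one_iff_dvd _).1 hij
    have h4 : ρ ^ (i + i + i) = 1 := by
      rw [show i + i + i = 3 * i by ring, pow_mul, hρ.pow_eq_one, one_pow]
    have h5 : ρ ^ i ≠ 0 := pow_ne_zero _ (hρ.ne_zero (by norm_num))
    apply mul_left_cancel₀ h5
    rw [← pow_add, hij, ← pow_add, ← h4]
    ring_nf
  refine ⟨(⟨i, hi3⟩, σ), mk_eq_of_smul hm2 ?_⟩
  rw [← transpose_inj, transpose_smul, monomialGL_transpose, hm]
  ext k l
  fin_cases k <;> simp [monomialMatrix, hi, hj, hj']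

theorem card_paramHom_ker : Nat.card (paramHom hρ).ker = 18 := by
  have hmem : ∀ x, kernelClass hρ x ∈ groupG hρ := fun x => by
    obtain ⟨B, hB⟩ := ProjGenLinGroup.mk_surjective (kernelClass hρ x)
    obtain ⟨c, hc, e⟩ := carries_kernelClass hρ x B hB ⟨0, by norm_num⟩
    rw [← hB]
    exact mk_mem_groupG hρ (t := 0) (by norm_num) fun p => (e p).trans (hesseCubic_mul c 1 _ p)
  let F : Fin 3 × Equiv.Perm (Fin 3) → (paramHom hρ).ker := fun x =>
    ⟨⟨kernelClass hρ x, hmem x⟩, (MonoidHom.mem_ker).2 (Subtype.ext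
      ((carries_paramHom hρ ⟨kernelClass hρ x, hmem x⟩).unique (carries_kernelClass hρ x)))⟩
  have hF : Function.Bijective F := by
    constructor
    · intro x y hxy
      exact kernelClass_injective hρ (congrArg Subtype.val (congrArg Subtype.val hxy))
    · rintro ⟨g, hg⟩
      have h1 := carries_paramHom hρ g
      rw [MonoidHom.mem_ker.1 hg] at h1
      obtain ⟨x, hx⟩ := exists_kernelClass hρ h1
      exact ⟨x, Subtype.ext (Subtype.ext hx)⟩
  rw [← Nat.card_congr (Equiv.ofBijective F hF)]
  simp [Nat.card_eq_fintype_card, Fintype.card_perm, Nat.factorial]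

theorem card_groupG_eq : Nat.card (groupG hρ) = 18 * Nat.card (groupH hρ) := by
  rw [Subgroup.card_eq_card_quotient_mul_card_subgroup (paramHom hρ).ker, card_paramHom_ker,
    Nat.card_congr (QuotientGroup.quotientKerEquivOfSurjective _ (paramHom_surjective hρ)).toEquiv,
    mul_comm]

/-! ### The group `H` -/

/-- A permutation of the parameters given by a fractional linear transformation. -/
def IsMoebius (h : Equiv.Perm E6Param) : Prop :=
  ∃ a b c d : ℂ, a * d - b * c ≠ 0 ∧
    ∀ t : E6Param, c * t + d ≠ 0 ∧ (h t : ℂ) * (c * t + d) = a * t + b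

/-- This provides rigidity: elements of H are a priori mere permutations of the parameters, but as
fractional linear maps they are determined by three values. -/
theorem isMoebius_of_mem_groupH {h : Equiv.Perm E6Param} (hh : h ∈ groupH hρ) : IsMoebius h := by
  induction hh using Subgroup.closure_induction with
  | mem h hh =>
    rcases hh with rfl | rfl
    · refine ⟨ρ, 0, 0, 1, by simpa using hρ.ne_zero (by norm_num), fun t => ⟨by simp, ?_⟩⟩
      simp [permP]
    · refine ⟨-3, 18, 1, 3, by norm_num, fun t => ?_⟩
      have h := three_add_ne_zero t
      have h' : 1 * (t : ℂ) + 3 = 3 + t := by ring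
      rw [h']
      refine ⟨h, ?_⟩
      change (18 - 3 * (t : ℂ)) / (3 + t) * (3 + t) = _
      rw [div_mul_cancel₀ _ h]
      ring
  | one => exact ⟨1, 0, 0, 1, by simp, fun t => by simp⟩
  | mul g h _ _ hg hh =>
    obtain ⟨a, b, c, d, hdet, hg⟩ := hg
    obtain ⟨a', b', c', d', hdet', hh⟩ := hh
    refine ⟨a * a' + b * c', a * b' + b * d', c * a' + d * c', c * b' + d * d', ?_, fun t => ?_⟩
    · have := mul_ne_zero hdet hdet'
      contrapose this
      linear_combination this
    · obtain ⟨h1, h2⟩ := hh t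
      obtain ⟨h3, h4⟩ := hg (h t)
      have h5 : (c * a' + d * c') * (t : ℂ) + (c * b' + d * d') =
          (c * (h t : ℂ) + d) * (c' * t + d') := by linear_combination -c * h2
      rw [h5]
      refine ⟨mul_ne_zero h3 h1, ?_⟩
      change (g (h t) : ℂ) * _ = _
      linear_combination (c' * t + d') * h4 + a * h2
  | inv h _ hh =>
    obtain ⟨a, b, c, d, hdet, hh⟩ := hh
    refine ⟨d, -b, -c, a, by convert hdet using 1; ring, fun t => ?_⟩
    obtain ⟨h1, h2⟩ := hh (h⁻¹ t)
    rw [show h (h⁻¹ t) = t from h.apply_symm_apply t] at h2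
    refine ⟨fun h3 => hdet ?_, ?_⟩
    · linear_combination (c * (h⁻¹ t : E6Param) + d) * h3 + c * h2
    · linear_combination -h2

/-- The jump points, as parameters. -/
def jumpParam (i : Fin 4) : E6Param :=
  ⟨![0, 6, 6 * ρ, 6 * ρ ^ 2] i, by
    have h := hρ.pow_eq_one
    fin_cases i
    · norm_num
    · norm_num
    · change (6 * ρ) ^ 3 ≠ -27
      rw [mul_pow, h]
      norm_num
    · change (6 * ρ ^ 2) ^ 3 ≠ -27
      rw [mul_pow, ← pow_mul, mul_comm 2, pow_mul, h]
      norm_num⟩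

theorem jumpParam_injective : Function.Injective (jumpParam hρ) := by
  have h0 : ρ ≠ 0 := hρ.ne_zero (by norm_num)
  have h1 : ρ ≠ 1 := hρ.ne_one (by norm_num)
  have h2 : ρ ^ 2 ≠ 1 := hρ.pow_ne_one_of_pos_of_lt (by norm_num) (by norm_num)
  have h3 : ρ ^ 2 ≠ ρ := fun h => h1 (mul_left_cancel₀ h0 (by linear_combination h))
  intro i j hij
  have hij : (![0, 6, 6 * ρ, 6 * ρ ^ 2] : Fin 4 → ℂ) i = ![0, 6, 6 * ρ, 6 * ρ ^ 2] j :=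
    congrArg Subtype.val hij
  fin_cases i <;> fin_cases j <;> first | rfl | (simp [h0] at hij; try grind)

/-- The permutations of the jump points induced by the generators of `H`. -/
def jumpPermP : Equiv.Perm (Fin 4) := Equiv.swap 1 2 * Equiv.swap 2 3

/-- The permutation of the jump points induced by `R`. -/
def jumpPermR : Equiv.Perm (Fin 4) := Equiv.swap 0 1 * Equiv.swap 2 3

/-- The transformation `h` permutes the jump points by `σ`. -/
def PermutesJumps (h : Equiv.Perm E6Param) (σ : Equiv.Perm (Fin 4)) : Prop :=
  ∀ i, h (jumpParam hρ i) = jumpParam hρ (σ i)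

variable {hρ} in
theorem PermutesJumps.mul {h h' : Equiv.Perm E6Param} {σ σ' : Equiv.Perm (Fin 4)}
    (H : PermutesJumps hρ h σ) (H' : PermutesJumps hρ h' σ') :
    PermutesJumps hρ (h * h') (σ * σ') := fun i => by
  change h (h' _) = jumpParam hρ (σ (σ' i))
  rw [H' i, H]

variable {hρ} in
theorem PermutesJumps.inv {h : Equiv.Perm E6Param} {σ : Equiv.Perm (Fin 4)}
    (H : PermutesJumps hρ h σ) : PermutesJumps hρ h⁻¹ σ⁻¹ := fun i => by
  have := H (σ⁻¹ i)
  rw [show σ (σ⁻¹ i) = i from σ.apply_symm_apply i] at this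
  rw [← this]
  exact h.symm_apply_apply _

variable {hρ} in
theorem PermutesJumps.unique {h : Equiv.Perm E6Param} {σ σ' : Equiv.Perm (Fin 4)}
    (H : PermutesJumps hρ h σ) (H' : PermutesJumps hρ h σ') : σ = σ' :=
  Equiv.ext fun i => jumpParam_injective hρ ((H i).symm.trans (H' i))

theorem permutesJumps_one : PermutesJumps hρ 1 1 := fun _ => rfl

theorem permutesJumps_permP : PermutesJumps hρ (permP hρ) jumpPermP := by
  intro i
  refine Subtype.ext ?_
  change ρ * (jumpParam hρ i : ℂ) = _
  have h := hρ.pow_eq_one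
  fin_cases i
  · change ρ * 0 = (0 : ℂ)
    ring
  · change ρ * 6 = 6 * ρ
    ring
  · change ρ * (6 * ρ) = 6 * ρ ^ 2
    ring
  · change ρ * (6 * ρ ^ 2) = 6
    linear_combination 6 * h

theorem permutesJumps_permR : PermutesJumps hρ permR jumpPermR := by
  intro i
  refine Subtype.ext ?_
  change (18 - 3 * (jumpParam hρ i : ℂ)) / (3 + (jumpParam hρ i : ℂ)) = _
  rw [div_eq_iff (three_add_ne_zero _)]
  have h := hρ.pow_eq_one
  have h' := cubeRoot_relation hρ
  fin_cases i
  · change 18 - 3 * (0 : ℂ) = 6 * (3 + 0)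
    ring
  · change 18 - 3 * (6 : ℂ) = 0 * (3 + 6)
    ring
  · change 18 - 3 * (6 * ρ) = 6 * ρ ^ 2 * (3 + 6 * ρ)
    linear_combination -18 * h' - 36 * h + 0 * h
  · change 18 - 3 * (6 * ρ ^ 2) = 6 * ρ * (3 + 6 * ρ ^ 2)
    linear_combination -18 * h' - 36 * h

theorem exists_permutesJumps {h : Equiv.Perm E6Param} (hh : h ∈ groupH hρ) :
    ∃ σ ∈ alternatingGroup (Fin 4), PermutesJumps hρ h σ := by
  induction hh using Subgroup.closure_induction with
  | mem h hh =>
    rcases hh with rfl | rfl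
    · exact ⟨_, by rw [Equiv.Perm.mem_alternatingGroup]; decide, permutesJumps_permP hρ⟩
    · exact ⟨_, by rw [Equiv.Perm.mem_alternatingGroup]; decide, permutesJumps_permR hρ⟩
  | one => exact ⟨1, one_mem _, permutesJumps_one hρ⟩
  | mul g h _ _ hg hh =>
    obtain ⟨σ, hσ, hg⟩ := hg
    obtain ⟨τ, hτ, hh⟩ := hh
    exact ⟨σ * τ, mul_mem hσ hτ, hg.mul hh⟩
  | inv g _ hg =>
    obtain ⟨σ, hσ, hg⟩ := hg
    exact ⟨σ⁻¹, inv_mem hσ, hg.inv⟩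

/-- The powers of the 3-cycle form the stabilizer of the first point. Since A₄ is doubly transitive
there are just two double cosets of this stabilizer, of sizes 3 and 9. The resulting words lift to
H. -/
theorem alternating_four_cases (σ : Equiv.Perm (Fin 4)) (hσ : σ ∈ alternatingGroup (Fin 4)) :
    (∃ i : Fin 3, σ = jumpPermP ^ (i : ℕ)) ∨
      ∃ i j : Fin 3, σ = jumpPermP ^ (i : ℕ) * jumpPermR * jumpPermP ^ (j : ℕ) := by
  rw [Equiv.Perm.mem_alternatingGroup] at hσ
  revert σ
  decide

theorem exists_mem_groupH_permutesJumps {σ : Equiv.Perm (Fin 4)}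
    (hσ : σ ∈ alternatingGroup (Fin 4)) : ∃ h ∈ groupH hρ, PermutesJumps hρ h σ := by
  have hP : permP hρ ∈ groupH hρ := Subgroup.subset_closure (Or.inl rfl)
  have hR : permR ∈ groupH hρ := Subgroup.subset_closure (Or.inr rfl)
  have hpow : ∀ i : ℕ, PermutesJumps hρ (permP hρ ^ i) (jumpPermP ^ i) := by
    intro i
    induction i with
    | zero => exact permutesJumps_one hρ
    | succ i ih =>
      rw [pow_succ, pow_succ]
      exact ih.mul (permutesJumps_permP hρ)
  rcases alternating_four_cases σ hσ with ⟨i, rfl⟩ | ⟨i, j, rfl⟩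
  · exact ⟨_, pow_mem hP _, hpow i⟩
  · exact ⟨_, mul_mem (mul_mem (pow_mem hP _) hR) (pow_mem hP _),
      ((hpow i).mul (permutesJumps_permR hρ)).mul (hpow j)⟩

/-- The three fixed points 0, 6 and 6ρ already force b = c = 0 and a = d in the fractional linear
form. -/
theorem eq_one_of_permutesJumps {h : Equiv.Perm E6Param} (hh : h ∈ groupH hρ)
    (H : PermutesJumps hρ h 1) : h = 1 := by
  obtain ⟨a, b, c, d, hdet, hm⟩ := isMoebius_of_mem_groupH hρ hh
  have hfix : ∀ i, (jumpParam hρ i : ℂ) * (c * (jumpParam hρ i : ℂ) + d) =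
      a * (jumpParam hρ i : ℂ) + b := fun i => by
    have h1 := (hm (jumpParam hρ i)).2
    rw [H i] at h1
    exact h1
  have f0 : (0 : ℂ) * (c * 0 + d) = a * 0 + b := hfix 0
  have f1 : (6 : ℂ) * (c * 6 + d) = a * 6 + b := hfix 1
  have f2 : 6 * ρ * (c * (6 * ρ) + d) = a * (6 * ρ) + b := hfix 2
  have h0 : ρ ≠ 0 := hρ.ne_zero (by norm_num)
  have h1 : ρ - 1 ≠ 0 := sub_ne_zero.2 (hρ.ne_one (by norm_num))
  have hb : b = 0 := by linear_combination -f0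
  have hc : c = 0 := by
    apply mul_left_cancel₀ (mul_ne_zero h0 h1)
    linear_combination (f2 - ρ * f1) / 36 + (1 - ρ) / 36 * hb
  have ha : a = d := by linear_combination -f1 / 6 + 6 * hc - hb / 6
  refine Equiv.ext fun t => Subtype.ext ?_
  obtain ⟨e1, e2⟩ := hm t
  subst hb hc ha
  simp only [zero_mul, zero_add, add_zero] at e1 e2
  exact mul_right_cancel₀ e1 (e2.trans (mul_comm _ _))

/-- The action of `H` on the jump points. -/
def jumpHom : groupH hρ →* alternatingGroup (Fin 4) where
  toFun h := ⟨(exists_permutesJumps hρ h.2).choose, (exists_permutesJumps hρ h.2).choose_spec.1⟩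
  map_one' := Subtype.ext ((exists_permutesJumps hρ (1 : groupH hρ).2).choose_spec.2.unique
    (permutesJumps_one hρ))
  map_mul' g h := Subtype.ext ((exists_permutesJumps hρ (g * h).2).choose_spec.2.unique
    ((exists_permutesJumps hρ g.2).choose_spec.2.mul (exists_permutesJumps hρ h.2).choose_spec.2))

theorem permutesJumps_jumpHom (h : groupH hρ) : PermutesJumps hρ h (jumpHom hρ h : _) :=
  (exists_permutesJumps hρ h.2).choose_spec.2

theorem jumpHom_bijective : Function.Bijective (jumpHom hρ) := by
  constructor
  · rw [injective_iff_map_eq_one]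
    intro h hh
    have H := permutesJumps_jumpHom hρ h
    rw [hh] at H
    exact Subtype.ext (eq_one_of_permutesJumps hρ h.2 H)
  · rintro ⟨σ, hσ⟩
    obtain ⟨h, hh, H⟩ := exists_mem_groupH_permutesJumps hρ hσ
    exact ⟨⟨h, hh⟩, Subtype.ext ((permutesJumps_jumpHom hρ ⟨h, hh⟩).unique H)⟩

/-- The isomorphism from `H` to the alternating group given by the action on the jump points. -/
def groupHEquiv : groupH hρ ≃* alternatingGroup (Fin 4) :=
  MulEquiv.ofBijective (jumpHom hρ) (jumpHom_bijective hρ)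

theorem card_groupH : Nat.card (groupH hρ) = 12 := by
  rw [Nat.card_congr (groupHEquiv hρ).toEquiv, nat_card_alternatingGroup]
  simp [Nat.factorial]

theorem card_groupG : Nat.card (groupG hρ) = 216 := by
  rw [card_groupG_eq, card_groupH]

end

noncomputable section

open Matrix

/-! ### Orders of power series -/

/-- The ideal of the power series of order at least `n`. -/
def orderIdeal (n : ℕ) : Ideal (FormalRing 3) where
  carrier := {h | (n : ℕ∞) ≤ h.order}
  zero_mem' := by simp
  add_mem' ha hb := (le_min ha hb).trans MvPowerSeries.min_order_le_add
  smul_mem' c x hx := by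
    refine le_trans ?_ MvPowerSeries.le_order_mul
    exact le_trans hx (le_add_of_nonneg_left (zero_le))

theorem mem_orderIdeal {n : ℕ} {h : FormalRing 3} :
    h ∈ orderIdeal n ↔ ∀ d : Fin 3 →₀ ℕ, d.degree < n → MvPowerSeries.coeff d h = 0 := by
  constructor
  · intro hh d hd
    exact MvPowerSeries.coeff_of_lt_order (lt_of_lt_of_le (by exact_mod_cast hd) hh)
  · intro hh
    exact MvPowerSeries.nat_le_order hh

theorem mul_mem_orderIdeal {m n : ℕ} {g h : FormalRing 3} (hg : g ∈ orderIdeal m)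
    (hh : h ∈ orderIdeal n) : g * h ∈ orderIdeal (m + n) := by
  change ((m + n : ℕ) : ℕ∞) ≤ _
  push_cast
  exact (add_le_add hg hh).trans MvPowerSeries.le_order_mul

theorem orderIdeal_mul_le (m n : ℕ) : orderIdeal m * orderIdeal n ≤ orderIdeal (m + n) :=
  Ideal.mul_le.2 fun _ hg _ hh => mul_mem_orderIdeal hg hh

theorem orderIdeal_antitone {m n : ℕ} (h : m ≤ n) : orderIdeal n ≤ orderIdeal m :=
  fun _ hx => le_trans (by exact_mod_cast h) (show ((n : ℕ) : ℕ∞) ≤ _ from hx)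

theorem mem_maximalIdeal_iff {h : FormalRing 3} :
    h ∈ IsLocalRing.maximalIdeal (FormalRing 3) ↔ MvPowerSeries.constantCoeff h = 0 := by
  rw [IsLocalRing.mem_maximalIdeal, mem_nonunits_iff, MvPowerSeries.isUnit_iff_constantCoeff,
    isUnit_iff_ne_zero, not_not]

theorem mem_orderIdeal_one {h : FormalRing 3} :
    h ∈ orderIdeal 1 ↔ MvPowerSeries.constantCoeff h = 0 := by
  rw [mem_orderIdeal]
  constructor
  · intro H
    exact H 0 (by simp)
  · intro H d hd
    have : d = 0 := by
      rw [← Finsupp.degree_eq_zero_iff]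
      omega
    rw [this]
    exact H

theorem maximalIdeal_pow_le (n : ℕ) :
    IsLocalRing.maximalIdeal (FormalRing 3) ^ n ≤ orderIdeal n := by
  induction n with
  | zero => exact fun x _ => mem_orderIdeal.2 fun d hd => by omega
  | succ n ih =>
    rw [pow_succ]
    exact (Ideal.mul_mono ih fun x hx =>
      mem_orderIdeal_one.2 (mem_maximalIdeal_iff.1 hx)).trans (orderIdeal_mul_le n 1)

theorem X_mem_orderIdeal (i : Fin 3) : (MvPowerSeries.X i : FormalRing 3) ∈ orderIdeal 1 :=
  mem_orderIdeal_one.2 (MvPowerSeries.constantCoeff_X i)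

theorem sub_C_mem_orderIdeal (h : FormalRing 3) :
    h - MvPowerSeries.C (MvPowerSeries.constantCoeff h) ∈ orderIdeal 1 :=
  mem_orderIdeal_one.2 (by simp)

theorem X_pow_mem_orderIdeal (i : Fin 3) (n : ℕ) :
    (MvPowerSeries.X i : FormalRing 3) ^ n ∈ orderIdeal n := by
  have := Ideal.pow_mem_pow (mem_maximalIdeal_iff.2 (MvPowerSeries.constantCoeff_X (R := ℂ) i)) n
  exact maximalIdeal_pow_le n this

theorem e6Poly_mem_orderIdeal (t : ℂ) : e6Poly t ∈ orderIdeal 3 := by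
  refine add_mem (add_mem (add_mem ?_ ?_) ?_) (Ideal.mul_mem_left _ _ ?_)
  · exact X_pow_mem_orderIdeal 0 3
  · exact X_pow_mem_orderIdeal 1 3
  · exact X_pow_mem_orderIdeal 2 3
  · exact mul_mem_orderIdeal (mul_mem_orderIdeal (X_mem_orderIdeal 0) (X_mem_orderIdeal 1))
      (X_mem_orderIdeal 2)

/-- The ideal generated by the variables is the maximal ideal. -/
theorem exists_sum_X_mul {h : FormalRing 3} (hh : MvPowerSeries.constantCoeff h = 0) :
    ∃ q : Fin 3 → FormalRing 3, h = ∑ i, MvPowerSeries.X i * q i := by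
  classical
  -- The series is split into the terms divisible by x, those divisible by y but not by x, and the
  -- pure powers of z; the constant term is absent by `hh`.
  let h0 : FormalRing 3 := fun d => if d 0 = 0 then 0 else MvPowerSeries.coeff d h
  let h1 : FormalRing 3 := fun d => if d 0 = 0 then if d 1 = 0 then 0 else
    MvPowerSeries.coeff d h else 0
  let h2 : FormalRing 3 := fun d => if d 0 = 0 then if d 1 = 0 then
    MvPowerSeries.coeff d h else 0 else 0
  have c0 : ∀ d, MvPowerSeries.coeff d h0 = if d 0 = 0 then 0 else MvPowerSeries.coeff d h :=
    fun d => rfl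
  have c1 : ∀ d, MvPowerSeries.coeff d h1 = if d 0 = 0 then if d 1 = 0 then 0 else
    MvPowerSeries.coeff d h else 0 := fun d => rfl
  have c2 : ∀ d, MvPowerSeries.coeff d h2 = if d 0 = 0 then if d 1 = 0 then
    MvPowerSeries.coeff d h else 0 else 0 := fun d => rfl
  obtain ⟨q0, e0⟩ := MvPowerSeries.X_dvd_iff (s := (0 : Fin 3)) (φ := h0) |>.2 fun d hd => by
    rw [c0, if_pos hd]
  obtain ⟨q1, e1⟩ := MvPowerSeries.X_dvd_iff (s := (1 : Fin 3)) (φ := h1) |>.2 fun d hd => by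
    rw [c1]
    simp [hd]
  obtain ⟨q2, e2⟩ := MvPowerSeries.X_dvd_iff (s := (2 : Fin 3)) (φ := h2) |>.2 fun d hd => by
    rw [c2]
    split_ifs with h3 h4
    · have : d = 0 := by
        ext i
        fin_cases i <;> assumption
      rw [this]
      exact hh
    · rfl
    · rfl
  refine ⟨![q0, q1, q2], ?_⟩
  simp only [Fin.sum_univ_three, cons_val_zero, cons_val_one, cons_val_two, tail_cons, head_cons]
  rw [← e0, ← e1, ← e2]
  ext d
  simp only [map_add, c0, c1, c2]
  split_ifs <;> simp

/-! ### The partial derivatives of the cubics -/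

theorem pderiv_e6Poly_zero (t : ℂ) : MvPowerSeries.pderiv ℂ 0 (e6Poly t) =
    3 * MvPowerSeries.X 0 ^ 2 + MvPowerSeries.C t * (MvPowerSeries.X 1 * MvPowerSeries.X 2) := by
  simp only [e6Poly, map_add, Derivation.leibniz, Derivation.leibniz_pow, MvPowerSeries.pderiv_C,
    MvPowerSeries.pderiv_X]
  simp
  exact Or.inl (mul_comm _ _)

theorem pderiv_e6Poly_one (t : ℂ) : MvPowerSeries.pderiv ℂ 1 (e6Poly t) =
    3 * MvPowerSeries.X 1 ^ 2 + MvPowerSeries.C t * (MvPowerSeries.X 0 * MvPowerSeries.X 2) := by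
  simp only [e6Poly, map_add, Derivation.leibniz, Derivation.leibniz_pow, MvPowerSeries.pderiv_C,
    MvPowerSeries.pderiv_X]
  simp
  exact Or.inl (mul_comm _ _)

theorem pderiv_e6Poly_two (t : ℂ) : MvPowerSeries.pderiv ℂ 2 (e6Poly t) =
    3 * MvPowerSeries.X 2 ^ 2 + MvPowerSeries.C t * (MvPowerSeries.X 0 * MvPowerSeries.X 1) := by
  simp only [e6Poly, map_add, Derivation.leibniz, Derivation.leibniz_pow, MvPowerSeries.pderiv_C,
    MvPowerSeries.pderiv_X]
  simp

theorem pderiv_e6Poly_mem (t : ℂ) (i : Fin 3) :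
    MvPowerSeries.pderiv ℂ i (e6Poly t) ∈ orderIdeal 2 := by
  have h : ∀ i j k : Fin 3, 3 * MvPowerSeries.X i ^ 2 + MvPowerSeries.C t *
      (MvPowerSeries.X j * MvPowerSeries.X k) ∈ orderIdeal 2 := fun i j k =>
    add_mem (Ideal.mul_mem_left _ _ (X_pow_mem_orderIdeal i 2)) (Ideal.mul_mem_left _ _
      (mul_mem_orderIdeal (X_mem_orderIdeal j) (X_mem_orderIdeal k)))
  fin_cases i
  · change MvPowerSeries.pderiv ℂ 0 _ ∈ _
    rw [pderiv_e6Poly_zero]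
    exact h 0 1 2
  · change MvPowerSeries.pderiv ℂ 1 _ ∈ _
    rw [pderiv_e6Poly_one]
    exact h 1 0 2
  · change MvPowerSeries.pderiv ℂ 2 _ ∈ _
    rw [pderiv_e6Poly_two]
    exact h 2 0 1

theorem jacobiIdeal_e6Poly_le (t : ℂ) : jacobiIdeal (e6Poly t) ≤ orderIdeal 2 := by
  rw [jacobiIdeal, Ideal.span_le]
  rintro _ ⟨i, rfl⟩
  exact pderiv_e6Poly_mem t i

theorem moduliIdeal_coe {n : ℕ} (f : FormalRing n) (k : ℕ) : moduliIdeal f k =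
    Ideal.span {f} ⊔ IsLocalRing.maximalIdeal (FormalRing n) ^ k * jacobiIdeal f := rfl

/-- No linear form is killed in any Aᵏ, so the matrix of an isomorphism in degree one is well
defined. -/
theorem moduliIdeal_le_orderIdeal (t : ℂ) (k : ℕ∞) : moduliIdeal (e6Poly t) k ≤ orderIdeal 2 := by
  have h1 : Ideal.span {e6Poly t} ≤ orderIdeal 2 := by
    rw [Ideal.span_singleton_le_iff_mem]
    exact orderIdeal_antitone (by norm_num) (e6Poly_mem_orderIdeal t)
  induction k using ENat.recTopCoe with
  | top => exact h1
  | coe k =>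
    rw [moduliIdeal_coe]
    exact sup_le h1 (Ideal.mul_le_right.trans (jacobiIdeal_e6Poly_le t))

/-- Here k ≥ 2 parts from k ≤ 1: mᵏJ starts in degree k + 2 ≥ 4, so in degree three the ideal
contains only the multiples of f_t. -/
theorem moduliIdeal_le_sup (t : ℂ) {k : ℕ∞} (hk : 2 ≤ k) :
    moduliIdeal (e6Poly t) k ≤ Ideal.span {e6Poly t} ⊔ orderIdeal 4 := by
  induction k using ENat.recTopCoe with
  | top => exact le_sup_left
  | coe k =>
    rw [moduliIdeal_coe]
    refine sup_le_sup le_rfl ?_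
    have hk' : 4 ≤ k + 2 := by
      have : 2 ≤ k := by exact_mod_cast hk
      omega
    exact (Ideal.mul_mono (maximalIdeal_pow_le k) (jacobiIdeal_e6Poly_le t)).trans
      ((orderIdeal_mul_le k 2).trans (orderIdeal_antitone hk'))

/-! ### Linear substitutions -/

/-- The linear form `∑ i, B i j x_i`. -/
def linearForm (B : Matrix (Fin 3) (Fin 3) ℂ) (j : Fin 3) : MvPolynomial (Fin 3) ℂ :=
  ∑ i, MvPolynomial.C (B i j) * MvPolynomial.X i

theorem linearForm_isHomogeneous (B : Matrix (Fin 3) (Fin 3) ℂ) (j : Fin 3) :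
    (linearForm B j).IsHomogeneous 1 := by
  refine MvPolynomial.IsHomogeneous.sum _ _ _ fun i _ => ?_
  simpa using (MvPolynomial.isHomogeneous_C (Fin 3) (B i j)).mul
    (MvPolynomial.isHomogeneous_X ℂ i)

theorem coe_linearForm (B : Matrix (Fin 3) (Fin 3) ℂ) (j : Fin 3) :
    (linearForm B j : FormalRing 3) = ∑ i, B i j • (MvPowerSeries.X i : FormalRing 3) := by
  simp [linearForm, Fin.sum_univ_three, MvPowerSeries.smul_eq_C_mul]

theorem hasSubst_linearForm (B : Matrix (Fin 3) (Fin 3) ℂ) :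
    MvPowerSeries.HasSubst fun j => (linearForm B j : FormalRing 3) :=
  MvPowerSeries.hasSubst_of_constantCoeff_zero fun j => by
    rw [coe_linearForm]
    simp

/-- The linear substitution `x_j ↦ ∑ i, B i j x_i`. -/
def linearSubst (B : Matrix (Fin 3) (Fin 3) ℂ) : FormalRing 3 →ₐ[ℂ] FormalRing 3 :=
  MvPowerSeries.substAlgHom (hasSubst_linearForm B)

theorem linearSubst_X (B : Matrix (Fin 3) (Fin 3) ℂ) (j : Fin 3) :
    linearSubst B (MvPowerSeries.X j) = ∑ i, B i j • (MvPowerSeries.X i : FormalRing 3) := by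
  rw [← coe_linearForm]
  exact MvPowerSeries.substAlgHom_X _ j

theorem linearSubst_C (B : Matrix (Fin 3) (Fin 3) ℂ) (c : ℂ) :
    linearSubst B (MvPowerSeries.C c) = MvPowerSeries.C c :=
  (linearSubst B).commutes c

theorem linearSubst_coe (B : Matrix (Fin 3) (Fin 3) ℂ) (p : MvPolynomial (Fin 3) ℂ) :
    linearSubst B p = (MvPolynomial.aeval (linearForm B) p : MvPolynomial (Fin 3) ℂ) := by
  have : (linearSubst B).comp (MvPolynomial.coeToMvPowerSeries.algHom ℂ) =
      (MvPolynomial.coeToMvPowerSeries.algHom ℂ).comp (MvPolynomial.aeval (linearForm B)) := by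
    apply MvPolynomial.algHom_ext
    intro j
    simp [MvPolynomial.coeToMvPowerSeries.algHom_apply, linearSubst_X, coe_linearForm]
  simpa [MvPolynomial.coeToMvPowerSeries.algHom_apply] using DFunLike.congr_fun this p

theorem linearSubst_one (h : FormalRing 3) : linearSubst 1 h = h := by
  have h1 : (fun j => (linearForm 1 j : FormalRing 3)) = MvPowerSeries.X := by
    funext j
    rw [coe_linearForm]
    simp [one_apply]
  change MvPowerSeries.substAlgHom _ h = h
  rw [MvPowerSeries.substAlgHom_apply, h1, MvPowerSeries.subst_self]
  rfl

theorem linearSubst_linearSubst (B C : Matrix (Fin 3) (Fin 3) ℂ) (h : FormalRing 3) :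
    linearSubst B (linearSubst C h) = linearSubst (B * C) h := by
  have h1 : (fun j => (linearForm (B * C) j : FormalRing 3)) =
      fun j => MvPowerSeries.subst (fun j => (linearForm B j : FormalRing 3))
        (linearForm C j : FormalRing 3) := by
    funext j
    rw [← MvPowerSeries.substAlgHom_apply (hasSubst_linearForm B)]
    change _ = linearSubst B _
    simp only [coe_linearForm, map_sum, map_smul, linearSubst_X, mul_apply, Finset.smul_sum,
      Finset.sum_smul, smul_smul]
    rw [Finset.sum_comm]
    simp only [mul_comm]
  simp only [linearSubst, MvPowerSeries.substAlgHom_apply]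
  rw [MvPowerSeries.subst_comp_subst_apply (hasSubst_linearForm C) (hasSubst_linearForm B), h1]

/-- The linear substitution attached to an invertible matrix, as an automorphism. -/
def linearSubstEquiv (B : GeneralLinearGroup (Fin 3) ℂ) : FormalRing 3 ≃ₐ[ℂ] FormalRing 3 :=
  AlgEquiv.ofAlgHom (linearSubst B) (linearSubst (B⁻¹ : GeneralLinearGroup (Fin 3) ℂ))
    (AlgHom.ext fun h => by
      change linearSubst _ (linearSubst _ h) = h
      rw [linearSubst_linearSubst, Units.mul_inv, linearSubst_one])
    (AlgHom.ext fun h => by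
      change linearSubst _ (linearSubst _ h) = h
      rw [linearSubst_linearSubst, Units.inv_mul, linearSubst_one])

end

/-! ### The cubics as polynomials under linear substitution -/

noncomputable section

open Matrix

/-- The polynomial `x³ + y³ + z³ + t x y z`. -/
def e6MvPoly (t : ℂ) : MvPolynomial (Fin 3) ℂ :=
  MvPolynomial.X 0 ^ 3 + MvPolynomial.X 1 ^ 3 + MvPolynomial.X 2 ^ 3 +
    MvPolynomial.C t * (MvPolynomial.X 0 * MvPolynomial.X 1 * MvPolynomial.X 2)

theorem coe_e6MvPoly (t : ℂ) : (e6MvPoly t : FormalRing 3) = e6Poly t := by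
  simp [e6MvPoly, e6Poly]

theorem e6MvPoly_isHomogeneous (t : ℂ) : (e6MvPoly t).IsHomogeneous 3 := by
  have h := fun i => MvPolynomial.isHomogeneous_X ℂ (i : Fin 3)
  refine MvPolynomial.IsHomogeneous.add (MvPolynomial.IsHomogeneous.add
    (MvPolynomial.IsHomogeneous.add ?_ ?_) ?_) ?_
  · simpa using (h 0).pow 3
  · simpa using (h 1).pow 3
  · simpa using (h 2).pow 3
  · simpa using (MvPolynomial.isHomogeneous_C (Fin 3) t).mul (((h 0).mul (h 1)).mul (h 2))

theorem eval_e6MvPoly (t : ℂ) (p : Fin 3 → ℂ) :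
    MvPolynomial.eval p (e6MvPoly t) = hesseCubic 1 t p := by
  simp [e6MvPoly, hesseCubic]

theorem eval_linearForm (B : Matrix (Fin 3) (Fin 3) ℂ) (j : Fin 3) (p : Fin 3 → ℂ) :
    MvPolynomial.eval p (linearForm B j) = (Bᵀ *ᵥ p) j := by
  simp [linearForm, mulVec, dotProduct]

theorem eval_aeval_linearForm (B : Matrix (Fin 3) (Fin 3) ℂ) (q : MvPolynomial (Fin 3) ℂ)
    (p : Fin 3 → ℂ) : MvPolynomial.eval p (MvPolynomial.aeval (linearForm B) q) =
      MvPolynomial.eval (Bᵀ *ᵥ p) q := by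
  have : (MvPolynomial.aeval (R := ℂ) p).comp (MvPolynomial.aeval (linearForm B)) =
      MvPolynomial.aeval (R := ℂ) (Bᵀ *ᵥ p) := by
    apply MvPolynomial.algHom_ext
    intro j
    simp only [AlgHom.comp_apply, MvPolynomial.aeval_X, MvPolynomial.aeval_eq_eval,
      eval_linearForm]
  simpa [MvPolynomial.aeval_eq_eval] using DFunLike.congr_fun this q

theorem linearSubst_e6Poly {B : Matrix (Fin 3) (Fin 3) ℂ} {t s c : ℂ}
    (h : ∀ p, hesseCubic 1 t (Bᵀ *ᵥ p) = c * hesseCubic 1 s p) :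
    linearSubst B (e6Poly t) = MvPowerSeries.C c * e6Poly s := by
  have h1 : MvPolynomial.aeval (linearForm B) (e6MvPoly t) =
      MvPolynomial.C c * e6MvPoly s := by
    apply MvPolynomial.funext
    intro p
    rw [eval_aeval_linearForm, eval_e6MvPoly, h, map_mul, MvPolynomial.eval_C, eval_e6MvPoly]
  rw [← coe_e6MvPoly, linearSubst_coe, h1, MvPolynomial.coe_mul, MvPolynomial.coe_C, coe_e6MvPoly]

/-- If a linear substitution carries `f_t` to a multiple of `f_s` up to terms of order four, it
does so exactly. -/
theorem hesseCubic_comp_of_sub_mem {B : Matrix (Fin 3) (Fin 3) ℂ} {t s : ℂ} {g : FormalRing 3}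
    (h : linearSubst B (e6Poly t) - g * e6Poly s ∈ orderIdeal 4) (p : Fin 3 → ℂ) :
    hesseCubic 1 t (Bᵀ *ᵥ p) = MvPowerSeries.constantCoeff g * hesseCubic 1 s p := by
  set c := MvPowerSeries.constantCoeff g
  -- As f_s has order three, g may be replaced by its constant term modulo order four.
  have h1 : linearSubst B (e6Poly t) - MvPowerSeries.C c * e6Poly s ∈ orderIdeal 4 := by
    have h2 := mul_mem_orderIdeal (sub_C_mem_orderIdeal g) (e6Poly_mem_orderIdeal s)
    convert add_mem h h2 using 1
    ring
  set q := MvPolynomial.aeval (linearForm B) (e6MvPoly t) - MvPolynomial.C c * e6MvPoly s with hq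
  have hqc : (q : FormalRing 3) = linearSubst B (e6Poly t) - MvPowerSeries.C c * e6Poly s := by
    rw [← coe_e6MvPoly t, linearSubst_coe, ← coe_e6MvPoly s, ← MvPolynomial.coe_C,
      ← MvPolynomial.coe_mul, hq]
    exact map_sub (MvPolynomial.coeToMvPowerSeries.ringHom (R := ℂ)) _ _
  have hqh : q.IsHomogeneous 3 := by
    refine MvPolynomial.IsHomogeneous.sub ?_ ?_
    · simpa using (e6MvPoly_isHomogeneous t).aeval _ (linearForm_isHomogeneous B)
    · simpa using (MvPolynomial.isHomogeneous_C (Fin 3) c).mul (e6MvPoly_isHomogeneous s)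
  -- A cubic form of order at least four is zero.
  have hq0 : q = 0 := by
    ext d
    by_cases hd : d.degree = 3
    · rw [← MvPolynomial.coeff_coe, hqc, mem_orderIdeal.1 h1 d (by omega)]
      simp
    · rw [hqh.coeff_eq_zero hd]
      simp
  have h3 := congrArg (MvPolynomial.eval p) hq0
  rw [hq, map_sub, eval_aeval_linearForm, map_mul, MvPolynomial.eval_C, eval_e6MvPoly,
    eval_e6MvPoly, map_zero, sub_eq_zero] at h3
  exact h3

/-! ### Linear substitutions and moduli ideals -/

theorem pderiv_linearSubst_X (B : Matrix (Fin 3) (Fin 3) ℂ) (i j : Fin 3) :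
    MvPowerSeries.pderiv ℂ i (linearSubst B (MvPowerSeries.X j)) = MvPowerSeries.C (B i j) := by
  rw [linearSubst_X, map_sum]
  simp only [Derivation.map_smul, MvPowerSeries.pderiv_X]
  rw [Finset.sum_eq_single i (fun k _ hk => by simp [hk]) (by simp)]
  simp [MvPowerSeries.smul_eq_C_mul]

/-- The chain rule for a linear substitution. -/
theorem pderiv_linearSubst (B : Matrix (Fin 3) (Fin 3) ℂ) (t : ℂ) (i : Fin 3) :
    MvPowerSeries.pderiv ℂ i (linearSubst B (e6Poly t)) =
      ∑ j, MvPowerSeries.C (B i j) * linearSubst B (MvPowerSeries.pderiv ℂ j (e6Poly t)) := by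
  simp only [Fin.sum_univ_three, pderiv_e6Poly_zero, pderiv_e6Poly_one, pderiv_e6Poly_two]
  simp only [e6Poly, map_add, map_mul, map_pow, linearSubst_C, Derivation.leibniz,
    Derivation.leibniz_pow, MvPowerSeries.pderiv_C, pderiv_linearSubst_X, map_ofNat]
  simp only [smul_eq_mul, nsmul_eq_mul]
  push_cast
  ring

/-- The chain rule writes c·∂ᵢf_s as a combination, with matrix B, of the substituted partial
derivatives of f_t; applying B⁻¹ solves for the latter. -/
theorem linearSubst_pderiv {B : GeneralLinearGroup (Fin 3) ℂ} {t s c : ℂ}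
    (h : ∀ p, hesseCubic 1 t ((B : Matrix (Fin 3) (Fin 3) ℂ)ᵀ *ᵥ p) = c * hesseCubic 1 s p)
    (j : Fin 3) : linearSubst B (MvPowerSeries.pderiv ℂ j (e6Poly t)) ∈ jacobiIdeal (e6Poly s) := by
  have h1 : ∀ i, ∑ j, MvPowerSeries.C ((B : Matrix (Fin 3) (Fin 3) ℂ) i j) *
      linearSubst B (MvPowerSeries.pderiv ℂ j (e6Poly t)) ∈ jacobiIdeal (e6Poly s) := fun i => by
    rw [← pderiv_linearSubst, linearSubst_e6Poly h, Derivation.leibniz, MvPowerSeries.pderiv_C,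
      smul_zero, add_zero]
    exact Ideal.mul_mem_left _ _ (Ideal.subset_span ⟨i, rfl⟩)
  have h2 : linearSubst B (MvPowerSeries.pderiv ℂ j (e6Poly t)) =
      ∑ i, MvPowerSeries.C (((B⁻¹ : GeneralLinearGroup (Fin 3) ℂ) :
        Matrix (Fin 3) (Fin 3) ℂ) j i) *
        ∑ k, MvPowerSeries.C ((B : Matrix (Fin 3) (Fin 3) ℂ) i k) *
          linearSubst B (MvPowerSeries.pderiv ℂ k (e6Poly t)) := by
    simp only [Finset.mul_sum, ← mul_assoc, ← map_mul]
    rw [Finset.sum_comm]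
    simp only [← Finset.sum_mul, ← map_sum, ← mul_apply, Units.inv_mul]
    rw [Finset.sum_eq_single j (fun k _ hk => by simp [one_apply, hk.symm]) (by simp)]
    simp
  rw [h2]
  exact Ideal.sum_mem _ fun i _ => Ideal.mul_mem_left _ _ (h1 i)

/-- The substitution respects each ingredient of the ideal separately: f, the maximal ideal, and the
Jacobi ideal. -/
theorem linearSubst_mem_moduliIdeal {B : GeneralLinearGroup (Fin 3) ℂ} {t s c : ℂ}
    (h : ∀ p, hesseCubic 1 t ((B : Matrix (Fin 3) (Fin 3) ℂ)ᵀ *ᵥ p) = c * hesseCubic 1 s p)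
    (k : ℕ∞) : Ideal.map (linearSubst (B : Matrix (Fin 3) (Fin 3) ℂ)) (moduliIdeal (e6Poly t) k) ≤
      moduliIdeal (e6Poly s) k := by
  have h1 : Ideal.map (linearSubst (B : Matrix (Fin 3) (Fin 3) ℂ)) (Ideal.span {e6Poly t}) ≤
      Ideal.span {e6Poly s} := by
    rw [Ideal.map_span, Set.image_singleton, linearSubst_e6Poly h,
      Ideal.span_singleton_le_iff_mem]
    exact Ideal.mul_mem_left _ _ (Ideal.mem_span_singleton_self _)
  have h2 : Ideal.map (linearSubst (B : Matrix (Fin 3) (Fin 3) ℂ)) (jacobiIdeal (e6Poly t)) ≤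
      jacobiIdeal (e6Poly s) := by
    rw [jacobiIdeal, Ideal.map_span, Ideal.span_le]
    rintro _ ⟨_, ⟨j, rfl⟩, rfl⟩
    exact linearSubst_pderiv h j
  have h3 : Ideal.map (linearSubst (B : Matrix (Fin 3) (Fin 3) ℂ))
      (IsLocalRing.maximalIdeal (FormalRing 3)) ≤ IsLocalRing.maximalIdeal (FormalRing 3) := by
    rw [Ideal.map_le_iff_le_comap]
    intro x hx
    rw [Ideal.mem_comap, mem_maximalIdeal_iff]
    rw [mem_maximalIdeal_iff] at hx
    obtain ⟨q, rfl⟩ := exists_sum_X_mul hx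
    simp [linearSubst_X, Fin.sum_univ_three]
  induction k using ENat.recTopCoe with
  | top => exact h1
  | coe k =>
    rw [moduliIdeal_coe, moduliIdeal_coe, Ideal.map_sup, Ideal.map_mul, Ideal.map_pow]
    exact sup_le_sup h1 (Ideal.mul_mono (Ideal.pow_right_mono h3 k) h2)

theorem hesseCubic_comp_inv {B : GeneralLinearGroup (Fin 3) ℂ} {t s c : ℂ} (hc : c ≠ 0)
    (h : ∀ p, hesseCubic 1 t ((B : Matrix (Fin 3) (Fin 3) ℂ)ᵀ *ᵥ p) = c * hesseCubic 1 s p)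
    (p : Fin 3 → ℂ) : hesseCubic 1 s (((B⁻¹ : GeneralLinearGroup (Fin 3) ℂ) :
      Matrix (Fin 3) (Fin 3) ℂ)ᵀ *ᵥ p) = c⁻¹ * hesseCubic 1 t p := by
  have e2 : (B : Matrix (Fin 3) (Fin 3) ℂ)ᵀ *
      ((B⁻¹ : GeneralLinearGroup (Fin 3) ℂ) : Matrix (Fin 3) (Fin 3) ℂ)ᵀ = 1 := by
    rw [← transpose_mul, Units.inv_mul, transpose_one]
  have e1 := h (((B⁻¹ : GeneralLinearGroup (Fin 3) ℂ) : Matrix (Fin 3) (Fin 3) ℂ)ᵀ *ᵥ p)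
  rw [mulVec_mulVec, e2, one_mulVec] at e1
  rw [e1, inv_mul_cancel_left₀ hc]

theorem map_moduliIdeal_eq {B : GeneralLinearGroup (Fin 3) ℂ} {t s c : ℂ} (hc : c ≠ 0)
    (h : ∀ p, hesseCubic 1 t ((B : Matrix (Fin 3) (Fin 3) ℂ)ᵀ *ᵥ p) = c * hesseCubic 1 s p)
    (k : ℕ∞) : moduliIdeal (e6Poly s) k =
      Ideal.map (linearSubstEquiv B : FormalRing 3 →+* FormalRing 3) (moduliIdeal (e6Poly t) k) := by
  refine le_antisymm ?_ (linearSubst_mem_moduliIdeal h k)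
  intro x hx
  have h1 := linearSubst_mem_moduliIdeal (hesseCubic_comp_inv hc h) k (Ideal.mem_map_of_mem _ hx)
  have h2 := Ideal.mem_map_of_mem (linearSubstEquiv B : FormalRing 3 →+* FormalRing 3) h1
  have h3 : (linearSubstEquiv B : FormalRing 3 →+* FormalRing 3) (linearSubst
      ((B⁻¹ : GeneralLinearGroup (Fin 3) ℂ) : Matrix (Fin 3) (Fin 3) ℂ) x) = x :=
    (linearSubstEquiv B).apply_symm_apply x
  rwa [h3] at h2

/-- The isomorphism of moduli algebras induced by a linear substitution. -/
def moduliEquiv {B : GeneralLinearGroup (Fin 3) ℂ} {t s c : ℂ} (hc : c ≠ 0)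
    (h : ∀ p, hesseCubic 1 t ((B : Matrix (Fin 3) (Fin 3) ℂ)ᵀ *ᵥ p) = c * hesseCubic 1 s p)
    (k : ℕ∞) : ModuliAlgebra (e6Poly t) k ≃ₐ[ℂ] ModuliAlgebra (e6Poly s) k :=
  Ideal.quotientEquivAlg _ _ (linearSubstEquiv B) (map_moduliIdeal_eq hc h k)

theorem moduliEquiv_toModuli {B : GeneralLinearGroup (Fin 3) ℂ} {t s c : ℂ} (hc : c ≠ 0)
    (h : ∀ p, hesseCubic 1 t ((B : Matrix (Fin 3) (Fin 3) ℂ)ᵀ *ᵥ p) = c * hesseCubic 1 s p)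
    (k : ℕ∞) (x : FormalRing 3) : moduliEquiv hc h k (toModuli (e6Poly t) k x) =
      toModuli (e6Poly s) k (linearSubst B x) := rfl

theorem mem_gradedPiece {n : ℕ} {f : FormalRing n} {k : ℕ∞} {d : ℕ} {a : ModuliAlgebra f k} :
    a ∈ gradedPiece f k d ↔ ∃ p : MvPolynomial (Fin n) ℂ, p.IsHomogeneous d ∧
      toModuli f k p = a := by
  rfl

theorem moduliEquiv_mem_gradedPiece {B : GeneralLinearGroup (Fin 3) ℂ} {t s c : ℂ} (hc : c ≠ 0)
    (h : ∀ p, hesseCubic 1 t ((B : Matrix (Fin 3) (Fin 3) ℂ)ᵀ *ᵥ p) = c * hesseCubic 1 s p)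
    {k : ℕ∞} {d : ℕ} {a : ModuliAlgebra (e6Poly t) k} (ha : a ∈ gradedPiece (e6Poly t) k d) :
    moduliEquiv hc h k a ∈ gradedPiece (e6Poly s) k d := by
  obtain ⟨p, hp, rfl⟩ := mem_gradedPiece.1 ha
  rw [moduliEquiv_toModuli, linearSubst_coe]
  refine mem_gradedPiece.2 ⟨_, ?_, rfl⟩
  simpa using hp.aeval _ (linearForm_isHomogeneous (B : Matrix (Fin 3) (Fin 3) ℂ))

/-- The homogeneous isomorphism induced by a linear substitution. -/
def homogeneousIsoOfLinear {B : GeneralLinearGroup (Fin 3) ℂ} {t s c : ℂ} (hc : c ≠ 0)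
    (h : ∀ p, hesseCubic 1 t ((B : Matrix (Fin 3) (Fin 3) ℂ)ᵀ *ᵥ p) = c * hesseCubic 1 s p)
    (k : ℕ∞) : HomogeneousIso (e6Poly t) (e6Poly s) k where
  toAlgEquiv := moduliEquiv hc h k
  map_gradedPiece d := by
    refine le_antisymm ?_ fun a ha => ?_
    · rintro _ ⟨a, ha, rfl⟩
      exact moduliEquiv_mem_gradedPiece hc h ha
    · refine ⟨moduliEquiv (inv_ne_zero hc) (hesseCubic_comp_inv hc h) k a,
        moduliEquiv_mem_gradedPiece _ _ ha, ?_⟩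
      obtain ⟨x, rfl⟩ := Ideal.Quotient.mkₐ_surjective ℂ (moduliIdeal (e6Poly s) k) a
      change moduliEquiv hc h k (moduliEquiv _ _ k (toModuli _ _ x)) = toModuli _ _ x
      rw [moduliEquiv_toModuli, moduliEquiv_toModuli, linearSubst_linearSubst, Units.mul_inv,
        linearSubst_one]

end

noncomputable section

open Matrix

/-! ### The functional on cubic forms that vanishes on the Jacobi ideal -/

/-- The exponent of `x ^ a y ^ b z ^ c`. -/
def triExp (a b c : ℕ) : Fin 3 →₀ ℕ :=
  Finsupp.single 0 a + Finsupp.single 1 b + Finsupp.single 2 c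

theorem triExp_le {a b c a' b' c' : ℕ} :
    triExp a b c ≤ triExp a' b' c' ↔ a ≤ a' ∧ b ≤ b' ∧ c ≤ c' := by
  rw [Finsupp.le_def]
  simp [Fin.forall_fin_succ, triExp]

theorem triExp_inj {a b c a' b' c' : ℕ} :
    triExp a b c = triExp a' b' c' ↔ a = a' ∧ b = b' ∧ c = c' := by
  rw [Finsupp.ext_iff]
  simp [Fin.forall_fin_succ, triExp]

theorem triExp_sub (a b c a' b' c' : ℕ) :
    triExp a b c - triExp a' b' c' = triExp (a - a') (b - b') (c - c') := by
  ext i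
  fin_cases i <;> simp [triExp]

theorem monomial_triExp (a b c : ℕ) : (MvPowerSeries.monomial (triExp a b c) (1 : ℂ)) =
    MvPowerSeries.X 0 ^ a * MvPowerSeries.X 1 ^ b * MvPowerSeries.X 2 ^ c := by
  simp only [triExp, MvPowerSeries.X_pow_eq, MvPowerSeries.monomial_mul_monomial, mul_one]

theorem coeff_triExp_mul (a b c a' b' c' : ℕ) (g : FormalRing 3) :
    MvPowerSeries.coeff (triExp a b c) (g * (MvPowerSeries.X 0 ^ a' * MvPowerSeries.X 1 ^ b' *
      MvPowerSeries.X 2 ^ c')) = if a' ≤ a ∧ b' ≤ b ∧ c' ≤ c then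
        MvPowerSeries.coeff (triExp (a - a') (b - b') (c - c')) g else 0 := by
  classical
  rw [← monomial_triExp, MvPowerSeries.coeff_mul_monomial, triExp_sub, mul_one]
  exact if_congr triExp_le rfl rfl

theorem coeff_triExp (a b c a' b' c' : ℕ) :
    MvPowerSeries.coeff (triExp a b c) (MvPowerSeries.X 0 ^ a' * MvPowerSeries.X 1 ^ b' *
      MvPowerSeries.X 2 ^ c' : FormalRing 3) = if a = a' ∧ b = b' ∧ c = c' then 1 else 0 := by
  classical
  rw [← monomial_triExp, MvPowerSeries.coeff_monomial]
  exact if_congr triExp_inj rfl rfl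

/-- The functional on cubic forms that vanishes on the multiples of the partial derivatives
of `f_t`. -/
def cubicFunctional (t : ℂ) : FormalRing 3 →ₗ[ℂ] ℂ :=
  MvPowerSeries.coeff (triExp 1 1 1) - (t / 3) • (MvPowerSeries.coeff (triExp 3 0 0) +
    MvPowerSeries.coeff (triExp 0 3 0) + MvPowerSeries.coeff (triExp 0 0 3))

theorem cubicFunctional_apply (t : ℂ) (h : FormalRing 3) : cubicFunctional t h =
    MvPowerSeries.coeff (triExp 1 1 1) h - t / 3 * (MvPowerSeries.coeff (triExp 3 0 0) h +
      MvPowerSeries.coeff (triExp 0 3 0) h + MvPowerSeries.coeff (triExp 0 0 3) h) := rfl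

theorem cubicFunctional_monomial (t : ℂ) (a b c : ℕ) : cubicFunctional t
    (MvPowerSeries.X 0 ^ a * MvPowerSeries.X 1 ^ b * MvPowerSeries.X 2 ^ c) =
      if a = 1 ∧ b = 1 ∧ c = 1 then 1 else if (a = 3 ∧ b = 0 ∧ c = 0) ∨ (a = 0 ∧ b = 3 ∧ c = 0) ∨
        (a = 0 ∧ b = 0 ∧ c = 3) then - (t / 3) else 0 := by
  simp only [cubicFunctional_apply, coeff_triExp]
  split_ifs <;> grind

theorem pderiv_e6Poly (t : ℂ) {i j k : Fin 3} (hij : i ≠ j) (hik : i ≠ k) (hjk : j ≠ k) :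
    MvPowerSeries.pderiv ℂ i (e6Poly t) = 3 * MvPowerSeries.X i ^ 2 +
      MvPowerSeries.C t * (MvPowerSeries.X j * MvPowerSeries.X k) := by
  have h0 := pderiv_e6Poly_zero t
  have h1 := pderiv_e6Poly_one t
  have h2 := pderiv_e6Poly_two t
  fin_cases i <;> fin_cases j <;> fin_cases k <;> first
    | exact absurd rfl hij
    | exact absurd rfl hik
    | exact absurd rfl hjk
    | exact h0
    | exact h1
    | exact h2
    | exact h0.trans (by congr 2; exact mul_comm _ _)
    | exact h1.trans (by congr 2; exact mul_comm _ _)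
    | exact h2.trans (by congr 2; exact mul_comm _ _)

/-- Only the coefficient of xᵢ in g contributes: it enters with t through xyz and with 3·(-t/3)
through xᵢ³, and the two cancel. -/
theorem cubicFunctional_mul_pderiv (t : ℂ) (g : FormalRing 3) (i : Fin 3) :
    cubicFunctional t (g * MvPowerSeries.pderiv ℂ i (e6Poly t)) = 0 := by
  have h : ∀ {a b c a' b' c' : ℕ}, cubicFunctional t (g * (3 * (MvPowerSeries.X 0 ^ a *
      MvPowerSeries.X 1 ^ b * MvPowerSeries.X 2 ^ c) + MvPowerSeries.C t * (MvPowerSeries.X 0 ^ a' *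
      MvPowerSeries.X 1 ^ b' * MvPowerSeries.X 2 ^ c'))) = 3 * cubicFunctional t (g *
      (MvPowerSeries.X 0 ^ a * MvPowerSeries.X 1 ^ b * MvPowerSeries.X 2 ^ c)) +
      t * cubicFunctional t (g *
      (MvPowerSeries.X 0 ^ a' * MvPowerSeries.X 1 ^ b' * MvPowerSeries.X 2 ^ c')) := by
    intro a b c a' b' c'
    rw [← smul_eq_mul (3 : ℂ), ← smul_eq_mul t, ← map_smul, ← map_smul, ← map_add]
    congr 1
    rw [MvPowerSeries.smul_eq_C_mul, MvPowerSeries.smul_eq_C_mul, map_ofNat]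
    ring
  fin_cases i
  · change cubicFunctional t (g * MvPowerSeries.pderiv ℂ 0 _) = 0
    rw [pderiv_e6Poly_zero]
    have h' := h (a := 2) (b := 0) (c := 0) (a' := 0) (b' := 1) (c' := 1)
    simp only [cubicFunctional_apply, coeff_triExp_mul] at h' ⊢
    simp at h' ⊢
    rw [h']
    ring
  · change cubicFunctional t (g * MvPowerSeries.pderiv ℂ 1 _) = 0
    rw [pderiv_e6Poly_one]
    have h' := h (a := 0) (b := 2) (c := 0) (a' := 1) (b' := 0) (c' := 1)
    simp only [cubicFunctional_apply, coeff_triExp_mul] at h' ⊢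
    simp at h' ⊢
    rw [h']
    ring
  · change cubicFunctional t (g * MvPowerSeries.pderiv ℂ 2 _) = 0
    rw [pderiv_e6Poly_two]
    have h' := h (a := 0) (b := 0) (c := 2) (a' := 1) (b' := 1) (c' := 0)
    simp only [cubicFunctional_apply, coeff_triExp_mul] at h' ⊢
    simp at h' ⊢
    rw [h']
    ring

/-- The Euler relation. -/
theorem e6Poly_euler (t : ℂ) : MvPowerSeries.C 3 * e6Poly t =
    ∑ i, MvPowerSeries.X i * MvPowerSeries.pderiv ℂ i (e6Poly t) := by
  simp only [Fin.sum_univ_three, pderiv_e6Poly_zero, pderiv_e6Poly_one, pderiv_e6Poly_two,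
    map_ofNat]
  rw [e6Poly]
  ring

theorem e6Poly_mem_jacobiIdeal (t : ℂ) : e6Poly t ∈ jacobiIdeal (e6Poly t) := by
  have h : e6Poly t = MvPowerSeries.C 3⁻¹ * (MvPowerSeries.C 3 * e6Poly t) := by
    rw [← mul_assoc, ← map_mul]
    simp
  have h' : MvPowerSeries.C 3 * e6Poly t ∈ jacobiIdeal (e6Poly t) := by
    rw [e6Poly_euler]
    exact Ideal.sum_mem _ fun i _ => Ideal.mul_mem_left _ _ (Ideal.subset_span ⟨i, rfl⟩)
  have h'' := Ideal.mul_mem_left _ (MvPowerSeries.C 3⁻¹) h'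
  rwa [← h] at h''

theorem moduliIdeal_le_jacobiIdeal (t : ℂ) (k : ℕ) :
    moduliIdeal (e6Poly t) k ≤ jacobiIdeal (e6Poly t) := by
  rw [moduliIdeal_coe]
  refine sup_le ?_ Ideal.mul_le_right
  rw [Ideal.span_singleton_le_iff_mem]
  exact e6Poly_mem_jacobiIdeal t

theorem cubicFunctional_eq_zero {t : ℂ} {k : ℕ} {h : FormalRing 3}
    (hh : h ∈ moduliIdeal (e6Poly t) k) : cubicFunctional t h = 0 := by
  have h1 := moduliIdeal_le_jacobiIdeal t k hh
  rw [jacobiIdeal, Ideal.mem_span_range_iff_exists_fun] at h1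
  obtain ⟨g, rfl⟩ := h1
  rw [map_sum]
  exact Finset.sum_eq_zero fun i _ => cubicFunctional_mul_pderiv t (g i) i

theorem X_mul_pderiv_mem (t : ℂ) {k : ℕ} (hk : k ≤ 1) (i j : Fin 3) :
    MvPowerSeries.X j * MvPowerSeries.pderiv ℂ i (e6Poly t) ∈ moduliIdeal (e6Poly t) k := by
  rw [moduliIdeal_coe]
  refine Ideal.mem_sup_right (Ideal.mul_mem_mul ?_ (Ideal.subset_span ⟨i, rfl⟩))
  refine Ideal.pow_le_pow_right hk ?_
  rw [pow_one, mem_maximalIdeal_iff]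
  exact MvPowerSeries.constantCoeff_X j

/-- The monomials `x_i² x_j` with `i ≠ j` lie in the moduli ideal. -/
theorem X_sq_mul_X_mem {t : ℂ} (ht : t ^ 3 ≠ -27) {k : ℕ} (hk : k ≤ 1) {i j : Fin 3}
    (hij : i ≠ j) : MvPowerSeries.X i ^ 2 * MvPowerSeries.X j ∈ moduliIdeal (e6Poly t) k := by
  obtain ⟨l, hil, hjl⟩ : ∃ l : Fin 3, i ≠ l ∧ j ≠ l := by
    revert i j
    decide
  have h0 : (27 + t ^ 3) ≠ 0 := fun h => ht (by linear_combination h)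
  have h1 : (MvPowerSeries.C (27 + t ^ 3)⁻¹ * MvPowerSeries.C (27 + t ^ 3) : FormalRing 3) = 1 := by
    rw [← map_mul, inv_mul_cancel₀ h0, map_one]
  -- Cramer's rule: xⱼ∂ᵢf, xₗ∂ⱼf and xᵢ∂ₗf form a cyclic linear system in xᵢ²xⱼ, xⱼ²xₗ and xₗ²xᵢ
  -- with determinant 27 + t³.
  have h2 : (MvPowerSeries.X i ^ 2 * MvPowerSeries.X j : FormalRing 3) =
      MvPowerSeries.C (27 + t ^ 3)⁻¹ *
        (9 * (MvPowerSeries.X j * MvPowerSeries.pderiv ℂ i (e6Poly t)) +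
        MvPowerSeries.C (-3 * t) * (MvPowerSeries.X l * MvPowerSeries.pderiv ℂ j (e6Poly t)) +
        MvPowerSeries.C (t ^ 2) * (MvPowerSeries.X i * MvPowerSeries.pderiv ℂ l (e6Poly t))) := by
    rw [pderiv_e6Poly t hij hil hjl, pderiv_e6Poly t hjl hij.symm hil.symm,
      pderiv_e6Poly t hil.symm hjl.symm hij]
    have h3 : (MvPowerSeries.C (27 + t ^ 3) : FormalRing 3) = 27 + MvPowerSeries.C t ^ 3 := by
      rw [map_add, map_pow, map_ofNat]
    have h4 : (MvPowerSeries.C (-3 * t) : FormalRing 3) = -3 * MvPowerSeries.C t := by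
      rw [map_mul, map_neg, map_ofNat]
    rw [h3] at h1
    rw [h4, map_pow]
    linear_combination -(MvPowerSeries.X i ^ 2 * MvPowerSeries.X j) * h1
  rw [h2]
  exact Ideal.mul_mem_left _ _ (add_mem (add_mem (Ideal.mul_mem_left _ _ (X_mul_pderiv_mem t hk _ _))
    (Ideal.mul_mem_left _ _ (X_mul_pderiv_mem t hk _ _)))
    (Ideal.mul_mem_left _ _ (X_mul_pderiv_mem t hk _ _)))

theorem X_cube_add_mem (t : ℂ) {k : ℕ} (hk : k ≤ 1) (i : Fin 3) :
    3 * MvPowerSeries.X i ^ 3 + MvPowerSeries.C t * (MvPowerSeries.X 0 * MvPowerSeries.X 1 *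
      MvPowerSeries.X 2) ∈ moduliIdeal (e6Poly t) k := by
  convert X_mul_pderiv_mem t hk i i using 1
  fin_cases i
  · change 3 * MvPowerSeries.X 0 ^ 3 + _ = MvPowerSeries.X 0 * MvPowerSeries.pderiv ℂ 0 _
    rw [pderiv_e6Poly_zero]
    ring
  · change 3 * MvPowerSeries.X 1 ^ 3 + _ = MvPowerSeries.X 1 * MvPowerSeries.pderiv ℂ 1 _
    rw [pderiv_e6Poly_one]
    ring
  · change 3 * MvPowerSeries.X 2 ^ 3 + _ = MvPowerSeries.X 2 * MvPowerSeries.pderiv ℂ 2 _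
    rw [pderiv_e6Poly_two]
    ring

/-- The values on cubes of linear forms of a functional that annihilates the degree three part of
the Jacobi ideal. -/
theorem functional_cube (μ : FormalRing 3 →ₗ[ℂ] ℂ) (t : ℂ)
    (h : ∀ i j, i ≠ j → μ (MvPowerSeries.X i ^ 2 * MvPowerSeries.X j) = 0)
    (h' : ∀ i : Fin 3, μ (3 * MvPowerSeries.X i ^ 3 + MvPowerSeries.C t * (MvPowerSeries.X 0 *
      MvPowerSeries.X 1 * MvPowerSeries.X 2)) = 0) (v : Fin 3 → ℂ) :
    μ ((∑ i, v i • MvPowerSeries.X i) ^ 3) =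
      μ (MvPowerSeries.X 0 * MvPowerSeries.X 1 * MvPowerSeries.X 2) * hesseCubic (-t / 3) 6 v := by
  have h1 : ∀ i : Fin 3, μ (MvPowerSeries.X i ^ 3) =
      -t / 3 * μ (MvPowerSeries.X 0 * MvPowerSeries.X 1 * MvPowerSeries.X 2) := by
    intro i
    have h2 := h' i
    rw [← map_ofNat (MvPowerSeries.C (σ := Fin 3) (R := ℂ)), ← MvPowerSeries.smul_eq_C_mul,
      ← MvPowerSeries.smul_eq_C_mul, map_add, map_smul, map_smul, smul_eq_mul, smul_eq_mul] at h2
    linear_combination h2 / 3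
  have h2 : (∑ i, v i • MvPowerSeries.X i : FormalRing 3) ^ 3 =
      v 0 ^ 3 • MvPowerSeries.X 0 ^ 3 + v 1 ^ 3 • MvPowerSeries.X 1 ^ 3 +
      v 2 ^ 3 • MvPowerSeries.X 2 ^ 3 +
      (3 * v 0 ^ 2 * v 1) • (MvPowerSeries.X 0 ^ 2 * MvPowerSeries.X 1) +
      (3 * v 0 ^ 2 * v 2) • (MvPowerSeries.X 0 ^ 2 * MvPowerSeries.X 2) +
      (3 * v 1 ^ 2 * v 0) • (MvPowerSeries.X 1 ^ 2 * MvPowerSeries.X 0) +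
      (3 * v 1 ^ 2 * v 2) • (MvPowerSeries.X 1 ^ 2 * MvPowerSeries.X 2) +
      (3 * v 2 ^ 2 * v 0) • (MvPowerSeries.X 2 ^ 2 * MvPowerSeries.X 0) +
      (3 * v 2 ^ 2 * v 1) • (MvPowerSeries.X 2 ^ 2 * MvPowerSeries.X 1) +
      (6 * v 0 * v 1 * v 2) • (MvPowerSeries.X 0 * MvPowerSeries.X 1 * MvPowerSeries.X 2) := by
    simp only [Fin.sum_univ_three, MvPowerSeries.smul_eq_C_mul, map_mul, map_pow, map_ofNat]
    ring
  rw [h2]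
  simp only [map_add, map_smul, h1, h 0 1 (by decide), h 0 2 (by decide), h 1 0 (by decide),
    h 1 2 (by decide), h 2 0 (by decide), h 2 1 (by decide), smul_eq_mul, hesseCubic]
  ring

theorem cubicFunctional_xyz (t : ℂ) : cubicFunctional t
    (MvPowerSeries.X 0 * MvPowerSeries.X 1 * MvPowerSeries.X 2) = 1 := by
  simpa using cubicFunctional_monomial t 1 1 1

theorem cubicFunctional_cube {t : ℂ} (ht : t ^ 3 ≠ -27) (v : Fin 3 → ℂ) :
    cubicFunctional t ((∑ i, v i • MvPowerSeries.X i) ^ 3) = hesseCubic (-t / 3) 6 v := by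
  rw [functional_cube _ t (fun i j hij => cubicFunctional_eq_zero (k := 0)
    (X_sq_mul_X_mem ht (by norm_num) hij)) (fun i => cubicFunctional_eq_zero (k := 0)
    (X_cube_add_mem t (by norm_num) i)), cubicFunctional_xyz, one_mul]

/-- A linear substitution that maps the degree three part of the Jacobi ideal of `f_t` to that
of `f_s` carries the dual cubics to each other. -/
theorem dualCubic_comp {B : Matrix (Fin 3) (Fin 3) ℂ} {t s : ℂ} (ht : t ^ 3 ≠ -27)
    (hs : s ^ 3 ≠ -27) {k : ℕ} (hk : k ≤ 1)
    (h : ∀ p : MvPolynomial (Fin 3) ℂ, (p : FormalRing 3) ∈ moduliIdeal (e6Poly t) k →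
      linearSubst B p ∈ moduliIdeal (e6Poly s) k) :
    ∃ c : ℂ, ∀ v, hesseCubic (-s / 3) 6 (B *ᵥ v) = c * hesseCubic (-t / 3) 6 v := by
  -- The pulled-back functional annihilates the degree-three relations at t, so by `functional_cube`
  -- its values on cubes are a multiple of the dual cubic at t. Since the substitution sends the
  -- linear form with coefficients v to the one with coefficients Bv, B acts here without a
  -- transpose.
  let μ : FormalRing 3 →ₗ[ℂ] ℂ := cubicFunctional s ∘ₗ (linearSubst B).toLinearMap
  have hμ : ∀ x, μ x = cubicFunctional s (linearSubst B x) := fun x => rfl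
  refine ⟨μ (MvPowerSeries.X 0 * MvPowerSeries.X 1 * MvPowerSeries.X 2), fun v => ?_⟩
  rw [← functional_cube μ t, ← cubicFunctional_cube hs, hμ]
  · rw [map_pow (linearSubst B), map_sum (linearSubst B)]
    congr 2
    simp only [map_smul, linearSubst_X, Finset.smul_sum, smul_smul]
    rw [Finset.sum_comm]
    simp only [← Finset.sum_smul, mulVec, dotProduct, mul_comm]
  · intro i j hij
    have := X_sq_mul_X_mem ht hk hij
    have h1 := h (MvPolynomial.X i ^ 2 * MvPolynomial.X j) (by simpa using this)
    rw [hμ]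
    simpa using cubicFunctional_eq_zero h1
  · intro i
    have := X_cube_add_mem t hk i
    have h3 : ((3 : MvPolynomial (Fin 3) ℂ) : FormalRing 3) = 3 :=
      map_ofNat (MvPolynomial.coeToMvPowerSeries.ringHom (R := ℂ) (σ := Fin 3)) 3
    have h1 := h (3 * MvPolynomial.X i ^ 3 + MvPolynomial.C t * (MvPolynomial.X 0 *
      MvPolynomial.X 1 * MvPolynomial.X 2)) (by simpa [h3] using this)
    rw [hμ]
    have h2 := cubicFunctional_eq_zero h1
    simpa only [MvPolynomial.coe_add, MvPolynomial.coe_mul, MvPolynomial.coe_pow,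
      MvPolynomial.coe_X, MvPolynomial.coe_C, h3] using h2

end

noncomputable section

open Matrix

/-! ### Matrices of homogeneous isomorphisms -/

theorem eval_smul_of_isHomogeneous {p : MvPolynomial (Fin 3) ℂ} {d : ℕ} (hp : p.IsHomogeneous d)
    (u : ℂ) (q : Fin 3 → ℂ) : MvPolynomial.eval (u • q) p = u ^ d * MvPolynomial.eval q p := by
  rw [MvPolynomial.eval_eq', MvPolynomial.eval_eq', Finset.mul_sum]
  refine Finset.sum_congr rfl fun e he => ?_
  have h : e.degree = d := by
    by_contra h
    exact MvPolynomial.mem_support_iff.1 he (hp.coeff_eq_zero h)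
  rw [← h, Finsupp.degree_eq_sum, ← Finset.prod_pow_eq_pow_sum]
  simp only [Pi.smul_apply, smul_eq_mul, mul_pow, Finset.prod_mul_distrib]
  ring

namespace HomogeneousIso

variable {t s r : ℂ} {k : ℕ∞}

/-- `B` is the matrix of `φ` in weight one. -/
def MatrixIs (φ : HomogeneousIso (e6Poly t) (e6Poly s) k) (B : Matrix (Fin 3) (Fin 3) ℂ) : Prop :=
  ∀ j : Fin 3, φ.toAlgEquiv (toModuli (e6Poly t) k (MvPowerSeries.X j)) =
    ∑ i : Fin 3, B i j • toModuli (e6Poly s) k (MvPowerSeries.X i)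

theorem toModuli_X_independent (t : ℂ) (k : ℕ∞) {a b : Fin 3 → ℂ}
    (h : ∑ i, a i • toModuli (e6Poly t) k (MvPowerSeries.X i) =
      ∑ i, b i • toModuli (e6Poly t) k (MvPowerSeries.X i)) : a = b := by
  simp only [← map_smul, ← map_sum] at h
  have h1 := moduliIdeal_le_orderIdeal t k (Ideal.Quotient.eq.1 h)
  funext j
  have h2 := mem_orderIdeal.1 h1 (Finsupp.single j 1) (by simp)
  simp only [map_sub, map_sum, MvPowerSeries.coeff_smul, sub_eq_zero] at h2
  classical
  simpa [MvPowerSeries.coeff_index_single_X] using h2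

theorem exists_sum_of_mem_gradedPiece_one {a : ModuliAlgebra (e6Poly s) k}
    (ha : a ∈ gradedPiece (e6Poly s) k 1) :
    ∃ b : Fin 3 → ℂ, a = ∑ i, b i • toModuli (e6Poly s) k (MvPowerSeries.X i) := by
  obtain ⟨p, hp, rfl⟩ := mem_gradedPiece.1 ha
  have hp' : p ∈ MvPolynomial.homogeneousSubmodule (Fin 3) ℂ 1 := hp
  rw [MvPolynomial.homogeneousSubmodule_one_eq_span_X, Submodule.mem_span_range_iff_exists_fun] at hp'
  obtain ⟨b, rfl⟩ := hp'
  refine ⟨b, ?_⟩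
  rw [show ((∑ i, b i • MvPolynomial.X i : MvPolynomial (Fin 3) ℂ) : FormalRing 3) =
    ∑ i, b i • MvPowerSeries.X i by simp [Fin.sum_univ_three], map_sum]
  simp only [map_smul]

theorem exists_matrixIs (φ : HomogeneousIso (e6Poly t) (e6Poly s) k) : ∃ B, φ.MatrixIs B := by
  have h : ∀ j : Fin 3, ∃ b : Fin 3 → ℂ, φ.toAlgEquiv (toModuli (e6Poly t) k (MvPowerSeries.X j)) =
      ∑ i, b i • toModuli (e6Poly s) k (MvPowerSeries.X i) := fun j => by
    refine exists_sum_of_mem_gradedPiece_one (φ.mem_piece (mem_gradedPiece.2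
      ⟨MvPolynomial.X j, MvPolynomial.isHomogeneous_X ℂ j, ?_⟩))
    rw [MvPolynomial.coe_X]
  choose b hb using h
  exact ⟨Matrix.of fun i j => b j i, hb⟩

theorem MatrixIs.unique {φ : HomogeneousIso (e6Poly t) (e6Poly s) k}
    {B C : Matrix (Fin 3) (Fin 3) ℂ} (hB : φ.MatrixIs B) (hC : φ.MatrixIs C) : B = C := by
  ext i j
  exact congrFun (toModuli_X_independent s k ((hB j).symm.trans (hC j))) i

theorem MatrixIs.trans {φ : HomogeneousIso (e6Poly t) (e6Poly s) k}
    {ψ : HomogeneousIso (e6Poly s) (e6Poly r) k} {B C : Matrix (Fin 3) (Fin 3) ℂ}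
    (hB : φ.MatrixIs B) (hC : ψ.MatrixIs C) : (φ.trans ψ).MatrixIs (C * B) := by
  intro j
  change ψ.toAlgEquiv (φ.toAlgEquiv _) = _
  rw [hB j, map_sum]
  simp only [map_smul, hC _, Finset.smul_sum, smul_smul]
  rw [Finset.sum_comm]
  simp only [← Finset.sum_smul, mul_apply, mul_comm]

theorem MatrixIs.refl (t : ℂ) (k : ℕ∞) : (HomogeneousIso.refl (e6Poly t) k).MatrixIs 1 := by
  intro j
  rw [Finset.sum_eq_single j (fun i _ hi => by simp [one_apply, hi]) (by simp)]
  simp [HomogeneousIso.refl]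

/-- The matrices of φ and of its inverse are mutually inverse, because the matrix of a composite is
the product and matrices are unique. -/
theorem exists_matrixIs_gl (φ : HomogeneousIso (e6Poly t) (e6Poly s) k) :
    ∃ B : GeneralLinearGroup (Fin 3) ℂ, φ.MatrixIs (B : Matrix (Fin 3) (Fin 3) ℂ) := by
  obtain ⟨B, hB⟩ := φ.exists_matrixIs
  obtain ⟨C, hC⟩ := φ.symm.exists_matrixIs
  have h1 : B * C = 1 := by
    refine (hC.trans hB).unique (φ := φ.symm.trans φ) ?_
    rw [show φ.symm.trans φ = HomogeneousIso.refl _ k from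
      HomogeneousIso.ext (AlgEquiv.symm_trans_self φ.toAlgEquiv)]
    exact MatrixIs.refl s k
  have h2 : C * B = 1 := by
    refine (hB.trans hC).unique (φ := φ.trans φ.symm) ?_
    rw [show φ.trans φ.symm = HomogeneousIso.refl _ k from
      HomogeneousIso.ext (AlgEquiv.self_trans_symm φ.toAlgEquiv)]
    exact MatrixIs.refl t k
  exact ⟨⟨B, C, h1, h2⟩, hB⟩

/-- No continuity of φ is assumed, so it is compared with the substitution on polynomials only,
where the images of the variables determine it. This is enough: graded pieces consist of classes of
polynomials, and the relations used are polynomial. -/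
theorem MatrixIs.apply_coe {φ : HomogeneousIso (e6Poly t) (e6Poly s) k}
    {B : Matrix (Fin 3) (Fin 3) ℂ} (hB : φ.MatrixIs B) (p : MvPolynomial (Fin 3) ℂ) :
    φ.toAlgEquiv (toModuli (e6Poly t) k p) = toModuli (e6Poly s) k (linearSubst B p) := by
  have h : (φ.toAlgEquiv.toAlgHom.comp (toModuli (e6Poly t) k)).comp
      (MvPolynomial.coeToMvPowerSeries.algHom ℂ) =
      ((toModuli (e6Poly s) k).comp (linearSubst B)).comp
        (MvPolynomial.coeToMvPowerSeries.algHom ℂ) := by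
    apply MvPolynomial.algHom_ext
    intro j
    simp only [AlgHom.comp_apply, MvPolynomial.coeToMvPowerSeries.algHom_apply, MvPolynomial.coe_X,
      MvPowerSeries.map_X]
    refine (hB j).trans ?_
    rw [linearSubst_X, map_sum]
    simp only [map_smul]
  simpa [MvPolynomial.coeToMvPowerSeries.algHom_apply] using DFunLike.congr_fun h p

/-- Homogeneous isomorphisms with proportional matrices are equal modulo scalars. -/
theorem MatrixIs.toClass_eq {φ ψ : HomogeneousIso (e6Poly t) (e6Poly s) k}
    {B C : Matrix (Fin 3) (Fin 3) ℂ} (hB : φ.MatrixIs B) (hC : ψ.MatrixIs C) {u : ℂ} (hu : u ≠ 0)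
    (h : B = u • C) : φ.toClass = ψ.toClass := by
  refine Quotient.sound ⟨u, hu, fun d a ha => ?_⟩
  obtain ⟨p, hp, rfl⟩ := mem_gradedPiece.1 ha
  rw [hB.apply_coe, hC.apply_coe, ← map_smul]
  congr 1
  rw [linearSubst_coe, linearSubst_coe, ← MvPolynomial.coe_smul]
  congr 1
  apply MvPolynomial.funext
  intro q
  rw [eval_aeval_linearForm, MvPolynomial.smul_eval, eval_aeval_linearForm, h, transpose_smul,
    smul_mulVec]
  exact eval_smul_of_isHomogeneous hp u _

/-- The matrices of isomorphisms that are equal modulo scalars are proportional. -/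
theorem MatrixIs.proportional {φ ψ : HomogeneousIso (e6Poly t) (e6Poly s) k}
    {B C : Matrix (Fin 3) (Fin 3) ℂ} (hB : φ.MatrixIs B) (hC : ψ.MatrixIs C)
    (h : φ.toClass = ψ.toClass) : ∃ u : ℂ, u ≠ 0 ∧ B = u • C := by
  obtain ⟨u, hu, H⟩ := Quotient.exact h
  refine ⟨u, hu, hB.unique fun j => ?_⟩
  rw [H 1 _ (mem_gradedPiece.2 ⟨MvPolynomial.X j, MvPolynomial.isHomogeneous_X ℂ j, by
    rw [MvPolynomial.coe_X]⟩), hC j, Finset.smul_sum]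
  simp [smul_smul]

theorem MatrixIs.homogeneousIsoOfLinear {B : GeneralLinearGroup (Fin 3) ℂ} {c : ℂ} (hc : c ≠ 0)
    (h : ∀ p, hesseCubic 1 t ((B : Matrix (Fin 3) (Fin 3) ℂ)ᵀ *ᵥ p) = c * hesseCubic 1 s p)
    (k : ℕ∞) : (homogeneousIsoOfLinear hc h k).MatrixIs (B : Matrix (Fin 3) (Fin 3) ℂ) := by
  intro j
  change moduliEquiv hc h k _ = _
  rw [moduliEquiv_toModuli, linearSubst_X, map_sum]
  simp only [map_smul]

theorem MatrixIs.linearSubst_mem {φ : HomogeneousIso (e6Poly t) (e6Poly s) k}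
    {B : Matrix (Fin 3) (Fin 3) ℂ} (hB : φ.MatrixIs B) {p : MvPolynomial (Fin 3) ℂ}
    (hp : (p : FormalRing 3) ∈ moduliIdeal (e6Poly t) k) :
    linearSubst B p ∈ moduliIdeal (e6Poly s) k := by
  have h1 : toModuli (e6Poly t) k p = 0 := Ideal.Quotient.eq_zero_iff_mem.2 hp
  have h2 := hB.apply_coe p
  rw [h1, map_zero] at h2
  exact Ideal.Quotient.eq_zero_iff_mem.1 h2.symm

theorem e6Poly_mem_moduliIdeal (t : ℂ) (k : ℕ∞) : e6Poly t ∈ moduliIdeal (e6Poly t) k := by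
  induction k using ENat.recTopCoe with
  | top => exact Ideal.mem_span_singleton_self _
  | coe k => exact Ideal.mem_sup_left (Ideal.mem_span_singleton_self _)

/-- For `2 ≤ k` a homogeneous isomorphism carries `f_t` to a multiple of `f_s`. -/
theorem MatrixIs.hesseCubic_comp {φ : HomogeneousIso (e6Poly t) (e6Poly s) k}
    {B : Matrix (Fin 3) (Fin 3) ℂ} (hB : φ.MatrixIs B) (hk : 2 ≤ k) :
    ∃ c : ℂ, ∀ p, hesseCubic 1 t (Bᵀ *ᵥ p) = c * hesseCubic 1 s p := by
  have h1 := hB.linearSubst_mem (p := e6MvPoly t) (by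
    rw [coe_e6MvPoly]; exact e6Poly_mem_moduliIdeal t k)
  rw [coe_e6MvPoly] at h1
  obtain ⟨x, hx, y, hy, hxy⟩ := Submodule.mem_sup.1 (moduliIdeal_le_sup s hk h1)
  obtain ⟨g, rfl⟩ := Ideal.mem_span_singleton'.1 hx
  refine ⟨_, hesseCubic_comp_of_sub_mem (g := g) ?_⟩
  rw [← hxy]
  simpa using hy

end HomogeneousIso

end

/-! ### Matrices of homogeneous isomorphisms lie in G -/

noncomputable section

open Matrix

variable {ρ : ℂ} (hρ : IsPrimitiveRoot ρ 3)

/-- The transpose of an invertible matrix. -/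
def transposeGL (B : GeneralLinearGroup (Fin 3) ℂ) : GeneralLinearGroup (Fin 3) ℂ :=
  ⟨(B : Matrix (Fin 3) (Fin 3) ℂ)ᵀ, ((B⁻¹ : GeneralLinearGroup (Fin 3) ℂ) : Matrix _ _ ℂ)ᵀ,
    by rw [← transpose_mul, Units.inv_mul, transpose_one],
    by rw [← transpose_mul, Units.mul_inv, transpose_one]⟩

theorem coe_transposeGL (B : GeneralLinearGroup (Fin 3) ℂ) :
    (transposeGL B : Matrix (Fin 3) (Fin 3) ℂ) = (B : Matrix (Fin 3) (Fin 3) ℂ)ᵀ := rfl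

theorem mk_transposeGL_eq {B C : GeneralLinearGroup (Fin 3) ℂ}
    (h : ProjGenLinGroup.mk B = ProjGenLinGroup.mk C) :
    ProjGenLinGroup.mk (transposeGL B) = ProjGenLinGroup.mk (transposeGL C) := by
  obtain ⟨u, hu, e⟩ := exists_smul_of_mk_eq h
  exact mk_eq_of_smul hu (by rw [coe_transposeGL, e, transpose_smul, coe_transposeGL])

/-- The group `G` is stable under transposition. -/
theorem mk_transposeGL_mem {B : GeneralLinearGroup (Fin 3) ℂ}
    (hB : ProjGenLinGroup.mk B ∈ groupG hρ) : ProjGenLinGroup.mk (transposeGL B) ∈ groupG hρ := by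
  suffices ∀ g ∈ groupG hρ, ∃ C, ProjGenLinGroup.mk C = g ∧
      ProjGenLinGroup.mk (transposeGL C) ∈ groupG hρ by
    obtain ⟨C, hC, hC'⟩ := this _ hB
    rwa [mk_transposeGL_eq hC] at hC'
  intro g hg
  induction hg using Subgroup.closure_induction with
  | mem g hg =>
    obtain ⟨i, rfl⟩ := hg
    refine ⟨_, rfl, MemG.mk_mem ?_⟩
    rw [coe_transposeGL]
    change MemG hρ (hesseMatrix ρ i)ᵀ
    rw [hesseMatrix_transpose]
    exact memG_hesseMatrix hρ i
  | one =>
    refine ⟨1, map_one _, MemG.mk_mem ?_⟩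
    rw [coe_transposeGL, Units.val_one, transpose_one]
    exact memG_one hρ
  | mul g h _ _ hg hh =>
    obtain ⟨C, rfl, hC⟩ := hg
    obtain ⟨D, rfl, hD⟩ := hh
    refine ⟨C * D, map_mul _ _ _, ?_⟩
    rw [show transposeGL (C * D) = transposeGL D * transposeGL C from
      Units.ext (transpose_mul _ _), map_mul]
    exact mul_mem hD hC
  | inv g _ hg =>
    obtain ⟨C, rfl, hC⟩ := hg
    refine ⟨C⁻¹, map_inv _ _, ?_⟩
    rw [show transposeGL C⁻¹ = (transposeGL C)⁻¹ from Units.ext rfl, map_inv]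
    exact inv_mem hC

namespace HomogeneousIso

/-- For `k ≤ 1` and parameters that are not jump points, the matrix of a homogeneous isomorphism
belongs to `G` and its image in `H` relates the parameters. -/
theorem MatrixIs.mem_groupG_of_le_one {t s : E6Param} {k : ℕ} (hk : k ≤ 1)
    (hs : (s : ℂ) ∉ jumpPoints ρ)
    {φ : HomogeneousIso (e6Poly t) (e6Poly s) k} {B : GeneralLinearGroup (Fin 3) ℂ}
    (hB : φ.MatrixIs (B : Matrix (Fin 3) (Fin 3) ℂ)) :
    ∃ h : ProjGenLinGroup.mk B ∈ groupG hρ, paramHom hρ ⟨_, h⟩ • t = s := by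
  rw [mem_jumpPoints_iff hρ, mul_eq_zero, not_or] at hs
  have hG : ProjGenLinGroup.mk B ∈ groupG hρ := by
    -- The dual cubic at s, rescaled by -3/s, is the member of the pencil with parameter -18/s, and
    -- B takes it into the pencil. Hence `mk_mem_groupG` is applied to the transpose of B.
    obtain ⟨c, hc⟩ := dualCubic_comp t.2 s.2 hk fun p hp => hB.linearSubst_mem hp
    have h1 : ∀ p, hesseCubic 1 (-18 / s) ((transposeGL B : Matrix (Fin 3) (Fin 3) ℂ)ᵀ *ᵥ p) =
        hesseCubic (-3 / s * (c * (-t / 3))) (-3 / s * (c * 6)) p := by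
      intro p
      rw [coe_transposeGL, transpose_transpose, ← hesseCubic_mul, ← hesseCubic_mul, ← hc,
        hesseCubic_mul]
      congr 1
      · field_simp [hs.1]
      · ring
    -- The dual cubic is smooth because (-18/s)³ = -27 means s³ = 216, a jump point.
    have h2 := mk_mem_groupG hρ (t := -18 / s) (fun h3 => hs.2 ?_) h1
    · exact mk_transposeGL_mem hρ h2
    · rw [div_pow, div_eq_iff (pow_ne_zero 3 hs.1)] at h3
      linear_combination h3 / 27
  refine ⟨hG, ?_⟩
  -- Let s' = π(B)t. Undoing B leads from s' to t and φ leads from t to s, so the identity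
  -- substitution sends polynomials in the ideal at s' into the ideal at s. Applying the functional
  -- of s to the relation 3x³ + s'xyz gives s' - s = 0.
  obtain ⟨c, hc, e⟩ := carries_paramHom hρ ⟨_, hG⟩ B rfl t
  change (paramHom hρ ⟨_, hG⟩ : Equiv.Perm E6Param) t = s
  set s' : E6Param := (paramHom hρ ⟨_, hG⟩ : Equiv.Perm E6Param) t
  let q : MvPolynomial (Fin 3) ℂ := 3 * MvPolynomial.X 0 ^ 3 + MvPolynomial.C (s' : ℂ) *
    (MvPolynomial.X 0 * MvPolynomial.X 1 * MvPolynomial.X 2)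
  have hq : (q : FormalRing 3) = 3 * MvPowerSeries.X 0 ^ 3 + MvPowerSeries.C (s' : ℂ) *
      (MvPowerSeries.X 0 * MvPowerSeries.X 1 * MvPowerSeries.X 2) := by
    have h3 : ((3 : MvPolynomial (Fin 3) ℂ) : FormalRing 3) = 3 :=
      map_ofNat (MvPolynomial.coeToMvPowerSeries.ringHom (R := ℂ) (σ := Fin 3)) 3
    simp [q, h3]
  have h2 : (q : FormalRing 3) ∈ moduliIdeal (e6Poly s') k := by
    rw [hq]
    exact X_cube_add_mem _ hk 0
  have h3 := linearSubst_mem_moduliIdeal (hesseCubic_comp_inv hc e) k (Ideal.mem_map_of_mem _ h2)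
  have h3' : linearSubst ((B⁻¹ : GeneralLinearGroup (Fin 3) ℂ) : Matrix (Fin 3) (Fin 3) ℂ)
    (q : FormalRing 3) ∈ moduliIdeal (e6Poly t) k := h3
  rw [linearSubst_coe] at h3'
  have h4 := hB.linearSubst_mem h3'
  rw [← linearSubst_coe, linearSubst_linearSubst, Units.mul_inv, linearSubst_one, hq] at h4
  have h5 := cubicFunctional_eq_zero h4
  rw [← map_ofNat (MvPowerSeries.C (σ := Fin 3) (R := ℂ)), ← MvPowerSeries.smul_eq_C_mul,
    ← MvPowerSeries.smul_eq_C_mul, map_add, map_smul, map_smul, smul_eq_mul, smul_eq_mul,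
    cubicFunctional_xyz] at h5
  have h6 : cubicFunctional s (MvPowerSeries.X 0 ^ 3) = -(s / 3) := by
    simpa using cubicFunctional_monomial s 3 0 0
  rw [h6] at h5
  exact Subtype.ext (by linear_combination h5)

theorem MatrixIs.mem_groupG_of_two_le {t s : E6Param} {k : ℕ∞} (hk : 2 ≤ k)
    {φ : HomogeneousIso (e6Poly t) (e6Poly s) k} {B : GeneralLinearGroup (Fin 3) ℂ}
    (hB : φ.MatrixIs (B : Matrix (Fin 3) (Fin 3) ℂ)) :
    ∃ h : ProjGenLinGroup.mk B ∈ groupG hρ, paramHom hρ ⟨_, h⟩ • t = s := by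
  obtain ⟨c, hc⟩ := hB.hesseCubic_comp hk
  exact mk_mem_groupG_and_paramHom hρ hc

end HomogeneousIso

/-! ### The functors to the action groupoids -/

namespace E6Groupoid

open HomogeneousIso

variable {k : ℕ∞} {t s r : E6Groupoid k}

theorem exists_hasMatrix (m : t ⟶ s) : ∃ B, HasMatrix m B := by
  obtain ⟨φ, rfl⟩ := toClass_surjective m
  obtain ⟨B, hB⟩ := φ.exists_matrixIs_gl
  exact ⟨B, φ, rfl, hB⟩

theorem HasMatrix.mk_eq {m : t ⟶ s} {B C : GeneralLinearGroup (Fin 3) ℂ} (hB : HasMatrix m B)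
    (hC : HasMatrix m C) : ProjGenLinGroup.mk B = ProjGenLinGroup.mk C := by
  obtain ⟨φ, rfl, hB⟩ := hB
  obtain ⟨ψ, hψ, hC⟩ := hC
  obtain ⟨u, hu, h⟩ := MatrixIs.proportional hC hB hψ
  exact mk_eq_of_smul hu h

theorem HasMatrix.hom_eq {m m' : t ⟶ s} {B C : GeneralLinearGroup (Fin 3) ℂ} (hB : HasMatrix m B)
    (hC : HasMatrix m' C) (h : ProjGenLinGroup.mk C = ProjGenLinGroup.mk B) : m = m' := by
  obtain ⟨φ, rfl, hB⟩ := hB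
  obtain ⟨ψ, rfl, hC⟩ := hC
  obtain ⟨u, hu, h⟩ := exists_smul_of_mk_eq h
  exact MatrixIs.toClass_eq hB hC hu h

theorem HasMatrix.comp {m : t ⟶ s} {n : s ⟶ r} {B C : GeneralLinearGroup (Fin 3) ℂ}
    (hB : HasMatrix m B) (hC : HasMatrix n C) : HasMatrix (CategoryTheory.CategoryStruct.comp m n)
      (C * B) := by
  obtain ⟨φ, rfl, hB⟩ := hB
  obtain ⟨ψ, rfl, hC⟩ := hC
  exact ⟨φ.trans ψ, rfl, MatrixIs.trans hB hC⟩

theorem HasMatrix.id (t : E6Groupoid k) : HasMatrix (CategoryTheory.CategoryStruct.id t) 1 :=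
  ⟨HomogeneousIso.refl _ k, rfl, MatrixIs.refl _ k⟩

/-- The class of the matrix of a morphism. -/
def matrixClass (m : t ⟶ s) : ProjGenLinGroup (Fin 3) ℂ :=
  ProjGenLinGroup.mk (exists_hasMatrix m).choose

theorem HasMatrix.matrixClass_eq {m : t ⟶ s} {B : GeneralLinearGroup (Fin 3) ℂ}
    (hB : HasMatrix m B) : matrixClass m = ProjGenLinGroup.mk B :=
  (exists_hasMatrix m).choose_spec.mk_eq hB

/-- The later morphism stands on the left, as for the group elements of composites in the action
groupoid. -/
theorem matrixClass_comp (m : t ⟶ s) (n : s ⟶ r) :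
    matrixClass (CategoryTheory.CategoryStruct.comp m n) = matrixClass n * matrixClass m := by
  obtain ⟨B, hB⟩ := exists_hasMatrix m
  obtain ⟨C, hC⟩ := exists_hasMatrix n
  rw [(hB.comp hC).matrixClass_eq, hB.matrixClass_eq, hC.matrixClass_eq, map_mul]

theorem matrixClass_id (t : E6Groupoid k) :
    matrixClass (CategoryTheory.CategoryStruct.id t) = 1 := by
  rw [(HasMatrix.id t).matrixClass_eq, map_one]

theorem matrixClass_injective {m m' : t ⟶ s} (h : matrixClass m = matrixClass m') : m = m' := by
  obtain ⟨B, hB⟩ := exists_hasMatrix m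
  obtain ⟨C, hC⟩ := exists_hasMatrix m'
  rw [hB.matrixClass_eq, hC.matrixClass_eq] at h
  exact hB.hom_eq hC h.symm

/-- Fullness, for every k: a matrix carrying f_t to a multiple of f_s maps the moduli ideals onto
each other. -/
theorem exists_matrixClass_eq {g : ProjGenLinGroup (Fin 3) ℂ} (hg : g ∈ groupG hρ)
    (h : paramHom hρ ⟨g, hg⟩ • t.param = s.param) : ∃ m : t ⟶ s, matrixClass m = g := by
  obtain ⟨B, rfl⟩ := ProjGenLinGroup.mk_surjective g
  obtain ⟨c, hc, e⟩ := carries_paramHom hρ ⟨_, hg⟩ B rfl t.param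
  have e' : ∀ p, hesseCubic 1 t.param ((B : Matrix (Fin 3) (Fin 3) ℂ)ᵀ *ᵥ p) =
      c * hesseCubic 1 s.param p := fun p => by
    rw [e, ← h]
    rfl
  have hm : HasMatrix (t := t) (s := s) (homogeneousIsoOfLinear hc e' k).toClass B :=
    ⟨_, rfl, MatrixIs.homogeneousIsoOfLinear hc e' k⟩
  exact ⟨_, hm.matrixClass_eq⟩

theorem matrixClass_mem_of_two_le (hk : 2 ≤ k) (m : t ⟶ s) :
    ∃ h : matrixClass m ∈ groupG hρ, paramHom hρ ⟨_, h⟩ • t.param = s.param := by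
  obtain ⟨φ, -, hB⟩ := (exists_hasMatrix m).choose_spec
  exact MatrixIs.mem_groupG_of_two_le hρ hk hB

theorem matrixClass_mem_of_le_one {k : ℕ} {t s : E6Groupoid k} (hk : k ≤ 1)
    (hs : s.param ∈ nonJump hρ) (m : t ⟶ s) :
    ∃ h : matrixClass m ∈ groupG hρ, paramHom hρ ⟨_, h⟩ • t.param = s.param := by
  obtain ⟨φ, -, hB⟩ := (exists_hasMatrix m).choose_spec
  exact MatrixIs.mem_groupG_of_le_one hρ hk hs hB

end E6Groupoid

open CategoryTheory E6Groupoid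

/-- The functor to the action groupoid for `2 ≤ k`. -/
def toActionGroupoid {k : ℕ∞} (hk : 2 ≤ k) :
    Functor (E6Groupoid k) (ActionGroupoid (paramHom hρ) E6Param) where
  obj t := ActionCategory.objEquiv (groupG hρ) (ActionThrough (paramHom hρ) E6Param) t.param
  map m := ⟨⟨matrixClass m, (matrixClass_mem_of_two_le hρ hk m).1⟩,
    (matrixClass_mem_of_two_le hρ hk m).2⟩
  map_id t := Subtype.ext (Subtype.ext (matrixClass_id t))
  map_comp m n := Subtype.ext (Subtype.ext (matrixClass_comp m n))

theorem exists_functor_of_two_le {k : ℕ∞} (hk : 2 ≤ k) :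
    ∃ F : Functor (E6Groupoid k) (ActionGroupoid (paramHom hρ) E6Param),
      (∀ t : E6Groupoid k, (F.obj t).point = t.param) ∧
      (∀ (t s : E6Groupoid k) (m : t ⟶ s), ∃ B : GeneralLinearGroup (Fin 3) ℂ,
        HasMatrix m B ∧ ((ActionGroupoid.element (π := paramHom hρ) (F.map m) : groupG hρ) :
          ProjGenLinGroup (Fin 3) ℂ) = ProjGenLinGroup.mk B) ∧
      F.Full ∧ F.Faithful := by
  refine ⟨toActionGroupoid hρ hk, fun t => rfl, fun t s m => ?_, ⟨fun {t s} g => ?_⟩,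
    ⟨fun {t s} m m' h => ?_⟩⟩
  · obtain ⟨B, hB⟩ := exists_hasMatrix m
    exact ⟨B, hB, hB.matrixClass_eq⟩
  · obtain ⟨⟨g, hg⟩, h⟩ := g
    obtain ⟨m, hm⟩ := exists_matrixClass_eq hρ (t := t) (s := s) hg h
    exact ⟨m, Subtype.ext (Subtype.ext hm)⟩
  · exact matrixClass_injective (congrArg Subtype.val (congrArg Subtype.val h))

/-- The functor to the action groupoid for `k ≤ 1`. -/
def toActionGroupoidNonJump {k : ℕ} (hk : k ≤ 1) :
    Functor (E6NonJumpGroupoid hρ k) (ActionGroupoid (paramHom hρ) (nonJump hρ)) where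
  obj t := ActionCategory.objEquiv (groupG hρ) (ActionThrough (paramHom hρ) (nonJump hρ))
    ⟨t.obj.param, t.property⟩
  map {_ s} m := ⟨⟨matrixClass m.hom, (matrixClass_mem_of_le_one hρ hk s.property m.hom).1⟩,
    Subtype.ext (matrixClass_mem_of_le_one hρ hk s.property m.hom).2⟩
  map_id t := Subtype.ext (Subtype.ext (matrixClass_id t.obj))
  map_comp m n := Subtype.ext (Subtype.ext (matrixClass_comp m.hom n.hom))

theorem exists_functor_of_le_one {k : ℕ} (hk : k ≤ 1) :
    ∃ F : Functor (E6NonJumpGroupoid hρ k) (ActionGroupoid (paramHom hρ) (nonJump hρ)),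
      (∀ t : E6NonJumpGroupoid hρ k, ((F.obj t).point : E6Param) = t.obj.param) ∧
      (∀ (t s : E6NonJumpGroupoid hρ k) (m : t ⟶ s), ∃ B : GeneralLinearGroup (Fin 3) ℂ,
        HasMatrix m.hom B ∧ ((ActionGroupoid.element (π := paramHom hρ) (F.map m) : groupG hρ) :
          ProjGenLinGroup (Fin 3) ℂ) = ProjGenLinGroup.mk B) ∧
      F.Full ∧ F.Faithful := by
  refine ⟨toActionGroupoidNonJump hρ hk, fun t => rfl, fun t s m => ?_, ⟨fun {t s} g => ?_⟩,
    ⟨fun {t s} m m' h => ?_⟩⟩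
  · obtain ⟨B, hB⟩ := exists_hasMatrix m.hom
    exact ⟨B, hB, hB.matrixClass_eq⟩
  · obtain ⟨⟨g, hg⟩, h⟩ := g
    obtain ⟨m, hm⟩ := exists_matrixClass_eq hρ (t := t.obj) (s := s.obj) hg
      (congrArg Subtype.val h)
    exact ⟨⟨m⟩, Subtype.ext (Subtype.ext hm)⟩
  · exact ObjectProperty.hom_ext _
      (matrixClass_injective (congrArg Subtype.val (congrArg Subtype.val h)))

end

noncomputable section

open Matrix

/-! ### The monomial basis of the first moduli algebra -/

theorem moduliIdeal_one (f : FormalRing 3) : moduliIdeal f 1 = moduliIdeal f ((1 : ℕ) : ℕ∞) := by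
  rw [Nat.cast_one]

theorem mul_mem_of_constantCoeff {I : Ideal (FormalRing 3)} {a h : FormalRing 3}
    (hh : MvPowerSeries.constantCoeff h = 0) (ha : ∀ i, MvPowerSeries.X i * a ∈ I) :
    h * a ∈ I := by
  obtain ⟨q, rfl⟩ := exists_sum_X_mul hh
  rw [Finset.sum_mul]
  refine Ideal.sum_mem _ fun i _ => ?_
  rw [mul_right_comm]
  exact Ideal.mul_mem_right _ _ (ha i)

theorem X_sq_mul_X_mem_one {t : ℂ} (ht : t ^ 3 ≠ -27) {i j : Fin 3} (hij : i ≠ j) :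
    MvPowerSeries.X i ^ 2 * MvPowerSeries.X j ∈ moduliIdeal (e6Poly t) 1 := by
  rw [moduliIdeal_one]
  exact X_sq_mul_X_mem ht le_rfl hij

theorem X_cube_add_mem_one (t : ℂ) (i : Fin 3) :
    3 * MvPowerSeries.X i ^ 3 + MvPowerSeries.C t * (MvPowerSeries.X 0 * MvPowerSeries.X 1 *
      MvPowerSeries.X 2) ∈ moduliIdeal (e6Poly t) 1 := by
  rw [moduliIdeal_one]
  exact X_cube_add_mem t le_rfl i

theorem X_cube_add_mem_one' (t : ℂ) (i : Fin 3) :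
    MvPowerSeries.X i ^ 3 + MvPowerSeries.C (t / 3) * (MvPowerSeries.X 0 * MvPowerSeries.X 1 *
      MvPowerSeries.X 2) ∈ moduliIdeal (e6Poly t) 1 := by
  have h := Ideal.mul_mem_left _ (MvPowerSeries.C 3⁻¹) (X_cube_add_mem_one t i)
  have h3 : (MvPowerSeries.C 3⁻¹ * 3 : FormalRing 3) = 1 := by
    rw [← map_ofNat (MvPowerSeries.C (σ := Fin 3) (R := ℂ)), ← map_mul]
    norm_num
  have h4 : (MvPowerSeries.C (t / 3) : FormalRing 3) = MvPowerSeries.C 3⁻¹ * MvPowerSeries.C t := by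
    rw [← map_mul]
    congr 1
    ring
  convert h using 1
  rw [h4]
  linear_combination -(MvPowerSeries.X i ^ 3) * h3

theorem X_mul_xyz_mem {t : ℂ} (ht : t ^ 3 ≠ -27) (i : Fin 3) :
    MvPowerSeries.X i * (MvPowerSeries.X 0 * MvPowerSeries.X 1 * MvPowerSeries.X 2) ∈
      moduliIdeal (e6Poly t) 1 := by
  fin_cases i
  · convert Ideal.mul_mem_left _ (MvPowerSeries.X 2)
      (X_sq_mul_X_mem_one ht (show (0 : Fin 3) ≠ 1 by decide)) using 1
    change MvPowerSeries.X 0 * _ = _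
    ring
  · convert Ideal.mul_mem_left _ (MvPowerSeries.X 0)
      (X_sq_mul_X_mem_one ht (show (1 : Fin 3) ≠ 2 by decide)) using 1
    change MvPowerSeries.X 1 * _ = _
    ring
  · convert Ideal.mul_mem_left _ (MvPowerSeries.X 0)
      (X_sq_mul_X_mem_one ht (show (2 : Fin 3) ≠ 1 by decide)) using 1
    change MvPowerSeries.X 2 * _ = _
    ring

/-- In degree three A¹ is spanned by xyz: cubes become -(t/3)xyz and monomials with exactly two
equal factors vanish. -/
theorem X_cube_trichotomy {t : ℂ} (ht : t ^ 3 ≠ -27) (i j k : Fin 3) :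
    ∃ c : ℂ, MvPowerSeries.X i * MvPowerSeries.X j * MvPowerSeries.X k - MvPowerSeries.C c *
      (MvPowerSeries.X 0 * MvPowerSeries.X 1 * MvPowerSeries.X 2) ∈ moduliIdeal (e6Poly t) 1 := by
  by_cases hij : i = j
  · subst hij
    by_cases hik : i = k
    · subst hik
      refine ⟨-(t / 3), ?_⟩
      convert X_cube_add_mem_one' t i using 1
      rw [map_neg]
      ring
    · refine ⟨0, ?_⟩
      convert X_sq_mul_X_mem_one ht hik using 1
      rw [map_zero]
      ring
  · by_cases hik : i = k
    · subst hik
      refine ⟨0, ?_⟩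
      convert X_sq_mul_X_mem_one ht hij using 1
      rw [map_zero]
      ring
    · by_cases hjk : j = k
      · subst hjk
        refine ⟨0, ?_⟩
        convert X_sq_mul_X_mem_one ht (Ne.symm hij) using 1
        rw [map_zero]
        ring
      · refine ⟨1, ?_⟩
        convert zero_mem (moduliIdeal (e6Poly t) 1) using 1
        rw [map_one, sub_eq_zero, one_mul]
        fin_cases i <;> fin_cases j <;> fin_cases k <;> first
          | exact absurd rfl hij
          | exact absurd rfl hik
          | exact absurd rfl hjk
          | rfl
          | (simp only [Fin.zero_eta, Fin.mk_one, Fin.reduceFinMk]; ring)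

theorem X_fourfold_mem {t : ℂ} (ht : t ^ 3 ≠ -27) (i j k l : Fin 3) :
    MvPowerSeries.X i * (MvPowerSeries.X j * MvPowerSeries.X k * MvPowerSeries.X l) ∈
      moduliIdeal (e6Poly t) 1 := by
  obtain ⟨c, hc⟩ := X_cube_trichotomy ht j k l
  convert add_mem (Ideal.mul_mem_left _ (MvPowerSeries.X i) hc)
    (Ideal.mul_mem_left _ (MvPowerSeries.C c) (X_mul_xyz_mem ht i)) using 1
  ring

/-- The fourth power of the maximal ideal dies in A¹, since by multilinearity it is enough to check
variables. All truncations below rest on this. -/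
theorem mul_fourfold_mem {t : ℂ} (ht : t ^ 3 ≠ -27) {a b c d : FormalRing 3}
    (ha : MvPowerSeries.constantCoeff a = 0) (hb : MvPowerSeries.constantCoeff b = 0)
    (hc : MvPowerSeries.constantCoeff c = 0) (hd : MvPowerSeries.constantCoeff d = 0) :
    a * (b * (c * d)) ∈ moduliIdeal (e6Poly t) 1 := by
  refine mul_mem_of_constantCoeff ha fun i => ?_
  rw [mul_left_comm]
  refine mul_mem_of_constantCoeff hb fun j => ?_
  rw [mul_left_comm (MvPowerSeries.X i), mul_left_comm (MvPowerSeries.X j)]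
  refine mul_mem_of_constantCoeff hc fun k => ?_
  rw [show (MvPowerSeries.X k * (MvPowerSeries.X j * (MvPowerSeries.X i * d)) : FormalRing 3) =
    d * (MvPowerSeries.X i * MvPowerSeries.X j * MvPowerSeries.X k) by ring]
  exact mul_mem_of_constantCoeff hd fun l => X_fourfold_mem ht l i j k

/-- The positions of the variables among the monomials. -/
def linIdx (l : Fin 3) : Fin 11 := ⟨l + 1, by omega⟩

/-- The positions of the quadratic monomials among the monomials. -/
def quadIdx (m : Fin 6) : Fin 11 := ⟨m + 4, by omega⟩

/-- The first factors of the quadratic monomials. -/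
def fstVar : Fin 6 → Fin 3 := ![0, 1, 2, 0, 0, 1]

/-- The second factors of the quadratic monomials. -/
def sndVar : Fin 6 → Fin 3 := ![0, 1, 2, 1, 2, 2]

theorem e6Monomial_linIdx (l : Fin 3) : e6Monomial (linIdx l) = MvPowerSeries.X l := by
  fin_cases l <;> rfl

theorem e6Monomial_quadIdx (m : Fin 6) : e6Monomial (quadIdx m) =
    MvPowerSeries.X (fstVar m) * MvPowerSeries.X (sndVar m) := by
  fin_cases m <;> first | rfl | exact pow_two _

theorem e6Monomial_zero : e6Monomial 0 = 1 := rfl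

theorem e6Monomial_ten : e6Monomial 10 =
    MvPowerSeries.X 0 * MvPowerSeries.X 1 * MvPowerSeries.X 2 := rfl

theorem exists_quadIdx (i j : Fin 3) : ∃ m : Fin 6,
    (MvPowerSeries.X i * MvPowerSeries.X j : FormalRing 3) = e6Monomial (quadIdx m) := by
  have h : ∃ m, (fstVar m = i ∧ sndVar m = j) ∨ (fstVar m = j ∧ sndVar m = i) := by
    revert i j
    decide
  obtain ⟨m, ⟨rfl, rfl⟩ | ⟨rfl, rfl⟩⟩ := h
  · exact ⟨m, (e6Monomial_quadIdx m).symm⟩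
  · exact ⟨m, by rw [e6Monomial_quadIdx, mul_comm]⟩

/-- The coordinate functionals for the monomial basis. -/
def monomialFunctional (t : ℂ) : Fin 11 → FormalRing 3 →ₗ[ℂ] ℂ :=
  ![MvPowerSeries.coeff (triExp 0 0 0), MvPowerSeries.coeff (triExp 1 0 0),
    MvPowerSeries.coeff (triExp 0 1 0), MvPowerSeries.coeff (triExp 0 0 1),
    MvPowerSeries.coeff (triExp 2 0 0), MvPowerSeries.coeff (triExp 0 2 0),
    MvPowerSeries.coeff (triExp 0 0 2), MvPowerSeries.coeff (triExp 1 1 0),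
    MvPowerSeries.coeff (triExp 1 0 1), MvPowerSeries.coeff (triExp 0 1 1),
    cubicFunctional t]

theorem triExp_degree (a b c : ℕ) : (triExp a b c).degree = a + b + c := by
  simp [triExp]

theorem moduliIdeal_one_le (t : ℂ) : moduliIdeal (e6Poly t) 1 ≤ orderIdeal 3 := by
  rw [moduliIdeal_one, moduliIdeal_coe]
  refine sup_le ?_ ?_
  · rw [Ideal.span_singleton_le_iff_mem]
    exact e6Poly_mem_orderIdeal t
  · refine (Ideal.mul_mono (maximalIdeal_pow_le 1) (jacobiIdeal_e6Poly_le t)).trans ?_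
    exact orderIdeal_mul_le 1 2

/-- The ideal starts in degree three, so the lower coefficients vanish on it; the last functional
annihilates the whole Jacobi ideal. This yields independence of the monomials. -/
theorem monomialFunctional_eq_zero {t : ℂ} {h : FormalRing 3}
    (hh : h ∈ moduliIdeal (e6Poly t) 1) (i : Fin 11) : monomialFunctional t i h = 0 := by
  have h1 := mem_orderIdeal.1 (moduliIdeal_one_le t hh)
  have h2 : cubicFunctional t h = 0 := by
    rw [moduliIdeal_one] at hh
    exact cubicFunctional_eq_zero hh
  fin_cases i
  all_goals first
    | exact h2
    | exact h1 _ (by rw [triExp_degree]; norm_num)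

theorem e6Monomial_eq (j : Fin 11) : ∃ a b c : ℕ, e6Monomial j =
    MvPowerSeries.X 0 ^ a * MvPowerSeries.X 1 ^ b * MvPowerSeries.X 2 ^ c ∧
    (a, b, c) = (![(0, 0, 0), (1, 0, 0), (0, 1, 0), (0, 0, 1), (2, 0, 0), (0, 2, 0), (0, 0, 2),
      (1, 1, 0), (1, 0, 1), (0, 1, 1), (1, 1, 1)] : Fin 11 → ℕ × ℕ × ℕ) j := by
  fin_cases j
  exacts [⟨0, 0, 0, by simp [e6Monomial], rfl⟩, ⟨1, 0, 0, by simp [e6Monomial], rfl⟩,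
    ⟨0, 1, 0, by simp [e6Monomial], rfl⟩, ⟨0, 0, 1, by simp [e6Monomial], rfl⟩,
    ⟨2, 0, 0, by simp [e6Monomial], rfl⟩, ⟨0, 2, 0, by simp [e6Monomial], rfl⟩,
    ⟨0, 0, 2, by simp [e6Monomial], rfl⟩, ⟨1, 1, 0, by simp [e6Monomial], rfl⟩,
    ⟨1, 0, 1, by simp [e6Monomial], rfl⟩, ⟨0, 1, 1, by simp [e6Monomial], rfl⟩,
    ⟨1, 1, 1, by simp [e6Monomial], rfl⟩]

theorem monomialFunctional_e6Monomial (t : ℂ) (i j : Fin 11) :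
    monomialFunctional t i (e6Monomial j) = if i = j then 1 else 0 := by
  obtain ⟨a, b, c, h, h'⟩ := e6Monomial_eq j
  rw [h]
  fin_cases i
  pick_goal 11
  · refine (cubicFunctional_monomial t a b c).trans ?_
    fin_cases j <;> simp at h' <;> obtain ⟨rfl, rfl, rfl⟩ := h' <;> simp
  all_goals
    refine (coeff_triExp _ _ _ a b c).trans ?_
    fin_cases j <;> simp at h' <;> obtain ⟨rfl, rfl, rfl⟩ := h' <;> simp

theorem exists_sub_e6Monomial_mem {t : ℂ} (ht : t ^ 3 ≠ -27) (h : FormalRing 3) :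
    ∃ c : Fin 11 → ℂ, h - ∑ i, c i • e6Monomial i ∈ moduliIdeal (e6Poly t) 1 := by
  let S : Submodule ℂ (FormalRing 3) := (moduliIdeal (e6Poly t) 1).restrictScalars ℂ ⊔
    Submodule.span ℂ (Set.range e6Monomial)
  have hI : ∀ {g}, g ∈ moduliIdeal (e6Poly t) 1 → g ∈ S := fun hg =>
    (le_sup_left : (moduliIdeal (e6Poly t) 1).restrictScalars ℂ ≤ S) hg
  have hmon : ∀ i (c : ℂ), MvPowerSeries.C c * e6Monomial i ∈ S := fun i c => by
    rw [← MvPowerSeries.smul_eq_C_mul]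
    exact S.smul_mem _ ((le_sup_right : _ ≤ S) (Submodule.subset_span ⟨i, rfl⟩))
  -- Splitting g into its constant term and a combination of the variables raises the degree of the
  -- fixed factor a by one. Four applications, starting from a = 1, reach degree four, which lies in
  -- the ideal.
  have step : ∀ a : FormalRing 3, (∀ c : ℂ, MvPowerSeries.C c * a ∈ S) →
      (∀ i g, g * (MvPowerSeries.X i * a) ∈ S) → ∀ g, g * a ∈ S := by
    intro a ha ha' g
    obtain ⟨q, hq⟩ := exists_sum_X_mul (h := g - MvPowerSeries.C (MvPowerSeries.constantCoeff g))
      (by simp)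
    have hg : g * a = MvPowerSeries.C (MvPowerSeries.constantCoeff g) * a +
        ∑ i, q i * (MvPowerSeries.X i * a) := by
      have h1 : ∑ i, q i * (MvPowerSeries.X i * a) = (∑ i, MvPowerSeries.X i * q i) * a := by
        rw [Finset.sum_mul]
        exact Finset.sum_congr rfl fun i _ => by ring
      rw [h1, ← hq]
      ring
    rw [hg]
    exact S.add_mem (ha _) (S.sum_mem fun i _ => ha' i _)
  have hall : ∀ g, g * 1 ∈ S := by
    refine step 1 (fun c => by rw [← e6Monomial_zero]; exact hmon _ _) fun l => ?_
    refine step _ (fun c => by rw [mul_one, ← e6Monomial_linIdx]; exact hmon _ _) fun k => ?_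
    refine step _ (fun c => ?_) fun j => ?_
    · obtain ⟨m, hm⟩ := exists_quadIdx k l
      rw [mul_one, hm]
      exact hmon _ _
    refine step _ (fun c => ?_) fun i g => hI ?_
    · obtain ⟨d, hd⟩ := X_cube_trichotomy ht j k l
      have h1 := S.add_mem (hI (Ideal.mul_mem_left _ (MvPowerSeries.C c) hd)) (hmon 10 (c * d))
      rw [e6Monomial_ten] at h1
      convert h1 using 1
      rw [map_mul]
      ring
    · rw [mul_one, ← mul_assoc (MvPowerSeries.X j)]
      exact Ideal.mul_mem_left _ _ (X_fourfold_mem ht i j k l)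
  have hh : h ∈ S := by simpa using hall h
  obtain ⟨y, hy, z, hz, rfl⟩ := Submodule.mem_sup.1 hh
  obtain ⟨c, rfl⟩ := (Submodule.mem_span_range_iff_exists_fun ℂ).1 hz
  exact ⟨c, by rw [add_sub_cancel_right]; exact hy⟩

theorem toModuli_eq_zero {n : ℕ} {f : FormalRing n} {k : ℕ∞} {h : FormalRing n} :
    toModuli f k h = 0 ↔ h ∈ moduliIdeal f k :=
  Ideal.Quotient.eq_zero_iff_mem

theorem toModuli_surjective {n : ℕ} (f : FormalRing n) (k : ℕ∞) :
    Function.Surjective (toModuli f k) :=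
  Ideal.Quotient.mkₐ_surjective ℂ _

/-- The monomial basis of the first moduli algebra. -/
def monomialBasis {t : ℂ} (ht : t ^ 3 ≠ -27) :
    Module.Basis (Fin 11) ℂ (ModuliAlgebra (e6Poly t) 1) :=
  Module.Basis.mk (v := fun i => toModuli (e6Poly t) 1 (e6Monomial i))
    (by
      rw [Fintype.linearIndependent_iff]
      intro c hc i
      have h1 : ∑ i, c i • e6Monomial i ∈ moduliIdeal (e6Poly t) 1 := by
        rw [← toModuli_eq_zero, map_sum]
        simpa only [map_smul] using hc
      have h2 := monomialFunctional_eq_zero h1 i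
      rw [map_sum] at h2
      simpa [monomialFunctional_e6Monomial] using h2)
    (by
      rintro a -
      obtain ⟨h, rfl⟩ := toModuli_surjective (e6Poly t) 1 a
      obtain ⟨c, hc⟩ := exists_sub_e6Monomial_mem ht h
      rw [← toModuli_eq_zero, map_sub, sub_eq_zero] at hc
      rw [hc, map_sum]
      refine Submodule.sum_mem _ fun i _ => ?_
      rw [map_smul]
      exact Submodule.smul_mem _ _ (Submodule.subset_span ⟨i, rfl⟩))

theorem monomialBasis_apply {t : ℂ} (ht : t ^ 3 ≠ -27) (i : Fin 11) :
    monomialBasis ht i = toModuli (e6Poly t) 1 (e6Monomial i) :=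
  Module.Basis.mk_apply _ _ i

end

noncomputable section

open Matrix

/-! ### The derivations of the first moduli algebra -/

theorem monomialBasis_repr_toModuli {t : ℂ} (ht : t ^ 3 ≠ -27) (h : FormalRing 3) :
    toModuli (e6Poly t) 1 h = ∑ i, monomialFunctional t i h • monomialBasis ht i := by
  obtain ⟨c, hc⟩ := exists_sub_e6Monomial_mem ht h
  have h1 : ∀ i, monomialFunctional t i h = c i := by
    intro i
    have h2 := monomialFunctional_eq_zero hc i
    rw [map_sub, map_sum, sub_eq_zero] at h2
    rw [h2]
    simp [monomialFunctional_e6Monomial]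
  rw [← toModuli_eq_zero, map_sub, sub_eq_zero] at hc
  rw [hc, map_sum]
  exact Finset.sum_congr rfl fun i _ => by rw [map_smul, h1, monomialBasis_apply]

/-- The class of a variable in the first moduli algebra. -/
def varClass (t : ℂ) (l : Fin 3) : ModuliAlgebra (e6Poly t) 1 :=
  toModuli (e6Poly t) 1 (MvPowerSeries.X l)

/-- The class of a quadratic monomial in the first moduli algebra. -/
def quadClass (t : ℂ) (m : Fin 6) : ModuliAlgebra (e6Poly t) 1 :=
  varClass t (fstVar m) * varClass t (sndVar m)

/-- The class of `xyz`, which spans the socle of the first moduli algebra. -/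
def socleClass (t : ℂ) : ModuliAlgebra (e6Poly t) 1 :=
  varClass t 0 * varClass t 1 * varClass t 2

theorem monomialBasis_linIdx {t : ℂ} (ht : t ^ 3 ≠ -27) (l : Fin 3) :
    monomialBasis ht (linIdx l) = varClass t l := by
  rw [monomialBasis_apply, e6Monomial_linIdx, varClass]

theorem monomialBasis_quadIdx {t : ℂ} (ht : t ^ 3 ≠ -27) (m : Fin 6) :
    monomialBasis ht (quadIdx m) = quadClass t m := by
  rw [monomialBasis_apply, e6Monomial_quadIdx, map_mul, quadClass, varClass, varClass]

theorem monomialBasis_zero {t : ℂ} (ht : t ^ 3 ≠ -27) : monomialBasis ht 0 = 1 := by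
  rw [monomialBasis_apply, e6Monomial_zero, map_one]

theorem monomialBasis_ten {t : ℂ} (ht : t ^ 3 ≠ -27) : monomialBasis ht 10 = socleClass t := by
  rw [monomialBasis_apply, e6Monomial_ten, map_mul, map_mul, socleClass, varClass, varClass,
    varClass]

theorem fin_eleven_cases (i : Fin 11) :
    i = 0 ∨ (∃ l, i = linIdx l) ∨ (∃ m, i = quadIdx m) ∨ i = 10 := by
  revert i
  decide

theorem sum_fin_eleven {M : Type*} [AddCommMonoid M] (F : Fin 11 → M) :
    ∑ i, F i = F 0 + ∑ l, F (linIdx l) + ∑ m, F (quadIdx m) + F 10 := by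
  have h : ∑ i, F i = F 0 + F 1 + F 2 + F 3 + F 4 + F 5 + F 6 + F 7 + F 8 + F 9 + F 10 := by
    simp only [Fin.sum_univ_castSucc, Fin.sum_univ_zero, zero_add]
    rfl
  rw [h, Fin.sum_univ_three, Fin.sum_univ_six]
  change _ = F 0 + (F 1 + F 2 + F 3) + (F 4 + F 5 + F 6 + F 7 + F 8 + F 9) + F 10
  abel

/-- The products of the variables and the quadratic monomials, as multiples of `xyz`. -/
def socleCoeff (t : ℂ) : Fin 3 → Fin 6 → ℂ :=
  ![![-(t / 3), 0, 0, 0, 0, 1], ![0, -(t / 3), 0, 0, 1, 0], ![0, 0, -(t / 3), 1, 0, 0]]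

theorem cubicFunctional_X_mul (t : ℂ) (j : Fin 3) (m : Fin 6) :
    cubicFunctional t (MvPowerSeries.X j * MvPowerSeries.X (fstVar m) *
      MvPowerSeries.X (sndVar m)) = socleCoeff t j m := by
  have hX : ∀ i : Fin 3, (MvPowerSeries.X i : FormalRing 3) = MvPowerSeries.X 0 ^ (if i = 0 then 1
      else 0) * MvPowerSeries.X 1 ^ (if i = 1 then 1 else 0) *
      MvPowerSeries.X 2 ^ (if i = 2 then 1 else 0) := by
    intro i
    fin_cases i <;> simp
  have h : ∀ i j k : Fin 3, cubicFunctional t (MvPowerSeries.X i * MvPowerSeries.X j *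
      MvPowerSeries.X k) = cubicFunctional t (
        MvPowerSeries.X 0 ^ ((if i = 0 then 1 else 0) + (if j = 0 then 1 else 0) +
          (if k = 0 then 1 else 0)) *
        MvPowerSeries.X 1 ^ ((if i = 1 then 1 else 0) + (if j = 1 then 1 else 0) +
          (if k = 1 then 1 else 0)) *
        MvPowerSeries.X 2 ^ ((if i = 2 then 1 else 0) + (if j = 2 then 1 else 0) +
          (if k = 2 then 1 else 0))) := fun i j k => by
    rw [hX i, hX j, hX k]
    congr 1
    simp only [pow_add]
    ring
  simp only [cubicFunctional_monomial] at h
  rw [h]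
  fin_cases j <;> fin_cases m <;> simp [socleCoeff, fstVar, sndVar]

theorem toModuli_X_cube {t : ℂ} (ht : t ^ 3 ≠ -27) (i j k : Fin 3) :
    varClass t i * varClass t j * varClass t k = cubicFunctional t (MvPowerSeries.X i *
      MvPowerSeries.X j * MvPowerSeries.X k) • socleClass t := by
  obtain ⟨c, hc⟩ := X_cube_trichotomy ht i j k
  have h1 : cubicFunctional t (MvPowerSeries.X i * MvPowerSeries.X j * MvPowerSeries.X k) = c := by
    have h2 := monomialFunctional_eq_zero hc 10
    change cubicFunctional t _ = 0 at h2
    rw [map_sub, ← MvPowerSeries.smul_eq_C_mul, map_smul, cubicFunctional_xyz, sub_eq_zero] at h2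
    simpa using h2
  rw [← toModuli_eq_zero, map_sub, sub_eq_zero, ← MvPowerSeries.smul_eq_C_mul, map_smul] at hc
  simp only [map_mul] at hc
  rw [h1]
  exact hc

theorem varClass_mul_quadClass {t : ℂ} (ht : t ^ 3 ≠ -27) (j : Fin 3) (m : Fin 6) :
    varClass t j * quadClass t m = socleCoeff t j m • socleClass t := by
  rw [quadClass, ← mul_assoc, toModuli_X_cube ht, cubicFunctional_X_mul]

theorem varClass_mul_socleClass {t : ℂ} (ht : t ^ 3 ≠ -27) (j : Fin 3) :
    varClass t j * socleClass t = 0 := by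
  have h := X_mul_xyz_mem ht j
  rw [← toModuli_eq_zero, map_mul, map_mul, map_mul] at h
  exact h

/-- Coordinates of the derivations: the multiple of the Euler derivation, the quadratic parts and
the cubic parts of the images of the variables. -/
abbrev DerCoord : Type := ℂ × (Fin 3 → Fin 6 → ℂ) × (Fin 3 → ℂ)

/-- The images of the variables under the derivation with given coordinates. -/
def derValue (t : ℂ) : DerCoord →ₗ[ℂ] (Fin 3 → ModuliAlgebra (e6Poly t) 1) where
  toFun a l := a.1 • varClass t l + ∑ m, a.2.1 l m • quadClass t m + a.2.2 l • socleClass t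
  map_add' a b := by
    funext l
    simp only [Prod.fst_add, Prod.snd_add, Pi.add_apply, add_smul, Finset.sum_add_distrib]
    abel
  map_smul' c a := by
    funext l
    simp only [Prod.smul_fst, Prod.smul_snd, Pi.smul_apply, smul_add, Finset.smul_sum, smul_smul,
      smul_eq_mul, RingHom.id_apply]

theorem derValue_apply (t : ℂ) (a : DerCoord) (l : Fin 3) : derValue t a l =
    a.1 • varClass t l + ∑ m, a.2.1 l m • quadClass t m + a.2.2 l • socleClass t := rfl

theorem derValue_injective {t : ℂ} (ht : t ^ 3 ≠ -27) : Function.Injective (derValue t) := by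
  rw [injective_iff_map_eq_zero]
  rintro ⟨lam, d, c⟩ ha
  have key : ∀ l i, (monomialBasis ht).repr (derValue t ⟨lam, d, c⟩ l) i = 0 := by
    intro l i
    rw [ha]
    simp
  simp only [derValue_apply, ← monomialBasis_linIdx ht, ← monomialBasis_quadIdx ht,
    ← monomialBasis_ten ht, map_add, map_sum, map_smul, Module.Basis.repr_self, Finsupp.add_apply,
    Finsupp.coe_finsetSum, Finset.sum_apply, Finsupp.smul_apply, Finsupp.single_apply] at key
  refine Prod.ext ?_ (Prod.ext ?_ ?_)
  · simpa [linIdx, quadIdx, Fin.ext_iff, Fin.sum_univ_six] using key 0 (linIdx 0)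
  · funext l m
    have h1 : linIdx l ≠ quadIdx m := (by decide : ∀ l m, linIdx l ≠ quadIdx m) l m
    have h2 : (10 : Fin 11) ≠ quadIdx m := (by decide : ∀ m, (10 : Fin 11) ≠ quadIdx m) m
    have h3 : ∀ n, quadIdx n = quadIdx m ↔ n = m := fun n =>
      (by decide : ∀ n m, quadIdx n = quadIdx m ↔ n = m) n m
    simpa [h1, h2, h3] using key l (quadIdx m)
  · funext l
    have h1 : linIdx l ≠ 10 := (by decide : ∀ l, linIdx l ≠ 10) l
    have h2 : ∀ m, quadIdx m ≠ 10 := by decide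
    simpa [h1, h2] using key l 10

theorem varClass_mul_derValue {t : ℂ} (ht : t ^ 3 ≠ -27) (a : DerCoord) (j l : Fin 3) :
    varClass t j * derValue t a l = a.1 • (varClass t j * varClass t l) +
      (∑ m, a.2.1 l m * socleCoeff t j m) • socleClass t := by
  rw [derValue_apply, mul_add, mul_add, mul_smul_comm, mul_smul_comm, varClass_mul_socleClass ht,
    smul_zero, add_zero, Finset.mul_sum, Finset.sum_smul]
  congr 1
  refine Finset.sum_congr rfl fun m _ => ?_
  rw [mul_smul_comm, varClass_mul_quadClass ht, smul_smul]

/-- The cubic part of the image of a quadratic monomial. -/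
def quadShift (t : ℂ) (d : Fin 3 → Fin 6 → ℂ) (m : Fin 6) : ℂ :=
  (∑ n, d (sndVar m) n * socleCoeff t (fstVar m) n) +
    ∑ n, d (fstVar m) n * socleCoeff t (sndVar m) n

/-- The Euler part acts by the degree, the quadratic parts push a quadratic monomial into the socle,
and the cubic parts vanish for degree reasons. -/
theorem derivation_quadClass {t : ℂ} (ht : t ^ 3 ≠ -27) {a : DerCoord} {D : YauAlgebra (e6Poly t) 1}
    (hD : ∀ l, D (varClass t l) = derValue t a l) (m : Fin 6) :
    D (quadClass t m) = (2 * a.1) • quadClass t m + quadShift t a.2.1 m • socleClass t := by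
  rw [quadClass, Derivation.leibniz, smul_eq_mul, smul_eq_mul, hD, hD, varClass_mul_derValue ht,
    varClass_mul_derValue ht, quadShift, mul_comm (varClass t (sndVar m))]
  module

theorem varClass_mul_varClass_mul_derValue {t : ℂ} (ht : t ^ 3 ≠ -27) (a : DerCoord) (i j l : Fin 3) :
    varClass t i * varClass t j * derValue t a l =
      a.1 • (varClass t i * varClass t j * varClass t l) := by
  rw [mul_assoc, varClass_mul_derValue ht, mul_add, mul_smul_comm, mul_smul_comm,
    varClass_mul_socleClass ht, smul_zero, add_zero, mul_assoc]

theorem derivation_socleClass {t : ℂ} (ht : t ^ 3 ≠ -27) {a : DerCoord}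
    {D : YauAlgebra (e6Poly t) 1} (hD : ∀ l, D (varClass t l) = derValue t a l) :
    D (socleClass t) = (3 * a.1) • socleClass t := by
  have h : ∀ i j k : Fin 3, D (varClass t i * varClass t j * varClass t k) =
      varClass t i * varClass t j * derValue t a k + (varClass t i * varClass t k * derValue t a j +
        varClass t j * varClass t k * derValue t a i) := fun i j k => by
    rw [Derivation.leibniz, Derivation.leibniz, hD, hD, hD]
    simp only [smul_eq_mul]
    ring
  rw [socleClass, h]
  simp only [varClass_mul_varClass_mul_derValue ht]
  rw [mul_right_comm _ (varClass t 2), show varClass t 1 * varClass t 2 * varClass t 0 =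
    varClass t 0 * varClass t 1 * varClass t 2 by ring]
  module

/-- The image of an element of the span of the positive part under a derivation. -/
theorem derivation_derValue {t : ℂ} (ht : t ^ 3 ≠ -27) {a : DerCoord}
    {D : YauAlgebra (e6Poly t) 1} (hD : ∀ l, D (varClass t l) = derValue t a l) (b : DerCoord)
    (l : Fin 3) : D (derValue t b l) = b.1 • derValue t a l + ∑ m, b.2.1 l m •
      ((2 * a.1) • quadClass t m + quadShift t a.2.1 m • socleClass t) +
      (3 * a.1 * b.2.2 l) • socleClass t := by
  rw [derValue_apply, D.map_add, D.map_add, D.map_smul, D.map_smul, hD,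
    derivation_socleClass ht hD, map_sum, smul_smul, mul_comm (b.2.2 l)]
  congr 2
  refine Finset.sum_congr rfl fun m _ => ?_
  rw [D.map_smul, derivation_quadClass ht hD]

/-- The cubic part of the bracket of two derivations. -/
def socleBracket (t : ℂ) (d d' : Fin 3 → Fin 6 → ℂ) (l : Fin 3) : ℂ :=
  ∑ m, (d' l m * quadShift t d m - d l m * quadShift t d' m)

/-- The bracket of derivations in coordinates. -/
def derBracket (t : ℂ) (a b : DerCoord) : DerCoord :=
  (0, a.1 • b.2.1 - b.1 • a.2.1,
    (2 * a.1) • b.2.2 - (2 * b.1) • a.2.2 + socleBracket t a.2.1 b.2.1)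

theorem commutator_varClass {t : ℂ} (ht : t ^ 3 ≠ -27) {a b : DerCoord}
    {D D' : YauAlgebra (e6Poly t) 1} (hD : ∀ l, D (varClass t l) = derValue t a l)
    (hD' : ∀ l, D' (varClass t l) = derValue t b l) (l : Fin 3) :
    ⁅D, D'⁆ (varClass t l) = derValue t (derBracket t a b) l := by
  rw [Derivation.commutator_apply, hD, hD', derivation_derValue ht hD, derivation_derValue ht hD']
  simp only [derValue_apply, derBracket, socleBracket, Fin.sum_univ_six, Pi.add_apply,
    Pi.sub_apply, Pi.smul_apply, smul_eq_mul]
  module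

/-- The monomial basis consists of products of variables, so Leibniz determines a derivation from
its values on the variables. -/
theorem derivation_ext {t : ℂ} (ht : t ^ 3 ≠ -27) {D D' : YauAlgebra (e6Poly t) 1}
    (h : ∀ l, D (varClass t l) = D' (varClass t l)) : D = D' := by
  have h1 : D.toLinearMap = D'.toLinearMap := by
    refine (monomialBasis ht).ext fun i => ?_
    change D _ = D' _
    rcases fin_eleven_cases i with rfl | ⟨l, rfl⟩ | ⟨m, rfl⟩ | rfl
    · rw [monomialBasis_zero, D.map_one_eq_zero, D'.map_one_eq_zero]
    · rw [monomialBasis_linIdx, h]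
    · rw [monomialBasis_quadIdx, quadClass, Derivation.leibniz, Derivation.leibniz, h, h]
    · simp only [monomialBasis_ten, socleClass, Derivation.leibniz, h]
  exact Derivation.ext fun x => LinearMap.congr_fun h1 x

end

noncomputable section

open Matrix

/-! ### Existence of derivations with given coordinates -/

/-- Lifts of the terms of order at least two of the values of a derivation. -/
def derLiftTail (a : DerCoord) (l : Fin 3) : FormalRing 3 :=
  ∑ m, a.2.1 l m • (MvPowerSeries.X (fstVar m) * MvPowerSeries.X (sndVar m)) +
    a.2.2 l • (MvPowerSeries.X 0 * MvPowerSeries.X 1 * MvPowerSeries.X 2)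

/-- Lifts of the values of a derivation. -/
def derLift (a : DerCoord) (l : Fin 3) : FormalRing 3 :=
  MvPowerSeries.C a.1 * MvPowerSeries.X l + derLiftTail a l

theorem toModuli_derLift (t : ℂ) (a : DerCoord) (l : Fin 3) :
    toModuli (e6Poly t) 1 (derLift a l) = derValue t a l := by
  rw [derLift, derLiftTail, derValue_apply, ← MvPowerSeries.smul_eq_C_mul, map_add, map_add,
    map_sum, map_smul, map_smul, map_mul, map_mul, add_assoc]
  congr 2

theorem constantCoeff_derLiftTail (a : DerCoord) (l : Fin 3) :
    MvPowerSeries.constantCoeff (derLiftTail a l) = 0 := by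
  simp [derLiftTail, MvPowerSeries.smul_eq_C_mul]

theorem constantCoeff_derLift (a : DerCoord) (l : Fin 3) :
    MvPowerSeries.constantCoeff (derLift a l) = 0 := by
  simp [derLift, constantCoeff_derLiftTail]

theorem mul_derLiftTail_mem {t : ℂ} (ht : t ^ 3 ≠ -27) (a : DerCoord) (l : Fin 3)
    {u v : FormalRing 3} (hu : MvPowerSeries.constantCoeff u = 0)
    (hv : MvPowerSeries.constantCoeff v = 0) :
    u * (v * derLiftTail a l) ∈ moduliIdeal (e6Poly t) 1 := by
  have hX := fun i : Fin 3 => MvPowerSeries.constantCoeff_X (R := ℂ) i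
  simp only [derLiftTail, mul_add, Finset.mul_sum, MvPowerSeries.smul_eq_C_mul]
  refine add_mem (sum_mem fun m _ => ?_) ?_
  · rw [mul_left_comm v, mul_left_comm u]
    exact Ideal.mul_mem_left _ _ (mul_fourfold_mem ht hu hv (hX _) (hX _))
  · rw [mul_left_comm v, mul_left_comm u, mul_assoc (MvPowerSeries.X 0)]
    exact Ideal.mul_mem_left _ _ (mul_fourfold_mem ht hu hv (hX _) (by rw [map_mul, hX, zero_mul]))

theorem mul_pderiv_mem (t : ℂ) {u : FormalRing 3} (hu : MvPowerSeries.constantCoeff u = 0)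
    (i : Fin 3) : u * MvPowerSeries.pderiv ℂ i (e6Poly t) ∈ moduliIdeal (e6Poly t) 1 := by
  refine mul_mem_of_constantCoeff hu fun j => ?_
  rw [moduliIdeal_one]
  exact X_mul_pderiv_mem t le_rfl i j

theorem mul_mem_of_mem_jacobiIdeal {t : ℂ} {u v : FormalRing 3}
    (hu : MvPowerSeries.constantCoeff u = 0) (hv : v ∈ jacobiIdeal (e6Poly t)) :
    u * v ∈ moduliIdeal (e6Poly t) 1 := by
  rw [jacobiIdeal, Ideal.mem_span_range_iff_exists_fun] at hv
  obtain ⟨g, rfl⟩ := hv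
  rw [Finset.mul_sum]
  refine sum_mem fun i _ => ?_
  rw [mul_left_comm]
  exact Ideal.mul_mem_left _ _ (mul_pderiv_mem t hu i)

/-- The derivation of the power series ring with given values at the variables. -/
def vectorField (h : Fin 3 → FormalRing 3) : Derivation ℂ (FormalRing 3) (FormalRing 3) :=
  ∑ j, h j • MvPowerSeries.pderiv ℂ j

theorem vectorField_apply (h : Fin 3 → FormalRing 3) (g : FormalRing 3) :
    vectorField h g = ∑ j, h j * MvPowerSeries.pderiv ℂ j g := by
  simp only [vectorField, Fin.sum_univ_three, Derivation.add_apply, Derivation.smul_apply,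
    smul_eq_mul]

theorem vectorField_X (h : Fin 3 → FormalRing 3) (l : Fin 3) :
    vectorField h (MvPowerSeries.X l) = h l := by
  classical
  rw [vectorField_apply, Finset.sum_eq_single l]
  · simp
  · intro j _ hj
    simp [MvPowerSeries.pderiv_X_of_ne hj.symm]
  · simp

theorem constantCoeff_vectorField {h : Fin 3 → FormalRing 3}
    (hh : ∀ j, MvPowerSeries.constantCoeff (h j) = 0) (g : FormalRing 3) :
    MvPowerSeries.constantCoeff (vectorField h g) = 0 := by
  rw [vectorField_apply, map_sum]
  exact Finset.sum_eq_zero fun j _ => by rw [map_mul, hh, zero_mul]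

/-- The Euler part multiplies the quadric ∂ᵢf by 2·`a.1`. The tail produces terms of order at least
three, and with the factor u these lie in the fourth power of the maximal ideal. -/
theorem mul_vectorField_pderiv_mem {t : ℂ} (ht : t ^ 3 ≠ -27) (a : DerCoord) {u : FormalRing 3}
    (hu : MvPowerSeries.constantCoeff u = 0) (i : Fin 3) :
    u * vectorField (derLift a) (MvPowerSeries.pderiv ℂ i (e6Poly t)) ∈
      moduliIdeal (e6Poly t) 1 := by
  obtain ⟨j, k, hij, hik, hjk⟩ : ∃ j k : Fin 3, i ≠ j ∧ i ≠ k ∧ j ≠ k := by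
    revert i
    decide
  have h1 : vectorField (derLift a) (MvPowerSeries.pderiv ℂ i (e6Poly t)) =
      MvPowerSeries.C (2 * a.1) * MvPowerSeries.pderiv ℂ i (e6Poly t) +
      (6 * (MvPowerSeries.X i * derLiftTail a i) + MvPowerSeries.C t *
        (MvPowerSeries.X j * derLiftTail a k + MvPowerSeries.X k * derLiftTail a j)) := by
    rw [pderiv_e6Poly t hij hik hjk, ← map_ofNat (MvPowerSeries.C (σ := Fin 3) (R := ℂ)) 3,
      ← MvPowerSeries.smul_eq_C_mul, ← MvPowerSeries.smul_eq_C_mul, map_add, Derivation.map_smul,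
      Derivation.map_smul, Derivation.leibniz_pow, Derivation.leibniz, vectorField_X,
      vectorField_X, vectorField_X]
    simp only [MvPowerSeries.smul_eq_C_mul, smul_eq_mul, derLift, map_mul, map_ofNat, nsmul_eq_mul]
    push_cast
    ring
  have hX := fun i : Fin 3 => MvPowerSeries.constantCoeff_X (R := ℂ) i
  rw [h1]
  simp only [mul_add, mul_left_comm u]
  refine add_mem (Ideal.mul_mem_left _ _ (mul_pderiv_mem t hu i)) (add_mem ?_ (add_mem ?_ ?_))
  · exact Ideal.mul_mem_left _ _ (by
      rw [mul_left_comm]; exact mul_derLiftTail_mem ht a i hu (hX i))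
  · exact Ideal.mul_mem_left _ _ (by
      rw [mul_left_comm]; exact mul_derLiftTail_mem ht a k hu (hX j))
  · exact Ideal.mul_mem_left _ _ (by
      rw [mul_left_comm]; exact mul_derLiftTail_mem ht a j hu (hX k))

/-- The coefficients of the field lie in m, so f goes into mJ and every series goes into m. For a
product of u in m and v in J only u times the derivative of v needs care, and Leibniz reduces it to
`mul_vectorField_pderiv_mem`. -/
theorem vectorField_mem {t : ℂ} (ht : t ^ 3 ≠ -27) (a : DerCoord) {x : FormalRing 3}
    (hx : x ∈ moduliIdeal (e6Poly t) 1) :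
    vectorField (derLift a) x ∈ moduliIdeal (e6Poly t) 1 := by
  have hc := constantCoeff_vectorField (constantCoeff_derLift a)
  have hf : e6Poly t ∈ moduliIdeal (e6Poly t) 1 := by
    rw [moduliIdeal_one, moduliIdeal_coe]
    exact Ideal.mem_sup_left (Ideal.mem_span_singleton_self _)
  have hJ : ∀ u v, MvPowerSeries.constantCoeff u = 0 → v ∈ jacobiIdeal (e6Poly t) →
      u * vectorField (derLift a) v ∈ moduliIdeal (e6Poly t) 1 := by
    intro u v hu hv
    rw [jacobiIdeal, Ideal.mem_span_range_iff_exists_fun] at hv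
    obtain ⟨g, rfl⟩ := hv
    rw [map_sum, Finset.mul_sum]
    refine sum_mem fun i _ => ?_
    rw [Derivation.leibniz, smul_eq_mul, smul_eq_mul, mul_add, mul_left_comm u (g i)]
    refine add_mem (Ideal.mul_mem_left _ _ (mul_vectorField_pderiv_mem ht a hu i)) ?_
    rw [← mul_assoc]
    exact Ideal.mul_mem_right _ _ (mul_pderiv_mem t hu i)
  have hx' := hx
  rw [moduliIdeal_one, moduliIdeal_coe, pow_one] at hx'
  obtain ⟨y, hy, z, hz, rfl⟩ := Submodule.mem_sup.1 hx'
  rw [map_add]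
  refine add_mem ?_ ?_
  · obtain ⟨g, rfl⟩ := Ideal.mem_span_singleton'.1 hy
    rw [Derivation.leibniz, smul_eq_mul, smul_eq_mul]
    refine add_mem (Ideal.mul_mem_left _ _ ?_) (Ideal.mul_mem_right _ _ hf)
    rw [vectorField_apply]
    exact sum_mem fun j _ => mul_pderiv_mem t (constantCoeff_derLift a j) j
  · refine Submodule.mul_induction_on hz ?_ ?_
    · intro u hu v hv
      rw [mem_maximalIdeal_iff] at hu
      rw [Derivation.leibniz, smul_eq_mul, smul_eq_mul]
      refine add_mem (hJ u v hu hv) ?_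
      rw [mul_comm]
      exact mul_mem_of_mem_jacobiIdeal (hc u) hv
    · intro u v hu hv
      rw [map_add]
      exact add_mem hu hv

theorem exists_derivation {t : ℂ} (ht : t ^ 3 ≠ -27) (a : DerCoord) :
    ∃ D : YauAlgebra (e6Poly t) 1, ∀ l, D (varClass t l) = derValue t a l := by
  have hd : ∀ x, toModuli (e6Poly t) 1 x = 0 →
      toModuli (e6Poly t) 1 (vectorField (derLift a) x) = 0 := fun x hx => by
    rw [toModuli_eq_zero] at hx ⊢
    exact vectorField_mem ht a hx
  refine ⟨Derivation.liftOfSurjective (toModuli_surjective _ _) hd, fun l => ?_⟩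
  rw [varClass, Derivation.liftOfSurjective_apply, vectorField_X, toModuli_derLift]

end

noncomputable section

open Matrix

/-! ### Classification of the derivations away from the jump points -/

theorem derivation_relation {t : ℂ} {D : YauAlgebra (e6Poly t) 1} {h : Fin 3 → FormalRing 3}
    (hD : ∀ l, D (varClass t l) = toModuli (e6Poly t) 1 (h l)) {i j : Fin 3}
    (hij : MvPowerSeries.X i ^ 2 * MvPowerSeries.X j ∈ moduliIdeal (e6Poly t) 1) :
    h i * (2 * (MvPowerSeries.X i * MvPowerSeries.X j)) + h j * MvPowerSeries.X i ^ 2 ∈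
      moduliIdeal (e6Poly t) 1 := by
  have h1 : varClass t i ^ 2 * varClass t j = 0 := by
    rw [← toModuli_eq_zero, map_mul, map_pow] at hij
    exact hij
  have h2 := congrArg D h1
  rw [map_zero, Derivation.leibniz, Derivation.leibniz_pow, hD, hD] at h2
  rw [← toModuli_eq_zero]
  simp only [map_add, map_mul, map_pow, map_ofNat]
  simp only [smul_eq_mul, nsmul_eq_mul] at h2
  push_cast at h2
  rw [← h2, varClass, varClass]
  ring

theorem derivation_relation_cube {t : ℂ} {D : YauAlgebra (e6Poly t) 1} {h : Fin 3 → FormalRing 3}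
    (hD : ∀ l, D (varClass t l) = toModuli (e6Poly t) 1 (h l)) (i : Fin 3) :
    9 * (h i * MvPowerSeries.X i ^ 2) + MvPowerSeries.C t * (h 0 * (MvPowerSeries.X 1 *
      MvPowerSeries.X 2) + h 1 * (MvPowerSeries.X 0 * MvPowerSeries.X 2) +
      h 2 * (MvPowerSeries.X 0 * MvPowerSeries.X 1)) ∈ moduliIdeal (e6Poly t) 1 := by
  have h1 : (3 : ℂ) • varClass t i ^ 3 + t • socleClass t = 0 := by
    have h2 := X_cube_add_mem_one t i
    rw [← map_ofNat (MvPowerSeries.C (σ := Fin 3) (R := ℂ)), ← MvPowerSeries.smul_eq_C_mul,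
      ← MvPowerSeries.smul_eq_C_mul, ← toModuli_eq_zero, map_add, map_smul, map_smul, map_mul,
      map_mul, map_pow] at h2
    exact h2
  have h2 := congrArg D h1
  rw [map_zero, D.map_add, D.map_smul, D.map_smul, socleClass, Derivation.leibniz,
    Derivation.leibniz, Derivation.leibniz_pow, hD, hD, hD, hD] at h2
  rw [← toModuli_eq_zero, ← MvPowerSeries.smul_eq_C_mul]
  refine Eq.trans ?_ h2
  simp only [map_add, map_mul, map_pow, map_ofNat, map_smul]
  simp only [smul_eq_mul, nsmul_eq_mul, varClass]
  have h3 : ∀ y : ModuliAlgebra (e6Poly t) 1, (3 : ℂ) • y = 3 * y := fun y => by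
    rw [show (3 : ℂ) = 1 + 1 + 1 by norm_num, add_smul, add_smul, one_smul]
    ring
  rw [h3]
  push_cast
  ring_nf

/-- Applying D to the relations xᵢ²xⱼ = 0 and 3xᵢ³ + txyz = 0 constrains the lifts of its values.
Degree two kills the constant terms; degree three forces the linear part to be scalar, where t³ ≠
216 handles the off-diagonal entries and t ≠ 0 the diagonal ones. -/
theorem exists_derValue {t : ℂ} (ht : t ^ 3 ≠ -27) (ht' : t * (t ^ 3 - 216) ≠ 0)
    (D : YauAlgebra (e6Poly t) 1) : ∃ a, ∀ l, D (varClass t l) = derValue t a l := by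
  choose h hD using fun l => toModuli_surjective (e6Poly t) 1 (D (varClass t l))
  replace hD : ∀ l, D (varClass t l) = toModuli (e6Poly t) 1 (h l) := fun l => (hD l).symm
  obtain ⟨ht0, ht6⟩ := mul_ne_zero_iff.1 ht'
  have hrel := fun {i j : Fin 3} (hij : i ≠ j) => derivation_relation hD (X_sq_mul_X_mem_one ht hij)
  have hcube := derivation_relation_cube hD
  have key : ∀ (g g' : FormalRing 3) (a b c a' b' c' : ℕ) (d : Fin 3 →₀ ℕ),
      MvPowerSeries.coeff d (g * (2 * (MvPowerSeries.X 0 ^ a *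
        MvPowerSeries.X 1 ^ b * MvPowerSeries.X 2 ^ c)) + g' * (MvPowerSeries.X 0 ^ a' *
        MvPowerSeries.X 1 ^ b' * MvPowerSeries.X 2 ^ c')) =
      2 * MvPowerSeries.coeff d (g * (MvPowerSeries.X 0 ^ a *
        MvPowerSeries.X 1 ^ b * MvPowerSeries.X 2 ^ c)) +
      MvPowerSeries.coeff d (g' * (MvPowerSeries.X 0 ^ a' *
        MvPowerSeries.X 1 ^ b' * MvPowerSeries.X 2 ^ c')) := by
    intro g g' a b c a' b' c' d
    rw [map_add, mul_left_comm, ← map_ofNat (MvPowerSeries.C (σ := Fin 3) (R := ℂ)) 2,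
      ← MvPowerSeries.smul_eq_C_mul, map_smul, smul_eq_mul]
  -- What membership in the ideal yields: vanishing coefficients below degree three, and vanishing
  -- of the cubic functional.
  have rel : ∀ (g g' : FormalRing 3) (a b c a' b' c' : ℕ), g * (2 * (MvPowerSeries.X 0 ^ a *
        MvPowerSeries.X 1 ^ b * MvPowerSeries.X 2 ^ c)) + g' * (MvPowerSeries.X 0 ^ a' *
        MvPowerSeries.X 1 ^ b' * MvPowerSeries.X 2 ^ c') ∈ moduliIdeal (e6Poly t) 1 →
      (∀ p q r, p + q + r < 3 → 2 * MvPowerSeries.coeff (triExp p q r) (g * (MvPowerSeries.X 0 ^ a *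
        MvPowerSeries.X 1 ^ b * MvPowerSeries.X 2 ^ c)) +
      MvPowerSeries.coeff (triExp p q r) (g' * (MvPowerSeries.X 0 ^ a' *
        MvPowerSeries.X 1 ^ b' * MvPowerSeries.X 2 ^ c')) = 0) ∧
      2 * cubicFunctional t (g * (MvPowerSeries.X 0 ^ a *
        MvPowerSeries.X 1 ^ b * MvPowerSeries.X 2 ^ c)) +
      cubicFunctional t (g' * (MvPowerSeries.X 0 ^ a' *
        MvPowerSeries.X 1 ^ b' * MvPowerSeries.X 2 ^ c')) = 0 := by
    intro g g' a b c a' b' c' hm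
    constructor
    · intro p q r hpqr
      rw [← key]
      exact mem_orderIdeal.1 (moduliIdeal_one_le t hm) _ (by rw [triExp_degree]; exact hpqr)
    · have h1 := monomialFunctional_eq_zero hm 10
      change cubicFunctional t _ = 0 at h1
      rw [cubicFunctional_apply] at h1 ⊢
      simp only [key] at h1
      rw [cubicFunctional_apply]
      linear_combination h1
  have r01 := rel (h 0) (h 1) 1 1 0 2 0 0 (by simpa using hrel (show (0 : Fin 3) ≠ 1 by decide))
  have r02 := rel (h 0) (h 2) 1 0 1 2 0 0 (by simpa using hrel (show (0 : Fin 3) ≠ 2 by decide))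
  have r10 := rel (h 1) (h 0) 1 1 0 0 2 0 (by
    simpa [mul_comm (MvPowerSeries.X (0 : Fin 3))] using hrel (show (1 : Fin 3) ≠ 0 by decide))
  have r12 := rel (h 1) (h 2) 0 1 1 0 2 0 (by simpa using hrel (show (1 : Fin 3) ≠ 2 by decide))
  have r20 := rel (h 2) (h 0) 1 0 1 0 0 2 (by
    simpa [mul_comm (MvPowerSeries.X (0 : Fin 3))] using hrel (show (2 : Fin 3) ≠ 0 by decide))
  have r21 := rel (h 2) (h 1) 0 1 1 0 0 2 (by
    simpa [mul_comm (MvPowerSeries.X (1 : Fin 3))] using hrel (show (2 : Fin 3) ≠ 1 by decide))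
  -- The coefficient of xy in 2·h₀·xy + h₁·x² is twice the constant term of h₀; similarly for h₁ and
  -- h₂.
  have c0 := r01.1 1 1 0 (by norm_num)
  have c1 := r10.1 1 1 0 (by norm_num)
  have c2 := r20.1 1 0 1 (by norm_num)
  replace r01 := r01.2
  replace r02 := r02.2
  replace r10 := r10.2
  replace r12 := r12.2
  replace r20 := r20.2
  replace r21 := r21.2
  simp only [cubicFunctional_apply, coeff_triExp_mul] at r01 r02 r10 r12 r20 r21 c0 c1 c2
  simp at r01 r02 r10 r12 r20 r21 c0 c1 c2
  have e0 : ∀ g, cubicFunctional t (g * (MvPowerSeries.X 1 * MvPowerSeries.X 2)) =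
      MvPowerSeries.coeff (triExp 1 0 0) g := fun g => by
    have := coeff_triExp_mul (a' := 0) (b' := 1) (c' := 1) (g := g)
    rw [pow_zero, pow_one, pow_one, one_mul] at this
    simp [cubicFunctional_apply, this]
  have e1 : ∀ g, cubicFunctional t (g * (MvPowerSeries.X 0 * MvPowerSeries.X 2)) =
      MvPowerSeries.coeff (triExp 0 1 0) g := fun g => by
    have := coeff_triExp_mul (a' := 1) (b' := 0) (c' := 1) (g := g)
    rw [pow_zero, pow_one, pow_one, mul_one] at this
    simp [cubicFunctional_apply, this]
  have e2 : ∀ g, cubicFunctional t (g * (MvPowerSeries.X 0 * MvPowerSeries.X 1)) =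
      MvPowerSeries.coeff (triExp 0 0 1) g := fun g => by
    have := coeff_triExp_mul (a' := 1) (b' := 1) (c' := 0) (g := g)
    rw [pow_zero, pow_one, pow_one, mul_one] at this
    simp [cubicFunctional_apply, this]
  have s0 : ∀ g, cubicFunctional t (g * MvPowerSeries.X 0 ^ 2) =
      -(t / 3) * MvPowerSeries.coeff (triExp 1 0 0) g := fun g => by
    have := coeff_triExp_mul (a' := 2) (b' := 0) (c' := 0) (g := g)
    rw [pow_zero, pow_zero, mul_one, mul_one] at this
    simp [cubicFunctional_apply, this]
  have s1 : ∀ g, cubicFunctional t (g * MvPowerSeries.X 1 ^ 2) =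
      -(t / 3) * MvPowerSeries.coeff (triExp 0 1 0) g := fun g => by
    have := coeff_triExp_mul (a' := 0) (b' := 2) (c' := 0) (g := g)
    rw [pow_zero, pow_zero, mul_one, one_mul] at this
    simp [cubicFunctional_apply, this]
  have s2 : ∀ g, cubicFunctional t (g * MvPowerSeries.X 2 ^ 2) =
      -(t / 3) * MvPowerSeries.coeff (triExp 0 0 1) g := fun g => by
    have := coeff_triExp_mul (a' := 0) (b' := 0) (c' := 2) (g := g)
    rw [pow_zero, pow_zero, one_mul, one_mul] at this
    simp [cubicFunctional_apply, this]
  have hdiag : ∀ i, 9 * cubicFunctional t (h i * MvPowerSeries.X i ^ 2) +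
      t * (MvPowerSeries.coeff (triExp 1 0 0) (h 0) + MvPowerSeries.coeff (triExp 0 1 0) (h 1) +
        MvPowerSeries.coeff (triExp 0 0 1) (h 2)) = 0 := by
    intro i
    have h1 := monomialFunctional_eq_zero (hcube i) 10
    change cubicFunctional t _ = 0 at h1
    rwa [← map_ofNat (MvPowerSeries.C (σ := Fin 3) (R := ℂ)), ← MvPowerSeries.smul_eq_C_mul,
      ← MvPowerSeries.smul_eq_C_mul, map_add, map_smul, map_smul, map_add, map_add, e0, e1, e2]
      at h1
  have d0 := hdiag 0
  have d1 := hdiag 1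
  have d2 := hdiag 2
  rw [s0] at d0
  rw [s1] at d1
  rw [s2] at d2
  -- The six off-diagonal entries fall into two cycles of three. Going once around gives 8u =
  -- (t/3)³u, that is (t³ - 216)u = 0.
  have hoff : ∀ {u v w : ℂ}, 2 * u + -(t / 3 * v) = 0 → 2 * v + -(t / 3 * w) = 0 →
      2 * w + -(t / 3 * u) = 0 → u = 0 := by
    intro u v w h1 h2 h3
    refine (mul_eq_zero.1 ?_).resolve_left ht6
    linear_combination -108 * h1 - 18 * t * h2 - 3 * t ^ 2 * h3
  have n02 := hoff r01 r12 r20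
  have n10 := hoff r12 r20 r01
  have n21 := hoff r20 r01 r12
  have n01 := hoff r02 r21 r10
  have n20 := hoff r21 r10 r02
  have n12 := hoff r10 r02 r21
  -- The cube relations say that 3t times each diagonal entry equals t times the trace, so the
  -- diagonal entries agree when t ≠ 0.
  have m1 : MvPowerSeries.coeff (triExp 0 1 0) (h 1) = MvPowerSeries.coeff (triExp 1 0 0) (h 0) :=
    mul_left_cancel₀ ht0 (by linear_combination (d0 - d1) / 3)
  have m2 : MvPowerSeries.coeff (triExp 0 0 1) (h 2) = MvPowerSeries.coeff (triExp 1 0 0) (h 0) :=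
    mul_left_cancel₀ ht0 (by linear_combination (d0 - d2) / 3)
  refine ⟨⟨MvPowerSeries.coeff (triExp 1 0 0) (h 0),
    fun l m => monomialFunctional t (quadIdx m) (h l), fun l => cubicFunctional t (h l)⟩,
    fun l => ?_⟩
  have g0 : monomialFunctional t 0 = MvPowerSeries.coeff (triExp 0 0 0) := rfl
  have g1 : monomialFunctional t (linIdx 0) = MvPowerSeries.coeff (triExp 1 0 0) := rfl
  have g2 : monomialFunctional t (linIdx 1) = MvPowerSeries.coeff (triExp 0 1 0) := rfl
  have g3 : monomialFunctional t (linIdx 2) = MvPowerSeries.coeff (triExp 0 0 1) := rfl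
  have g10 : monomialFunctional t 10 = cubicFunctional t := rfl
  rw [hD, monomialBasis_repr_toModuli ht, sum_fin_eleven, derValue_apply, monomialBasis_ten,
    Fin.sum_univ_three, g0, g1, g2, g3, g10]
  simp only [monomialBasis_linIdx, monomialBasis_quadIdx]
  congr 2
  fin_cases l
  · simp [c0, n01, n02]
  · simp [c1, n10, n12, m1]
  · simp [c2, n20, n21, m2]

end

noncomputable section

open Matrix

/-! ### The Yau algebra with constant structure constants -/

/-- A linear shear of the quadratic coefficients, for which the cubic part of the bracket of the
images does not depend on the parameter. -/
def quadShear (t : ℂ) : (Fin 3 → Fin 6 → ℂ) →ₗ[ℂ] (Fin 3 → Fin 6 → ℂ) where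
  toFun d := ![
    ![d 0 0, d 0 1, d 0 2, d 0 3 + t / 3 * d 0 2, d 0 4 + t / 3 * d 0 1,
      d 0 5 + (t / 3 * d 0 0 - t / 6 * (d 1 3 + d 2 4))],
    ![d 1 0, d 1 1, d 1 2, d 1 3 + t / 3 * d 1 2,
      d 1 4 + (t / 3 * d 1 1 - t / 6 * (d 0 3 + d 2 5)), d 1 5 + t / 3 * d 1 0],
    ![d 2 0, d 2 1, d 2 2, d 2 3 + (t / 3 * d 2 2 - t / 6 * (d 0 4 + d 1 5)),
      d 2 4 + t / 3 * d 2 1, d 2 5 + t / 3 * d 2 0]]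
  map_add' d d' := by
    funext l m
    fin_cases l <;> fin_cases m <;> simp <;> ring
  map_smul' c d := by
    funext l m
    fin_cases l <;> fin_cases m <;> simp <;> ring

theorem quadShear_injective (t : ℂ) : Function.Injective (quadShear t) := by
  rw [injective_iff_map_eq_zero]
  intro d hd
  have h : ∀ l m, quadShear t d l m = 0 := fun l m => by rw [hd]; rfl
  have h00 : d 0 0 = 0 := h 0 0
  have h01 : d 0 1 = 0 := h 0 1
  have h02 : d 0 2 = 0 := h 0 2
  have h10 : d 1 0 = 0 := h 1 0
  have h11 : d 1 1 = 0 := h 1 1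
  have h12 : d 1 2 = 0 := h 1 2
  have h20 : d 2 0 = 0 := h 2 0
  have h21 : d 2 1 = 0 := h 2 1
  have h22 : d 2 2 = 0 := h 2 2
  have h03 : d 0 3 = 0 := by simpa [quadShear, h02] using h 0 3
  have h04 : d 0 4 = 0 := by simpa [quadShear, h01] using h 0 4
  have h13 : d 1 3 = 0 := by simpa [quadShear, h12] using h 1 3
  have h15 : d 1 5 = 0 := by simpa [quadShear, h10] using h 1 5
  have h24 : d 2 4 = 0 := by simpa [quadShear, h21] using h 2 4
  have h25 : d 2 5 = 0 := by simpa [quadShear, h20] using h 2 5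
  have h05 : d 0 5 = 0 := by simpa [quadShear, h00, h13, h24] using h 0 5
  have h14 : d 1 4 = 0 := by simpa [quadShear, h11, h03, h25] using h 1 4
  have h23 : d 2 3 = 0 := by simpa [quadShear, h22, h04, h15] using h 2 3
  funext l m
  fin_cases l <;> fin_cases m <;> assumption

/-- The shear as an equivalence. -/
def quadShearEquiv (t : ℂ) : (Fin 3 → Fin 6 → ℂ) ≃ₗ[ℂ] (Fin 3 → Fin 6 → ℂ) :=
  LinearEquiv.ofInjectiveEndo (quadShear t) (quadShear_injective t)

/-- After the shear, the shift of a mixed monomial xⱼxₖ is the one at parameter 0, while the shift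
of xᵢ² drops by t/3 times that of the complementary xⱼxₖ. The summand t/3 times the xᵢ²-coefficient,
which the shear adds to the xⱼxₖ-coefficient, compensates this in the bracket. The correction with
-t/6 is proportional to the shift of xⱼxₖ, so it contributes symmetrically in d and d' and cancels
in the commutator. -/
theorem socleBracket_quadShear (t : ℂ) (d d' : Fin 3 → Fin 6 → ℂ) :
    socleBracket t (quadShear t d) (quadShear t d') = socleBracket 0 d d' := by
  funext l
  fin_cases l <;> simp [socleBracket, quadShift, quadShear, socleCoeff, Fin.sum_univ_six, fstVar,
    sndVar] <;> ring

/-- The coordinates adapted to the bracket. -/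
def coordShear (t : ℂ) : DerCoord ≃ₗ[ℂ] DerCoord :=
  (LinearEquiv.refl ℂ ℂ).prodCongr ((quadShearEquiv t).prodCongr (LinearEquiv.refl ℂ _))

theorem coordShear_apply (t : ℂ) (a : DerCoord) :
    coordShear t a = (a.1, quadShear t a.2.1, a.2.2) := rfl

theorem derBracket_coordShear (t : ℂ) (a b : DerCoord) :
    derBracket t (coordShear t a) (coordShear t b) = coordShear t (derBracket 0 a b) := by
  simp only [coordShear_apply, derBracket, socleBracket_quadShear, map_sub, map_smul]

/-- The values of a derivation at the variables. -/
def valuesAtVars (t : ℂ) :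
    YauAlgebra (e6Poly t) 1 →ₗ[ℂ] (Fin 3 → ModuliAlgebra (e6Poly t) 1) where
  toFun D l := D (varClass t l)
  map_add' _ _ := rfl
  map_smul' _ _ := rfl

theorem valuesAtVars_injective {t : ℂ} (ht : t ^ 3 ≠ -27) :
    Function.Injective (valuesAtVars t) :=
  fun _ _ h => derivation_ext ht fun l => congrFun h l

theorem range_derValue {t : ℂ} (ht : t ^ 3 ≠ -27) (ht' : t * (t ^ 3 - 216) ≠ 0) :
    LinearMap.range (derValue t) = LinearMap.range (valuesAtVars t) := by
  ext v
  constructor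
  · rintro ⟨a, rfl⟩
    obtain ⟨D, hD⟩ := exists_derivation ht a
    exact ⟨D, funext hD⟩
  · rintro ⟨D, rfl⟩
    obtain ⟨a, ha⟩ := exists_derValue ht ht' D
    exact ⟨a, (funext ha).symm⟩

/-- The parametrization of the first Yau algebra away from the jump points. -/
def yauParam {t : ℂ} (ht : t ^ 3 ≠ -27) (ht' : t * (t ^ 3 - 216) ≠ 0) :
    DerCoord ≃ₗ[ℂ] YauAlgebra (e6Poly t) 1 :=
  coordShear t ≪≫ₗ LinearEquiv.ofInjective (derValue t) (derValue_injective ht) ≪≫ₗ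
    LinearEquiv.ofEq _ _ (range_derValue ht ht') ≪≫ₗ
    (LinearEquiv.ofInjective (valuesAtVars t) (valuesAtVars_injective ht)).symm

theorem yauParam_varClass {t : ℂ} (ht : t ^ 3 ≠ -27) (ht' : t * (t ^ 3 - 216) ≠ 0) (a : DerCoord)
    (l : Fin 3) : yauParam ht ht' a (varClass t l) = derValue t (coordShear t a) l := by
  have h := congrArg Subtype.val ((LinearEquiv.ofInjective (valuesAtVars t)
    (valuesAtVars_injective ht)).apply_symm_apply (LinearEquiv.ofEq _ _ (range_derValue ht ht')
      (LinearEquiv.ofInjective (derValue t) (derValue_injective ht) (coordShear t a))))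
  exact congrFun h l

/-- The structure is independent of t. Here `derBracket 0` is only a formula on coordinates: 0 is a
jump point, and its Yau algebra plays no role. -/
theorem lie_yauParam {t : ℂ} (ht : t ^ 3 ≠ -27) (ht' : t * (t ^ 3 - 216) ≠ 0) (a b : DerCoord) :
    ⁅yauParam ht ht' a, yauParam ht ht' b⁆ = yauParam ht ht' (derBracket 0 a b) := by
  refine derivation_ext ht fun l => ?_
  rw [commutator_varClass ht (yauParam_varClass ht ht' a) (yauParam_varClass ht ht' b),
    derBracket_coordShear, yauParam_varClass]

/-- The isomorphisms between the first Yau algebras at different parameters. -/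
def yauTransport {t s : ℂ} (ht : t ^ 3 ≠ -27) (ht' : t * (t ^ 3 - 216) ≠ 0) (hs : s ^ 3 ≠ -27)
    (hs' : s * (s ^ 3 - 216) ≠ 0) : YauAlgebra (e6Poly t) 1 ≃ₗ⁅ℂ⁆ YauAlgebra (e6Poly s) 1 :=
  { (yauParam ht ht').symm ≪≫ₗ yauParam hs hs' with
    map_lie' := by
      intro x y
      obtain ⟨a, rfl⟩ := (yauParam ht ht').surjective x
      obtain ⟨b, rfl⟩ := (yauParam ht ht').surjective y
      change yauParam hs hs' ((yauParam ht ht').symm _) = ⁅yauParam hs hs' ((yauParam ht ht').symm _),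
        yauParam hs hs' ((yauParam ht ht').symm _)⁆
      rw [lie_yauParam, LinearEquiv.symm_apply_apply, LinearEquiv.symm_apply_apply,
        LinearEquiv.symm_apply_apply, lie_yauParam] }

theorem finrank_derCoord : Module.finrank ℂ DerCoord = 22 := by
  simp [Module.finrank_prod, Module.finrank_pi_fintype]

theorem yauParam_symm_lie {t : ℂ} (ht : t ^ 3 ≠ -27) (ht' : t * (t ^ 3 - 216) ≠ 0)
    (x y : YauAlgebra (e6Poly t) 1) : (yauParam ht ht').symm ⁅x, y⁆ =
      derBracket 0 ((yauParam ht ht').symm x) ((yauParam ht ht').symm y) := by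
  rw [LinearEquiv.symm_apply_eq, ← lie_yauParam, LinearEquiv.apply_symm_apply,
    LinearEquiv.apply_symm_apply]

/-- The derivations without Euler part. -/
def nilIdeal {t : ℂ} (ht : t ^ 3 ≠ -27) (ht' : t * (t ^ 3 - 216) ≠ 0) :
    LieIdeal ℂ (YauAlgebra (e6Poly t) 1) where
  carrier := {x | ((yauParam ht ht').symm x).1 = 0}
  zero_mem' := by simp
  add_mem' {x y} hx hy := by
    simp only [Set.mem_ofPred_eq, map_add, Prod.fst_add] at *
    rw [hx, hy, add_zero]
  smul_mem' c x hx := by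
    simp only [Set.mem_ofPred_eq, map_smul, Prod.smul_fst] at *
    rw [hx, smul_zero]
  lie_mem {x y} _ := by
    change ((yauParam ht ht').symm ⁅x, y⁆).1 = 0
    rw [yauParam_symm_lie]
    rfl

/-- The derivations with values in the socle. -/
def socleIdeal {t : ℂ} (ht : t ^ 3 ≠ -27) (ht' : t * (t ^ 3 - 216) ≠ 0) :
    LieIdeal ℂ (YauAlgebra (e6Poly t) 1) where
  carrier := {x | ((yauParam ht ht').symm x).1 = 0 ∧ ((yauParam ht ht').symm x).2.1 = 0}
  zero_mem' := by simp
  add_mem' {x y} hx hy := by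
    simp only [Set.mem_ofPred_eq, map_add, Prod.fst_add, Prod.snd_add] at *
    rw [hx.1, hy.1, hx.2, hy.2, add_zero, add_zero]
    exact ⟨rfl, rfl⟩
  smul_mem' c x hx := by
    simp only [Set.mem_ofPred_eq, map_smul, Prod.smul_fst, Prod.smul_snd] at *
    rw [hx.1, hx.2, smul_zero, smul_zero]
    exact ⟨rfl, rfl⟩
  lie_mem {x y} hy := by
    change ((yauParam ht ht').symm ⁅x, y⁆).1 = 0 ∧ ((yauParam ht ht').symm ⁅x, y⁆).2.1 = 0
    have hy' : ((yauParam ht ht').symm y).1 = 0 ∧ ((yauParam ht ht').symm y).2.1 = 0 := hy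
    rw [yauParam_symm_lie]
    refine ⟨rfl, ?_⟩
    simp only [derBracket, hy'.1, hy'.2, smul_zero, zero_smul, sub_zero]

/-- Brackets have no Euler part, brackets of derivations without Euler part take values in the
socle, and derivations with socle values commute. The third derived algebra is therefore zero. -/
theorem isSolvable_yauAlgebra {t : ℂ} (ht : t ^ 3 ≠ -27) (ht' : t * (t ^ 3 - 216) ≠ 0) :
    LieAlgebra.IsSolvable (YauAlgebra (e6Poly t) 1) := by
  have h1 : LieAlgebra.derivedSeries ℂ (YauAlgebra (e6Poly t) 1) 1 ≤ nilIdeal ht ht' := by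
    rw [LieAlgebra.derivedSeries_def, LieAlgebra.derivedSeriesOfIdeal_succ,
      LieSubmodule.lie_le_iff]
    intro x _ y _
    change ((yauParam ht ht').symm ⁅x, y⁆).1 = 0
    rw [yauParam_symm_lie]
    rfl
  have h2 : LieAlgebra.derivedSeries ℂ (YauAlgebra (e6Poly t) 1) 2 ≤ socleIdeal ht ht' := by
    rw [LieAlgebra.derivedSeries_def, LieAlgebra.derivedSeriesOfIdeal_succ,
      LieSubmodule.lie_le_iff]
    intro x hx y hy
    have hx' : ((yauParam ht ht').symm x).1 = 0 := h1 hx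
    have hy' : ((yauParam ht ht').symm y).1 = 0 := h1 hy
    change ((yauParam ht ht').symm ⁅x, y⁆).1 = 0 ∧ ((yauParam ht ht').symm ⁅x, y⁆).2.1 = 0
    rw [yauParam_symm_lie]
    refine ⟨rfl, ?_⟩
    simp only [derBracket, hx', hy', zero_smul, sub_zero]
  refine LieAlgebra.IsSolvable.mk (R := ℂ) (k := 3) ?_
  rw [eq_bot_iff, LieAlgebra.derivedSeries_def, LieAlgebra.derivedSeriesOfIdeal_succ,
    LieSubmodule.lie_le_iff]
  intro x hx y hy
  have hx' : ((yauParam ht ht').symm x).1 = 0 ∧ ((yauParam ht ht').symm x).2.1 = 0 := h2 hx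
  have hy' : ((yauParam ht ht').symm y).1 = 0 ∧ ((yauParam ht ht').symm y).2.1 = 0 := h2 hy
  rw [LieSubmodule.mem_bot, ← LinearEquiv.map_eq_zero_iff (yauParam ht ht').symm,
    yauParam_symm_lie]
  simp only [derBracket, hx'.1, hx'.2, hy'.1, hy'.2]
  refine Prod.ext rfl (Prod.ext (by simp) ?_)
  funext l
  simp [socleBracket]

end

noncomputable section

open Matrix

/-! ### Continuity of the representations and solution of the third part -/

theorem continuous_quadShear (d : Fin 3 → Fin 6 → ℂ) (l : Fin 3) (m : Fin 6) :
    Continuous fun t => quadShear t d l m := by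
  fin_cases l <;> fin_cases m <;> simp [quadShear] <;> fun_prop

theorem continuous_socleCoeff (l : Fin 3) (m : Fin 6) : Continuous fun t => socleCoeff t l m := by
  fin_cases l <;> fin_cases m <;> simp [socleCoeff] <;> fun_prop

theorem continuous_quadShift_quadShear (d : Fin 3 → Fin 6 → ℂ) (m : Fin 6) :
    Continuous fun t => quadShift t (quadShear t d) m := by
  unfold quadShift
  exact (continuous_finsetSum _ fun n _ =>
    (continuous_quadShear d _ n).mul (continuous_socleCoeff _ n)).add
    (continuous_finsetSum _ fun n _ =>
      (continuous_quadShear d _ n).mul (continuous_socleCoeff _ n))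

/-- The entries of the representation matrices are continuous functions of the parameter. -/
theorem exists_continuous_entry (a : DerCoord) (i j : Fin 11) :
    ∃ F : ℂ → ℂ, Continuous F ∧ ∀ (t : ℂ) (ht : t ^ 3 ≠ -27) (ht' : t * (t ^ 3 - 216) ≠ 0),
      LinearMap.toMatrix (monomialBasis ht) (monomialBasis ht)
        (yauParam ht ht' a).toLinearMap i j = F t := by
  have hentry : ∀ (t : ℂ) (ht : t ^ 3 ≠ -27) (ht' : t * (t ^ 3 - 216) ≠ 0),
      LinearMap.toMatrix (monomialBasis ht) (monomialBasis ht)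
        (yauParam ht ht' a).toLinearMap i j =
      (monomialBasis ht).repr (yauParam ht ht' a (monomialBasis ht j)) i :=
    fun t ht ht' => LinearMap.toMatrix_apply _ _ _ _ _
  simp only [hentry]
  rcases fin_eleven_cases j with rfl | ⟨l, rfl⟩ | ⟨m, rfl⟩ | rfl
  · refine ⟨fun _ => 0, continuous_const, fun t ht ht' => ?_⟩
    rw [monomialBasis_zero, Derivation.map_one_eq_zero, map_zero]
    rfl
  · refine ⟨fun t => a.1 * Finsupp.single (linIdx l) (1 : ℂ) i +
      ∑ m, quadShear t a.2.1 l m * Finsupp.single (quadIdx m) (1 : ℂ) i +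
      a.2.2 l * Finsupp.single 10 (1 : ℂ) i, ?_, fun t ht ht' => ?_⟩
    · exact (continuous_const.add (continuous_finsetSum _ fun n _ =>
        (continuous_quadShear _ _ n).mul continuous_const)).add continuous_const
    · rw [monomialBasis_linIdx, yauParam_varClass, derValue_apply, coordShear_apply]
      simp only [← monomialBasis_linIdx ht, ← monomialBasis_quadIdx ht, ← monomialBasis_ten ht,
        map_add, map_sum, map_smul, Module.Basis.repr_self, Finsupp.add_apply,
        Finsupp.coe_finsetSum, Finset.sum_apply, Finsupp.smul_apply, smul_eq_mul]
  · refine ⟨fun t => 2 * a.1 * Finsupp.single (quadIdx m) (1 : ℂ) i +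
      quadShift t (quadShear t a.2.1) m * Finsupp.single 10 (1 : ℂ) i, ?_, fun t ht ht' => ?_⟩
    · exact continuous_const.add ((continuous_quadShift_quadShear _ _).mul continuous_const)
    · rw [monomialBasis_quadIdx, derivation_quadClass ht (yauParam_varClass ht ht' a),
        coordShear_apply]
      simp only [← monomialBasis_quadIdx ht, ← monomialBasis_ten ht,
        map_add, map_smul, Module.Basis.repr_self, Finsupp.add_apply, Finsupp.smul_apply,
        smul_eq_mul]
  · refine ⟨fun t => 3 * a.1 * Finsupp.single 10 (1 : ℂ) i, continuous_const, fun t ht ht' => ?_⟩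
    rw [monomialBasis_ten, derivation_socleClass ht (yauParam_varClass ht ht' a),
      coordShear_apply]
    simp only [← monomialBasis_ten ht, map_smul, Module.Basis.repr_self, Finsupp.smul_apply,
      smul_eq_mul]

theorem nonJump_ne_zero {ρ : ℂ} (hρ : IsPrimitiveRoot ρ 3) (t : nonJump hρ) :
    ((t : E6Param) : ℂ) * (((t : E6Param) : ℂ) ^ 3 - 216) ≠ 0 :=
  fun h => t.2 ((mem_jumpPoints_iff hρ _).2 h)

theorem exists_constant_yauAlgebra {ρ : ℂ} (hρ : IsPrimitiveRoot ρ 3) :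
    ∃ (L : Type) (_ : LieRing L) (_ : LieAlgebra ℂ L) (e : Module.Basis (Fin 22) ℂ L)
      (c : Fin 22 → Fin 22 → Fin 22 → ℂ)
      (Φ : ∀ t : nonJump hρ, L ≃ₗ⁅ℂ⁆ YauAlgebra (e6Poly (t : E6Param)) 1)
      (β : ∀ t : nonJump hρ, Module.Basis (Fin 11) ℂ (ModuliAlgebra (e6Poly (t : E6Param)) 1))
      (r : nonJump hρ → (L →ₗ[ℂ] Matrix (Fin 11) (Fin 11) ℂ)),
      LieAlgebra.IsSolvable L ∧
      (∀ t i j, ⁅Φ t (e i), Φ t (e j)⁆ = ∑ l, c i j l • Φ t (e l)) ∧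
      (∀ t i, β t i = toModuli (e6Poly (t : E6Param)) 1 (e6Monomial i)) ∧
      (∀ t x y, r t ⁅x, y⁆ = r t x * r t y - r t y * r t x) ∧
      (∀ t x, r t x = LinearMap.toMatrix (β t) (β t) (Φ t x).toLinearMap) ∧
      (∀ x, Continuous fun t : nonJump hρ => r t x) := by
  -- The Yau algebra at t = 1 serves as L; any parameter that is not a jump point would do.
  have h1 : (1 : ℂ) ^ 3 ≠ -27 := by norm_num
  have h1' : (1 : ℂ) * (1 ^ 3 - 216) ≠ 0 := by norm_num
  let e := (Module.finBasisOfFinrankEq ℂ DerCoord finrank_derCoord).map (yauParam h1 h1')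
  let Φ : ∀ t : nonJump hρ, YauAlgebra (e6Poly 1) 1 ≃ₗ⁅ℂ⁆ YauAlgebra (e6Poly (t : E6Param)) 1 :=
    fun t => yauTransport h1 h1' (t : E6Param).2 (nonJump_ne_zero hρ t)
  let β : ∀ t : nonJump hρ, Module.Basis (Fin 11) ℂ (ModuliAlgebra (e6Poly (t : E6Param)) 1) :=
    fun t => monomialBasis (t : E6Param).2
  refine ⟨YauAlgebra (e6Poly 1) 1, inferInstance, inferInstance, e,
    fun i j l => e.repr ⁅e i, e j⁆ l, Φ, β,
    fun t => { toFun := fun x => LinearMap.toMatrix (β t) (β t) (Φ t x).toLinearMap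
               map_add' := fun x y => ?_
               map_smul' := fun a x => ?_ },
    isSolvable_yauAlgebra h1 h1', fun t i j => ?_, fun t i => monomialBasis_apply _ i,
    fun t x y => ?_, fun t x => rfl, fun x => ?_⟩
  · rw [← map_add, map_add (Φ t)]
    rfl
  · rw [← map_smul, map_smul (Φ t)]
    rfl
  · rw [← LieEquiv.map_lie]
    conv_lhs => rw [← e.sum_repr ⁅e i, e j⁆]
    rw [map_sum]
    exact Finset.sum_congr rfl fun l _ => map_smul (Φ t) _ _
  · change LinearMap.toMatrix (β t) (β t) (Φ t ⁅x, y⁆).toLinearMap =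
      LinearMap.toMatrix (β t) (β t) (Φ t x).toLinearMap *
        LinearMap.toMatrix (β t) (β t) (Φ t y).toLinearMap -
      LinearMap.toMatrix (β t) (β t) (Φ t y).toLinearMap *
        LinearMap.toMatrix (β t) (β t) (Φ t x).toLinearMap
    rw [← LinearMap.toMatrix_comp, ← LinearMap.toMatrix_comp, ← map_sub, LieEquiv.map_lie]
    rfl
  · refine continuous_matrix fun i j => ?_
    obtain ⟨F, hF, hF'⟩ := exists_continuous_entry ((yauParam h1 h1').symm x) i j
    refine (hF.comp (continuous_subtype_val.comp continuous_subtype_val)).congr fun t => ?_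
    exact (hF' _ _ (nonJump_ne_zero hρ t)).symm

end

noncomputable section

open Matrix

/-! ### Contact equivalence -/

/-- Leading forms multiply: ab - a'b' = (a - a')b + a'(b - b'), and each summand gains one order. -/
theorem mul_sub_mul_mem_orderIdeal {m n : ℕ} {a a' b b' : FormalRing 3}
    (ha : a - a' ∈ orderIdeal (m + 1)) (ha' : a' ∈ orderIdeal m)
    (hb : b - b' ∈ orderIdeal (n + 1)) (hb' : b' ∈ orderIdeal n) :
    a * b - a' * b' ∈ orderIdeal (m + n + 1) := by
  have hb'' : b ∈ orderIdeal n := by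
    simpa using add_mem (orderIdeal_antitone (Nat.le_succ n) hb) hb'
  have h1 := mul_mem_orderIdeal ha hb''
  have h2 := mul_mem_orderIdeal ha' hb
  rw [add_right_comm] at h1
  rw [← add_assoc] at h2
  convert add_mem h1 h2 using 1
  ring

/-- Automorphisms preserve non-units, so the maximal ideal is preserved without any continuity
assumption. -/
theorem constantCoeff_algEquiv_X (φ : FormalRing 3 ≃ₐ[ℂ] FormalRing 3) (j : Fin 3) :
    MvPowerSeries.constantCoeff (φ (MvPowerSeries.X j)) = 0 := by
  by_contra h
  have h1 : IsUnit (φ (MvPowerSeries.X j)) := by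
    rw [MvPowerSeries.isUnit_iff_constantCoeff]
    exact isUnit_iff_ne_zero.2 h
  have h2 : IsUnit (MvPowerSeries.X j : FormalRing 3) := by
    simpa using h1.map φ.symm
  rw [MvPowerSeries.isUnit_iff_constantCoeff, MvPowerSeries.constantCoeff_X] at h2
  exact not_isUnit_zero h2

/-- The linear part of an automorphism of the power series ring. -/
def linearPart (φ : FormalRing 3 ≃ₐ[ℂ] FormalRing 3) : Matrix (Fin 3) (Fin 3) ℂ :=
  Matrix.of fun i j => MvPowerSeries.coeff (Finsupp.single i 1) (φ (MvPowerSeries.X j))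

theorem sub_linearSubst_X_mem (φ : FormalRing 3 ≃ₐ[ℂ] FormalRing 3) (j : Fin 3) :
    φ (MvPowerSeries.X j) - linearSubst (linearPart φ) (MvPowerSeries.X j) ∈ orderIdeal 2 := by
  classical
  rw [mem_orderIdeal]
  intro d hd
  rw [linearSubst_X, map_sub, map_sum, sub_eq_zero]
  rcases Nat.lt_succ_iff_lt_or_eq.1 hd with h0 | h1
  · have : d = 0 := by
      rw [← Finsupp.degree_eq_zero_iff]
      omega
    subst this
    simpa using constantCoeff_algEquiv_X φ j
  · obtain ⟨i, rfl⟩ : ∃ i, d = Finsupp.single i 1 := by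
      have h2 : d.degree = d 0 + d 1 + d 2 := by
        rw [Finsupp.degree_eq_sum, Fin.sum_univ_three]
      have h3 : (d 0 = 1 ∧ d 1 = 0 ∧ d 2 = 0) ∨ (d 0 = 0 ∧ d 1 = 1 ∧ d 2 = 0) ∨
          (d 0 = 0 ∧ d 1 = 0 ∧ d 2 = 1) := by omega
      rcases h3 with h | h | h
      · exact ⟨0, Finsupp.ext fun l => by fin_cases l <;> simp [h]⟩
      · exact ⟨1, Finsupp.ext fun l => by fin_cases l <;> simp [h]⟩
      · exact ⟨2, Finsupp.ext fun l => by fin_cases l <;> simp [h]⟩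
    simp [MvPowerSeries.coeff_X, linearPart, Finsupp.single_left_inj]

theorem linearSubst_X_mem_orderIdeal (B : Matrix (Fin 3) (Fin 3) ℂ) (j : Fin 3) :
    linearSubst B (MvPowerSeries.X j) ∈ orderIdeal 1 := by
  rw [linearSubst_X]
  exact sum_mem fun i _ => by
    rw [MvPowerSeries.smul_eq_C_mul]
    exact Ideal.mul_mem_left _ _ (X_mem_orderIdeal i)

theorem sub_linearSubst_e6Poly_mem (φ : FormalRing 3 ≃ₐ[ℂ] FormalRing 3) (t : ℂ) :
    φ (e6Poly t) - linearSubst (linearPart φ) (e6Poly t) ∈ orderIdeal 4 := by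
  have h := sub_linearSubst_X_mem φ
  have h' := linearSubst_X_mem_orderIdeal (linearPart φ)
  have h3 : ∀ i j k : Fin 3, φ (MvPowerSeries.X i * MvPowerSeries.X j * MvPowerSeries.X k) -
      linearSubst (linearPart φ) (MvPowerSeries.X i * MvPowerSeries.X j * MvPowerSeries.X k) ∈
        orderIdeal 4 := by
    intro i j k
    rw [map_mul, map_mul, map_mul, map_mul]
    exact mul_sub_mul_mem_orderIdeal (m := 2) (n := 1)
      (mul_sub_mul_mem_orderIdeal (m := 1) (n := 1) (h i) (h' i) (h j) (h' j))
      (mul_mem_orderIdeal (h' i) (h' j)) (h k) (h' k)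
  have hC : ∀ c : ℂ, φ (MvPowerSeries.C c) = MvPowerSeries.C c := fun c => φ.commutes c
  have h4 := add_mem (add_mem (add_mem (h3 0 0 0) (h3 1 1 1)) (h3 2 2 2))
    (Ideal.mul_mem_left _ (MvPowerSeries.C t) (h3 0 1 2))
  convert h4 using 1
  simp only [e6Poly, map_add, map_mul, map_pow, hC, linearSubst_C]
  ring

/-- Both cubics are homogeneous, so the 3-jet of φ f_t = u f_s involves only the linear part of φ
and the constant term of u: a contact equivalence yields a linear one, to which the result on G
applies. -/
theorem exists_smul_eq_of_contactEquivalent {ρ : ℂ} (hρ : IsPrimitiveRoot ρ 3) {t s : E6Param}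
    (h : ContactEquivalent (e6Poly t) (e6Poly s)) : ∃ σ : groupH hρ, σ • t = s := by
  obtain ⟨φ, u, hu⟩ := h
  set B := linearPart φ
  have h1 : linearSubst B (e6Poly t) - u * e6Poly s ∈ orderIdeal 4 := by
    rw [← hu, ← neg_sub]
    exact neg_mem (sub_linearSubst_e6Poly_mem φ t)
  have h2 := hesseCubic_comp_of_sub_mem h1
  set c := MvPowerSeries.constantCoeff (u : FormalRing 3)
  have hc : c ≠ 0 := ((u.isUnit.map (MvPowerSeries.constantCoeff (σ := Fin 3) (R := ℂ)))).ne_zero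
  -- If det B were 0, covariance would make the Hessian of c·f_s vanish, but its coefficients -6c³s²
  -- and c³(216 + 2s³) are not both zero.
  have hB : B.det ≠ 0 := by
    intro h0
    have h3 := hesseCubic_hessian_covariant (fun p => (h2 p).trans (hesseCubic_mul c 1 s p))
    rw [det_transpose, h0] at h3
    have h4 := hesseCubic_coeffs (a := 0) (b := 0) (fun p => by
      rw [← h3 p]
      simp [hesseCubic])
    obtain ⟨h5, h6⟩ := h4
    have h7 : c ^ 3 * (s : ℂ) ^ 2 = 0 := by linear_combination h5 / 6
    have h8 : (s : ℂ) ^ 2 = 0 := (mul_eq_zero.1 h7).resolve_left (pow_ne_zero 3 hc)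
    have h9 : c ^ 3 = 0 := by
      linear_combination -h6 / 216 - c ^ 3 * (s : ℂ) / 108 * h8
    exact pow_ne_zero 3 hc h9
  obtain ⟨hG, e⟩ := mk_mem_groupG_and_paramHom hρ
    (B := GeneralLinearGroup.mkOfDetNeZero B hB) (t := t) (s := s) (c := c) h2
  exact ⟨_, e⟩

/-- A rational function of the parameter whose cube is invariant under the group `H`. -/
def hesseInvariant (t : E6Param) : ℂ := (t : ℂ) * (216 - (t : ℂ) ^ 3) / ((t : ℂ) ^ 3 + 27)

theorem hesseInvariant_mapR (t : E6Param) : hesseInvariant (mapR t) = hesseInvariant t := by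
  have h1 := three_add_ne_zero t
  have h2 : (t : ℂ) ^ 3 + 27 ≠ 0 := fun h => t.2 (by linear_combination h)
  have h3 : ((mapR t : E6Param) : ℂ) ^ 3 + 27 ≠ 0 := fun h => (mapR t).2 (by linear_combination h)
  rw [hesseInvariant, hesseInvariant, div_eq_div_iff h3 h2]
  change (18 - 3 * (t : ℂ)) / (3 + t) * (216 - ((18 - 3 * (t : ℂ)) / (3 + t)) ^ 3) *
    ((t : ℂ) ^ 3 + 27) = (t : ℂ) * (216 - (t : ℂ) ^ 3) *
      (((18 - 3 * (t : ℂ)) / (3 + t)) ^ 3 + 27)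
  field_simp
  ring

theorem hesseInvariant_groupH {ρ : ℂ} (hρ : IsPrimitiveRoot ρ 3) {σ : Equiv.Perm E6Param}
    (hσ : σ ∈ groupH hρ) : ∀ t, hesseInvariant (σ t) ^ 3 = hesseInvariant t ^ 3 := by
  induction hσ using Subgroup.closure_induction with
  | mem σ h =>
    intro t
    rcases h with rfl | rfl
    · have h1 : ((permP hρ t : E6Param) : ℂ) = ρ * t := rfl
      rw [hesseInvariant, hesseInvariant, h1, mul_pow ρ, hρ.pow_eq_one, one_mul, mul_assoc,
        mul_div_assoc, mul_pow ρ, hρ.pow_eq_one, one_mul]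
    · exact congrArg (· ^ 3) (hesseInvariant_mapR t)
  | one => exact fun _ => rfl
  | mul σ τ _ _ h1 h2 => exact fun t => (h1 (τ t)).trans (h2 t)
  | inv σ _ h => exact fun t => by simpa using (h (σ⁻¹ t)).symm

theorem exists_not_contactEquivalent {ρ : ℂ} (hρ : IsPrimitiveRoot ρ 3) :
    ∃ t s : nonJump hρ,
      Nonempty (YauAlgebra (e6Poly (t : E6Param)) 1 ≃ₗ⁅ℂ⁆ YauAlgebra (e6Poly (s : E6Param)) 1) ∧
      ¬ ContactEquivalent (e6Poly (t : E6Param)) (e6Poly (s : E6Param)) := by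
  -- The invariant is 215/28 at 1 and 416/35 at 2, and the cubes of these numbers differ.
  let t : nonJump hρ := ⟨⟨1, by norm_num⟩, fun h => by
    have := (mem_jumpPoints_iff hρ _).1 h
    norm_num at this⟩
  let s : nonJump hρ := ⟨⟨2, by norm_num⟩, fun h => by
    have := (mem_jumpPoints_iff hρ _).1 h
    norm_num at this⟩
  refine ⟨t, s, ⟨yauTransport (t : E6Param).2 (nonJump_ne_zero hρ t) (s : E6Param).2
    (nonJump_ne_zero hρ s)⟩, fun h => ?_⟩
  obtain ⟨σ, hσ⟩ := exists_smul_eq_of_contactEquivalent hρ h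
  have h1 := hesseInvariant_groupH hρ σ.2 (t : E6Param)
  change hesseInvariant (σ • (t : E6Param)) ^ 3 = _ at h1
  rw [hσ] at h1
  norm_num [hesseInvariant, t, s] at h1

end

theorem theoremA (ρ : ℂ) (hρ : IsPrimitiveRoot ρ 3) :
    -- the groups `G` and `H`, and the homomorphism `π`
    Nat.card (groupG hρ) = 216 ∧
    Nat.card (groupH hρ) = 12 ∧
    Nonempty (groupH hρ ≃* alternatingGroup (Fin 4)) ∧
    (∃ π : groupG hρ →* groupH hρ,
      (∀ i : Fin 4, (π (genG hρ i) : Equiv.Perm E6Param) = ![permP hρ, permR, 1, 1] i) ∧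
      -- the cases `k = 0` and `k = 1`, away from the jump points
      (∀ k : ℕ∞, k = 0 ∨ k = 1 →
        ∃ F : CategoryTheory.Functor (E6NonJumpGroupoid hρ k) (ActionGroupoid π (nonJump hρ)),
          (∀ t : E6NonJumpGroupoid hρ k, ((F.obj t).point : E6Param) = t.obj.param) ∧
          (∀ (t s : E6NonJumpGroupoid hρ k) (m : t ⟶ s), ∃ B : Matrix.GeneralLinearGroup (Fin 3) ℂ,
            E6Groupoid.HasMatrix m.hom B ∧
            ((ActionGroupoid.element (π := π) (F.map m) : groupG hρ) : Matrix.ProjGenLinGroup (Fin 3) ℂ) =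
              Matrix.ProjGenLinGroup.mk B) ∧
          F.Full ∧ F.Faithful) ∧
      -- the cases `2 ≤ k ≤ ∞`, for all parameters
      (∀ k : ℕ∞, 2 ≤ k →
        ∃ F : CategoryTheory.Functor (E6Groupoid k) (ActionGroupoid π E6Param),
          (∀ t : E6Groupoid k, (F.obj t).point = t.param) ∧
          (∀ (t s : E6Groupoid k) (m : t ⟶ s), ∃ B : Matrix.GeneralLinearGroup (Fin 3) ℂ,
            E6Groupoid.HasMatrix m B ∧
            ((ActionGroupoid.element (π := π) (F.map m) : groupG hρ) : Matrix.ProjGenLinGroup (Fin 3) ℂ) =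
              Matrix.ProjGenLinGroup.mk B) ∧
          F.Full ∧ F.Faithful)) ∧
    -- the constant Lie algebra and its representations
    (∃ (L : Type) (_ : LieRing L) (_ : LieAlgebra ℂ L) (e : Module.Basis (Fin 22) ℂ L)
      (c : Fin 22 → Fin 22 → Fin 22 → ℂ)
      (Φ : ∀ t : nonJump hρ, L ≃ₗ⁅ℂ⁆ YauAlgebra (e6Poly (t : E6Param)) 1)
      (β : ∀ t : nonJump hρ, Module.Basis (Fin 11) ℂ (ModuliAlgebra (e6Poly (t : E6Param)) 1))
      (r : nonJump hρ → (L →ₗ[ℂ] Matrix (Fin 11) (Fin 11) ℂ)),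
      LieAlgebra.IsSolvable L ∧
      (∀ t i j, ⁅Φ t (e i), Φ t (e j)⁆ = ∑ l, c i j l • Φ t (e l)) ∧
      (∀ t i, β t i = toModuli (e6Poly (t : E6Param)) 1 (e6Monomial i)) ∧
      (∀ t x y, r t ⁅x, y⁆ = r t x * r t y - r t y * r t x) ∧
      (∀ t x, r t x = LinearMap.toMatrix (β t) (β t) (Φ t x).toLinearMap) ∧
      (∀ x, Continuous fun t : nonJump hρ => r t x)) ∧
    -- no Torelli-type theorem
    (∃ t s : nonJump hρ,
      Nonempty (YauAlgebra (e6Poly (t : E6Param)) 1 ≃ₗ⁅ℂ⁆ YauAlgebra (e6Poly (s : E6Param)) 1) ∧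
      ¬ ContactEquivalent (e6Poly (t : E6Param)) (e6Poly (s : E6Param))) := by
  refine ⟨card_groupG hρ, card_groupH hρ, ⟨groupHEquiv hρ⟩,
    ⟨paramHom hρ, paramHom_genG hρ, fun k hk => ?_, fun k hk => exists_functor_of_two_le hρ hk⟩,
    exists_constant_yauAlgebra hρ, exists_not_contactEquivalent hρ⟩
  obtain ⟨j, hj, rfl⟩ : ∃ j : ℕ, j ≤ 1 ∧ (j : ℕ∞) = k := by
    rcases hk with rfl | rfl
    · exact ⟨0, zero_le_one, Nat.cast_zero⟩
    · exact ⟨1, le_rfl, Nat.cast_one⟩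
  exact exists_functor_of_le_one hρ hj
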